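/- Let $(z,\zeta,w)$ be coordinates on $\mathbb{C}^3$, with $w=u+iv$. Consider germs at $0$ of real-analytic rigid hypersurfaces $M^5=\{u=F(z,\zeta,\bar z,\bar\zeta)\}\subset\mathbb{C}^3$, where $F$ is a real-valued real-analytic function near $0$ with $F(0)=0$. Say that $M\in\mathfrak{C}_{2,1}$ if the Levi matrix $\begin{pmatrix}F_{z\bar z}&F_{z\bar\zeta}\\F_{\zeta\bar z}&F_{\zeta\bar\zeta}\end{pmatrix}$ has rank exactly $1$ at every point near $0$ and $M$ is 2-nondegenerate at $0$, i.e. the vectors $\partial_{\bar z}^{\alpha_1}\partial_{\bar\zeta}^{\alpha_2}(F_z,F_\zeta)(0)$ with $1\le\alpha_1+\alpha_2\le2$ span $\mathbb{C}^2$. (When $F_{z\bar z}(0)\ne0$, which a linear change of $(z,\zeta)$ always achieves, these conditions amount to $F_{z\bar z}F_{\zeta\bar\zeta}-F_{z\bar\zeta}F_{\zeta\bar z}\equiv0$ near $0$ and $F_{z\bar z}F_{zz\bar\zeta}-F_{z\bar\zeta}F_{zz\bar z}\neq0$ at $0$.) A rigid biholomorphism is a germ at $0$ of a biholomorphism fixing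 the origin, of the form $(z,\zeta,w)\mapsto(f(z,\zeta),g(z,\zeta),\rho w+h(z,\zeta))$ with $f,g,h$ holomorphic and $\rho\in\mathbb{R}\setminus\{0\}$; two germs of hypersurfaces are rigidly equivalent if such a map takes one onto the other. Put $$m(z,\zeta,\bar z,\bar\zeta)=\frac{z\bar z+\frac12z^2\bar\zeta+\frac12\bar z^2\zeta}{1-\zeta\bar\zeta}.$$ A hypersurface is in normal form if its equation is $u=m+G$ with $G=\sum_{a,b,c,d\ge0}G_{a,b,c,d}\,z^a\zeta^b\bar z^c\bar\zeta^d$ convergent near $0$ and (1) $G_{a,b,c,d}=0$ whenever $a+c\le2$, that is, $G=O_{z,\bar z}(3)$; (2) $G_{a,b,0,0}=G_{a,b,1,0}=G_{a,b,2,0}=0$ and $G_{0,0,c,d}=G_{1,0,c,d}=G_{2,0,c,d}=0$ for all $a,b,c,d\ge0$; (3) $G_{3,0,0,1}=0=G_{0,1,3,0}$ and $\operatorname{Im}G_{3,0,1,1}=0=\operatorname{Im}G_{1,1,3,0}$. **Theorem.** (i) Every $M\in\mathfrak{C}_{2,1}$ is rigidly equivalent to some $M'\in\mathfrak{C}_{2,1}$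 in normal form. (ii) Two hypersurfaces $M=\{u=m+G\}$ and $M'=\{u=m+G'\}$ in $\mathfrak{C}_{2,1}$, both in normal form, are rigidly equivalent if and only if there exist $\rho>0$ and $\varphi\in\mathbb{R}$ such that, for all $a,b,c,d\ge0$, $$G_{a,b,c,d}=G'_{a,b,c,d}\,\rho^{\frac{a+c-2}{2}}\,e^{i\varphi(a+2b-c-2d)}.$$ -/

import Mathlib

open Complex Filter Topology

/-- The coordinate directions of `ℂ² ∋ (z, ζ)`: index `0` is `z`, index `1` is `ζ`. -/
def coordDir (j : Fin 2) : ℂ × ℂ := ![(1, 0), (0, 1)] j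

/-- The Wirtinger derivative `∂/∂z_j = (∂/∂x_j - i ∂/∂y_j) / 2`. -/
noncomputable def dHol (j : Fin 2) (φ : ℂ × ℂ → ℂ) (p : ℂ × ℂ) : ℂ :=
  (fderiv ℝ φ p (coordDir j) - I * fderiv ℝ φ p (I • coordDir j)) / 2

/-- The Wirtinger derivative `∂/∂z̄_j = (∂/∂x_j + i ∂/∂y_j) / 2`. -/
noncomputable def dAnti (j : Fin 2) (φ : ℂ × ℂ → ℂ) (p : ℂ × ℂ) : ℂ :=
  (fderiv ℝ φ p (coordDir j) + I * fderiv ℝ φ p (I • coordDir j)) / 2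

/-- The rigid hypersurface `u = F(z, ζ, z̄, ζ̄)` of `ℂ³ ∋ (z, ζ, w)`, where `w = u + i v`.
Only its germ at the origin is used. -/
def rigidHypersurface (F : ℂ × ℂ → ℝ) : Set (ℂ × ℂ × ℂ) :=
  {P | P.2.2.re = F (P.1, P.2.1)}

/-- The Levi matrix `(∂²F / ∂z_j ∂z̄_k)` of `u = F`, which does not depend on `v`. -/
noncomputable def leviMatrix (F : ℂ × ℂ → ℝ) (p : ℂ × ℂ) : Matrix (Fin 2) (Fin 2) ℂ :=
  Matrix.of fun j k => dHol j (dAnti k fun q => (F q : ℂ)) p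

/-- The holomorphic gradient `(∂_z, ∂_ζ)` of a function at `p`. -/
noncomputable def holGrad (φ : ℂ × ℂ → ℂ) (p : ℂ × ℂ) : Fin 2 → ℂ := fun j => dHol j φ p

/-- `u = F` is finitely nondegenerate of order at most two at the point over `p`: the vectors
`L̄^α ρ_Z` with `|α| ≤ 2`, where `ρ = w + w̄ - 2F`, span `ℂ³`. As `F` does not depend on `v`,
this says that the vectors `∂̄^α (F_z, F_ζ)` with `1 ≤ |α| ≤ 2` span `ℂ²`. If the Levi matrix has
rank one near `p` and `F_{z z̄}(p) ≠ 0`, it is the nonvanishing at `p` of the determinant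
`F_{z z̄} F_{z z ζ̄} - F_{z ζ̄} F_{z z z̄}`. -/
def SpansAtOrderTwo (F : ℂ × ℂ → ℝ) (p : ℂ × ℂ) : Prop :=
  Submodule.span ℂ
    ((Set.range fun k : Fin 2 => holGrad (dAnti k fun q => (F q : ℂ)) p) ∪
      (Set.range fun kl : Fin 2 × Fin 2 =>
        holGrad (dAnti kl.1 (dAnti kl.2 fun q => (F q : ℂ))) p)) = ⊤

/-- The class of germs at `0` of real-analytic rigid hypersurfaces `u = F` through the origin whose
Levi form has constant rank one near the origin and which are 2-nondegenerate. (Rank one excludes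
nondegeneracy of order one, and the spanning condition is open.) -/
structure InClassC21 (F : ℂ × ℂ → ℝ) : Prop where
  analytic : AnalyticAt ℝ F 0
  through_origin : F 0 = 0
  levi_rank_one : ∀ᶠ p in 𝓝 (0 : ℂ × ℂ), (leviMatrix F p).rank = 1
  two_nondegenerate : SpansAtOrderTwo F 0

/-- The Gaussier–Merker function
`m = (z z̄ + z² ζ̄ / 2 + z̄² ζ / 2) / (1 - ζ ζ̄)` (its values are real). -/
noncomputable def gmModel (z ζ : ℂ) : ℂ :=
  (z * star z + 1 / 2 * z ^ 2 * star ζ + 1 / 2 * star z ^ 2 * ζ) / (1 - ζ * star ζ)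

/-- `H` is (the germ at `0` of) a rigid biholomorphism fixing the origin,
`(z, ζ, w) ↦ (f(z, ζ), g(z, ζ), ρ w + h(z, ζ))` with `f, g, h` holomorphic near `0`, `ρ ∈ ℝ^*`
and nonzero Jacobian at `0`. -/
def IsRigidBiholomorphism (H : ℂ × ℂ × ℂ → ℂ × ℂ × ℂ) : Prop :=
  ∃ (f g h : ℂ × ℂ → ℂ) (ρ : ℝ),
    AnalyticAt ℂ f 0 ∧ AnalyticAt ℂ g 0 ∧ AnalyticAt ℂ h 0 ∧
    f 0 = 0 ∧ g 0 = 0 ∧ h 0 = 0 ∧ ρ ≠ 0 ∧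
    fderiv ℂ f 0 (1, 0) * fderiv ℂ g 0 (0, 1) - fderiv ℂ f 0 (0, 1) * fderiv ℂ g 0 (1, 0) ≠ 0 ∧
    ∀ z ζ w : ℂ, H (z, ζ, w) = (f (z, ζ), g (z, ζ), (ρ : ℂ) * w + h (z, ζ))

/-- The germs at the origin of `M` and `M'` are rigidly equivalent: some rigid biholomorphism `H`
fixing the origin satisfies `H(M ∩ U) = M' ∩ H(U)` for a neighbourhood `U` of `0`. -/
def RigidlyEquivalent (M M' : Set (ℂ × ℂ × ℂ)) : Prop :=
  ∃ H : ℂ × ℂ × ℂ → ℂ × ℂ × ℂ, IsRigidBiholomorphism H ∧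
    ∀ᶠ P in 𝓝 (0 : ℂ × ℂ × ℂ), P ∈ M ↔ H P ∈ M'

/-- Near the origin, `φ` is the sum of the convergent power series
`∑ G_{a,b,c,d} z^a ζ^b z̄^c ζ̄^d`. -/
def HasExpansion (φ : ℂ × ℂ → ℂ) (G : ℕ → ℕ → ℕ → ℕ → ℂ) : Prop :=
  ∀ᶠ p in 𝓝 (0 : ℂ × ℂ),
    HasSum (fun n : ℕ × ℕ × ℕ × ℕ =>
      G n.1 n.2.1 n.2.2.1 n.2.2.2 *
        (p.1 ^ n.1 * p.2 ^ n.2.1 * star p.1 ^ n.2.2.1 * star p.2 ^ n.2.2.2)) (φ p)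

/-- The equation `u = F` reads `u = m + G` and is in normal form. -/
structure IsNormalForm (F : ℂ × ℂ → ℝ) (G : ℕ → ℕ → ℕ → ℕ → ℂ) : Prop where
  expansion : HasExpansion (fun p => (F p : ℂ) - gmModel p.1 p.2) G
  /-- `G = O_{z, z̄}(3)` -/
  order_three : ∀ a b c d, a + c < 3 → G a b c d = 0
  prenormal_zero : ∀ a b, G a b 0 0 = 0
  prenormal_zero_conj : ∀ c d, G 0 0 c d = 0
  prenormal_one : ∀ a b, G a b 1 0 = 0
  prenormal_one_conj : ∀ c d, G 1 0 c d = 0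
  prenormal_two : ∀ a b, G a b 2 0 = 0
  prenormal_two_conj : ∀ c d, G 2 0 c d = 0
  sporadic_order_four : G 3 0 0 1 = 0
  sporadic_order_four_conj : G 0 1 3 0 = 0
  sporadic_order_five : (G 3 0 1 1).im = 0
  sporadic_order_five_conj : (G 1 1 3 0).im = 0

/-! Polarize: replace z̄ and ζ̄ by independent variables w and η. A real-analytic F becomes a
holomorphic germ Φ(Z, W) with Z = (z, ζ), W = (w, η), Hermitian under `polSwap`. Nothing is lost,
because W = Z̄ is a totally real subspace on which a holomorphic germ is determined
(`eventuallyEq_of_polDiag`). A rigid equivalence given by φ = (f, g), h and ρ becomes the single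
identity ρ Φ(Z, W) + (h(Z) + h̄(W)) / 2 = Φ'(φ(Z), φ̄(W)) (`IsPolarization.identity`).

Call Φ prenormal if Φ = 0, Φ_w = z and Φ_ww = ζ on {W = 0}. Agreement with the model up to order
three in (z, w) is then automatic (`Prenormal.leaf`). Since the Levi determinant vanishes
identically, the coefficient k of the kernel field k ∂_z + ∂_ζ is annihilated by the conjugate
kernel field l ∂_w + ∂_η, and conversely (`levi_kernel_involutive`). On z = w = 0 both k and l
vanish, and their first derivatives solve a Goursat problem with the same data as those of the model
(`levi_kernel_leaf`, `goursat_unique`). This determines Φ and its first and second derivatives in z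
and w there. So, for hypersurfaces in the class, a normal form is the same thing as a prenormal Φ
with S₄ = Φ_zzzη(0) = 0 and S₅ = Φ_zzzwη(0) real (`IsNormalForm.of_prenormal`,
`IsNormalForm.prenormal`).

Uniqueness: for prenormal Φ, the restriction of Φ_η to {W = 0} is a function κ(z) = z²/2 + S₄ z³/6 +
... of z alone. Comparing the derivatives ∂_w, ∂_η and ∂_w² of the identity on {W = 0}, with S₄ = 0
on both sides, forces f = λz and g = (λ/λ̄) ζ + c κ'(λz) with κ' the function of the target, ρ =
|λ|² and c imaginary (`Prenormal.map_eq`). Moreover S₅ = ρ (S₅' + 3c), so c = 0 once both S₅ and S₅'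
are real. Only (z, ζ) ↦ (λz, (λ/λ̄) ζ) remains, and it acts diagonally on the coefficients.

Existence: a linear change makes the Levi matrix at 0 equal to diag(s, 0); rescaling w and absorbing
Φ(Z, 0) gives `LeviNormalized`. New coordinates f = ∂_u Φ(Z, 0) and g = (∂_u² + ∂_v) Φ(Z, 0), for
suitable antiholomorphic vectors u and v, make Φ prenormal, and a free component of u serves to kill
S₄ (`LeviNormalized.exists_prenormal`). A shear ζ ↦ ζ - c κ(z) with c imaginary preserves all this
and adds 3c to S₅ (`Prenormal.shear`). -/

section MonomialSeries

/-! ### Convergent power series in several complex variables -/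

variable {ι : Type*} [Fintype ι]

/-- The monomial `v ^ n` in several complex variables. -/
def monom (n : ι → ℕ) (v : ι → ℂ) : ℂ := ∏ i, v i ^ n i

/-- Near the origin, `Φ` is the sum of the power series with coefficients `G`. -/
def HasMonomialSum (Φ : (ι → ℂ) → ℂ) (G : (ι → ℕ) → ℂ) : Prop :=
  ∀ᶠ v in 𝓝 (0 : ι → ℂ), HasSum (fun n => G n * monom n v) (Φ v)

theorem monom_zero_apply (n : ι → ℕ) (hn : n ≠ 0) : monom n (0 : ι → ℂ) = 0 := by
  obtain ⟨i, hi⟩ := Function.ne_iff.1 hn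
  exact Finset.prod_eq_zero (Finset.mem_univ i) (by simpa using hi)

theorem HasMonomialSum.apply_zero {Φ : (ι → ℂ) → ℂ} {G : (ι → ℕ) → ℂ}
    (h : HasMonomialSum Φ G) : Φ 0 = G 0 := by
  have h0 := h.self_of_nhds
  have h1 := hasSum_single (f := fun n => G n * monom n (0 : ι → ℂ)) 0
    (fun n hn => by simp [monom_zero_apply n hn])
  have := h0.unique h1
  simpa [monom] using this

theorem norm_monom_le (n : ι → ℕ) {v : ι → ℂ} {r : ℝ} (hv : ‖v‖ ≤ r) :
    ‖monom n v‖ ≤ ∏ i, r ^ n i := by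
  rw [monom, norm_prod]
  refine Finset.prod_le_prod (fun _ _ => norm_nonneg _) fun i _ => ?_
  rw [norm_pow]
  exact pow_le_pow_left₀ (norm_nonneg _) ((norm_le_pi_norm v i).trans hv) _

/-- Summability in ℂ is absolute, so convergence at a single point whose coordinates all equal a
positive number dominates the series on a whole polydisc. -/
theorem exists_summable_of_eventually {G : (ι → ℕ) → ℂ}
    (h : ∀ᶠ t : ℝ in 𝓝 0, Summable fun n => G n * monom n fun _ : ι => (t : ℂ)) :
    ∃ r > 0, Summable fun n => ‖G n‖ * ∏ i, r ^ n i := by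
  obtain ⟨ε, hε, h⟩ := Metric.eventually_nhds_iff.1 h
  refine ⟨ε / 2, half_pos hε, ?_⟩
  have := (h (y := ε / 2) (by simp [abs_of_pos hε, hε])).norm
  refine this.congr fun n => ?_
  simp [monom, abs_of_pos hε]

theorem HasMonomialSum.exists_summable {Φ : (ι → ℂ) → ℂ} {G : (ι → ℕ) → ℂ}
    (h : HasMonomialSum Φ G) : ∃ r > 0, Summable fun n => ‖G n‖ * ∏ i, r ^ n i := by
  apply exists_summable_of_eventually
  have hc : Tendsto (fun t : ℝ => fun _ : ι => (t : ℂ)) (𝓝 0) (𝓝 0) := by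
    have : Continuous (fun t : ℝ => fun _ : ι => (t : ℂ)) := by fun_prop
    simpa [Pi.zero_def] using this.tendsto 0
  exact (hc.eventually h).mono fun t ht => ht.summable

theorem hasMonomialSum_tsum {G : (ι → ℕ) → ℂ} {r : ℝ} (hr : 0 < r)
    (h : Summable fun n => ‖G n‖ * ∏ i, r ^ n i) :
    HasMonomialSum (fun v => ∑' n, G n * monom n v) G := by
  filter_upwards [Metric.ball_mem_nhds 0 hr] with v hv
  refine (Summable.of_norm_bounded h fun n => ?_).hasSum
  rw [norm_mul]
  exact mul_le_mul_of_nonneg_left (norm_monom_le n (mem_ball_zero_iff.1 hv).le) (norm_nonneg _)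

/-- Since k ≤ 2 ^ k, halving the radius pays for the factor k that differentiation of a k-th power
produces. At k = 0 that factor makes the truncated exponent harmless. -/
theorem natCast_mul_half_pow_le {r : ℝ} (hr : 0 < r) (k : ℕ) :
    (k : ℝ) * (r / 2) ^ (k - 1) ≤ 2 / r * r ^ k := by
  rcases k with _ | m
  · simp; positivity
  · have h2 : ((m + 1 : ℕ) : ℝ) ≤ 2 ^ (m + 1) := by exact_mod_cast Nat.lt_two_pow_self.le
    calc ((m + 1 : ℕ) : ℝ) * (r / 2) ^ m ≤ 2 ^ (m + 1) * (r / 2) ^ m := by gcongr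
      _ = 2 / r * r ^ (m + 1) := by rw [div_pow]; field_simp; ring

theorem norm_proj_le_one (i : ι) :
    ‖ContinuousLinearMap.proj (R := ℂ) (φ := fun _ : ι => ℂ) i‖ ≤ 1 :=
  ContinuousLinearMap.opNorm_le_bound _ zero_le_one fun x => by
    simpa using norm_le_pi_norm x i

variable [DecidableEq ι]

/-- The derivative of a monomial. -/
noncomputable def monomDeriv (n : ι → ℕ) (v : ι → ℂ) : (ι → ℂ) →L[ℂ] ℂ :=
  ∑ i, (∏ j ∈ Finset.univ.erase i, v j ^ n j) •
    ((n i * v i ^ (n i - 1)) • ContinuousLinearMap.proj (R := ℂ) (φ := fun _ : ι => ℂ) i)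

theorem hasFDerivAt_monom (n : ι → ℕ) (v : ι → ℂ) :
    HasFDerivAt (monom n) (monomDeriv n v) v := by
  unfold monom monomDeriv
  refine HasFDerivAt.finsetProd fun i _ => ?_
  exact ((hasDerivAt_pow (n i) (v i)).comp_hasFDerivAt v
    (ContinuousLinearMap.proj (R := ℂ) (φ := fun _ : ι => ℂ) i).hasFDerivAt)

theorem norm_monomDeriv_le (n : ι → ℕ) {v : ι → ℂ} {r : ℝ} (hr : 0 < r) (hv : ‖v‖ ≤ r / 2) :
    ‖monomDeriv n v‖ ≤ Fintype.card ι * (2 / r) * ∏ i, r ^ n i := by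
  have key : ∀ i ∈ (Finset.univ : Finset ι), ‖(∏ j ∈ Finset.univ.erase i, v j ^ n j) •
    ((n i * v i ^ (n i - 1)) • ContinuousLinearMap.proj (R := ℂ) (φ := fun _ : ι => ℂ) i)‖ ≤
      (2 / r) * ∏ i, r ^ n i := by
    intro i _
    have hvi : ∀ j, ‖v j‖ ≤ r / 2 := fun j => (norm_le_pi_norm v j).trans hv
    rw [norm_smul, norm_smul, norm_mul, norm_prod, norm_pow, Complex.norm_natCast]
    have h1 : ∏ j ∈ Finset.univ.erase i, ‖v j ^ n j‖ ≤ ∏ j ∈ Finset.univ.erase i, r ^ n j := by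
      refine Finset.prod_le_prod (fun _ _ => norm_nonneg _) fun j _ => ?_
      rw [norm_pow]
      exact pow_le_pow_left₀ (norm_nonneg _) ((hvi j).trans (by linarith)) _
    have h2 : (n i : ℝ) * ‖v i‖ ^ (n i - 1) ≤ 2 / r * r ^ n i :=
      (mul_le_mul_of_nonneg_left (pow_le_pow_left₀ (norm_nonneg _) (hvi i) _)
        (Nat.cast_nonneg _)).trans (natCast_mul_half_pow_le hr _)
    calc _ ≤ (∏ j ∈ Finset.univ.erase i, r ^ n j) * ((2 / r * r ^ n i) * 1) := by
          refine mul_le_mul h1 (mul_le_mul h2 (norm_proj_le_one i) (norm_nonneg _) (by positivity))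
            (by positivity) (Finset.prod_nonneg fun _ _ => by positivity)
      _ = 2 / r * (r ^ n i * ∏ j ∈ Finset.univ.erase i, r ^ n j) := by ring
      _ = _ := by rw [Finset.mul_prod_erase Finset.univ (fun j => r ^ n j) (Finset.mem_univ i)]
  refine (norm_sum_le_of_le _ key).trans ?_
  simp [mul_assoc]

theorem monomDeriv_single (n : ι → ℕ) (v : ι → ℂ) (i : ι) :
    monomDeriv (n + Pi.single i 1) v (Pi.single i 1) = (n i + 1) * monom n v := by
  unfold monomDeriv
  rw [sum_apply, Finset.sum_eq_single i]
  · have : ∏ j ∈ Finset.univ.erase i, v j ^ (n + Pi.single i 1 : ι → ℕ) j =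
        ∏ j ∈ Finset.univ.erase i, v j ^ n j :=
      Finset.prod_congr rfl fun j hj => by
        simp [Pi.single_eq_of_ne (Finset.ne_of_mem_erase hj)]
    simp only [this, monom, ← Finset.mul_prod_erase Finset.univ (fun j => v j ^ n j)
      (Finset.mem_univ i)]
    simp
    ring
  · intro j _ hj
    simp [Pi.single_eq_of_ne hj]
  · simp

theorem monomDeriv_single_of_eq_zero (n : ι → ℕ) (v : ι → ℂ) (i : ι) (h : n i = 0) :
    monomDeriv n v (Pi.single i 1) = 0 := by
  unfold monomDeriv
  rw [sum_apply]
  refine Finset.sum_eq_zero fun j _ => ?_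
  by_cases hj : j = i
  · subst hj; simp [h]
  · simp [Pi.single_eq_of_ne hj]

theorem HasMonomialSum.hasFDerivAt {Φ : (ι → ℂ) → ℂ} {G : (ι → ℕ) → ℂ}
    (h : HasMonomialSum Φ G) :
    ∀ᶠ v in 𝓝 (0 : ι → ℂ), DifferentiableAt ℂ Φ v ∧
      HasSum (fun n => G n • monomDeriv n v) (fderiv ℂ Φ v) := by
  obtain ⟨r, hr, hs⟩ := h.exists_summable
  have hΦ : ∀ᶠ v in 𝓝 (0 : ι → ℂ), Φ =ᶠ[𝓝 v] fun v => ∑' n, G n * monom n v :=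
    (h.mono fun v hv => hv.tsum_eq.symm).eventually_nhds
  have hs' := hs.mul_left (Fintype.card ι * (2 / r))
  have bd : ∀ (n : ι → ℕ), ∀ v ∈ Metric.ball (0 : ι → ℂ) (r / 2), ‖G n • monomDeriv n v‖ ≤
      Fintype.card ι * (2 / r) * (‖G n‖ * ∏ i, r ^ n i) := by
    intro n v hv
    rw [norm_smul]
    have := norm_monomDeriv_le n hr (v := v) (by simpa using (Metric.mem_ball.1 hv).le)
    calc _ ≤ ‖G n‖ * (Fintype.card ι * (2 / r) * ∏ i, r ^ n i) := by gcongr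
      _ = _ := by ring
  filter_upwards [hΦ, Metric.ball_mem_nhds (0 : ι → ℂ) (half_pos hr)] with v hv hvr
  have := hasFDerivAt_tsum_of_isPreconnected (𝕜 := ℂ) (f := fun n v => G n * monom n v)
    (f' := fun n v => G n • monomDeriv n v) hs' Metric.isOpen_ball
    (convex_ball (0 : ι → ℂ) (r / 2)).isPreconnected
    (fun n v _ => (hasFDerivAt_monom n v).const_mul (G n)) bd
    (Metric.mem_ball_self (half_pos hr)) h.self_of_nhds.summable hvr
  have h2 := this.congr_of_eventuallyEq hv
  refine ⟨h2.differentiableAt, ?_⟩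
  rw [h2.fderiv]
  exact (Summable.of_norm_bounded hs' fun n => bd n v hvr).hasSum

/-- Power series may be differentiated term by term. -/
theorem HasMonomialSum.fderiv_single {Φ : (ι → ℂ) → ℂ} {G : (ι → ℕ) → ℂ}
    (h : HasMonomialSum Φ G) (i : ι) :
    HasMonomialSum (fun v => fderiv ℂ Φ v (Pi.single i 1))
      (fun n => (n i + 1) * G (n + Pi.single i 1)) := by
  filter_upwards [h.hasFDerivAt] with v hv
  have h1 := (ContinuousLinearMap.apply ℂ ℂ (Pi.single i 1 : ι → ℂ)).hasSum hv.2
  -- The derivative in the variable i is the original family reindexed along n ↦ n + e_i; the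
  -- indices outside the range have n i = 0, and their terms have zero derivative.
  have hinj : Function.Injective fun n : ι → ℕ => n + Pi.single i 1 := add_left_injective _
  have h2 := (hinj.hasSum_iff (fun n hn => ?_)).2 h1
  · have e : (fun n : ι → ℕ => ((n i + 1) * G (n + Pi.single i 1)) * monom n v) =
        (fun b => (ContinuousLinearMap.apply ℂ ℂ (Pi.single i 1 : ι → ℂ)) (G b • monomDeriv b v)) ∘
          fun n => n + Pi.single i 1 := by
      funext n
      simp only [Function.comp, ContinuousLinearMap.apply_apply, smul_apply,
        monomDeriv_single, smul_eq_mul]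
      ring
    show HasSum (fun n : ι → ℕ => ((n i + 1) * G (n + Pi.single i 1)) * monom n v) _
    rw [e]
    exact h2
  · have : n i = 0 := by
      by_contra hni
      refine hn ⟨n - Pi.single i 1, funext fun j => ?_⟩
      by_cases hj : j = i
      · subst hj; simp; omega
      · simp [Pi.single_eq_of_ne hj]
    simp [monomDeriv_single_of_eq_zero n v i this]

end MonomialSeries

/-! ### Polarized variables and the totally real subspace -/

/-- The space of polarized variables `(Z, W)`, where `W` stands for `Z̄`. -/
abbrev Pol := (ℂ × ℂ) × (ℂ × ℂ)

/-- The coordinates of a polarized point as a vector. -/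
noncomputable def polVec : Pol ≃L[ℂ] (Fin 4 → ℂ) :=
  LinearEquiv.toContinuousLinearEquiv
    { toFun := fun v => ![v.1.1, v.1.2, v.2.1, v.2.2]
      invFun := fun x => ((x 0, x 1), (x 2, x 3))
      map_add' := fun u v => by ext i; fin_cases i <;> simp
      map_smul' := fun c v => by ext i; fin_cases i <;> simp
      left_inv := fun v => by simp
      right_inv := fun x => by ext i; fin_cases i <;> simp }

theorem polVec_apply (v : Pol) : polVec v = ![v.1.1, v.1.2, v.2.1, v.2.2] := rfl
/-- The totally real embedding `p ↦ (p, p̄)`. -/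
def polDiag (p : ℂ × ℂ) : Pol := (p, star p)

/-- The totally real embedding as a real-linear map. -/
noncomputable def polDiagL : ℂ × ℂ →L[ℝ] Pol :=
  (ContinuousLinearMap.id ℝ (ℂ × ℂ)).prod
    (((conjCLE : ℂ →L[ℝ] ℂ) ∘L ContinuousLinearMap.fst ℝ ℂ ℂ).prod
      ((conjCLE : ℂ →L[ℝ] ℂ) ∘L ContinuousLinearMap.snd ℝ ℂ ℂ))

theorem polDiagL_apply (p : ℂ × ℂ) : polDiagL p = polDiag p := rfl
theorem polDiag_zero : polDiag 0 = 0 := by simp [polDiag]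
theorem continuous_polDiag : Continuous polDiag := polDiagL.continuous
theorem tendsto_polDiag : Tendsto polDiag (𝓝 0) (𝓝 0) := by
  simpa [polDiag_zero] using continuous_polDiag.tendsto 0

/-- A complex-linear form that vanishes on the totally real subspace is zero. -/
theorem clm_eq_zero_of_polDiag {L : Pol →L[ℂ] ℂ} (h : ∀ u, L (polDiag u) = 0) : L = 0 := by
  have h1 : ∀ u : ℂ × ℂ, L (u, 0) = 0 ∧ L (0, star u) = 0 := by
    intro u
    -- The second component of the embedding is conjugate-linear, so testing on u and on I • u
    -- separates the two halves of L.
    have ha := h u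
    have hb := h (I • u)
    have e1 : polDiag u = (u, 0) + (0, star u) := by simp [polDiag]
    have e2 : polDiag (I • u) = I • (u, (0 : ℂ × ℂ)) - I • ((0 : ℂ × ℂ), star u) := by
      ext <;> simp [polDiag]
    rw [e1, map_add] at ha
    rw [e2, map_sub, map_smul, map_smul, smul_eq_mul, smul_eq_mul] at hb
    have hb' : L (u, 0) - L (0, star u) = 0 := by
      have : I * (L (u, 0) - L (0, star u)) = 0 := by linear_combination hb
      simpa using this
    constructor
    · linear_combination (ha + hb') / 2
    · linear_combination (ha - hb') / 2
  ext
  all_goals simp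
  · exact (h1 (1, 0)).1
  · exact (h1 (0, 1)).1
  · simpa [Prod.star_def] using (h1 (1, 0)).2
  · simpa [Prod.star_def] using (h1 (0, 1)).2

/-- A function that is complex differentiable near `0` and vanishes on the totally real subspace
has derivative zero there. -/
theorem eventually_fderiv_eq_zero_of_polDiag {Φ : Pol → ℂ}
    (hd : ∀ᶠ v in 𝓝 0, DifferentiableAt ℂ Φ v) (h : ∀ᶠ p in 𝓝 0, Φ (polDiag p) = 0) :
    ∀ᶠ p in 𝓝 0, fderiv ℂ Φ (polDiag p) = 0 := by
  filter_upwards [tendsto_polDiag.eventually hd, h.eventually_nhds] with p hp hp0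
  refine clm_eq_zero_of_polDiag fun u => ?_
  have h1 : HasFDerivAt (Φ ∘ polDiagL) ((fderiv ℂ Φ (polDiag p)).restrictScalars ℝ ∘L polDiagL) p :=
    HasFDerivAt.comp p (hp.hasFDerivAt.restrictScalars ℝ) polDiagL.hasFDerivAt
  have h2 : HasFDerivAt (Φ ∘ polDiagL) (0 : ℂ × ℂ →L[ℝ] ℂ) p :=
    (hasFDerivAt_const (0 : ℂ) p).congr_of_eventuallyEq hp0
  have := congrArg (fun T => T u) (h1.unique h2)
  simpa [polDiagL_apply] using this

/-- The coefficients of a power series that vanishes on the totally real subspace are zero. -/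
theorem HasMonomialSum.eq_zero_of_polDiag {Φ : (Fin 4 → ℂ) → ℂ} {G : (Fin 4 → ℕ) → ℂ}
    (h : HasMonomialSum Φ G) (h0 : ∀ᶠ p in 𝓝 0, Φ (polVec (polDiag p)) = 0) : G = 0 := by
  -- Induction on the total degree. The value at 0 is the constant coefficient, and every partial
  -- derivative is again a power series vanishing on the totally real subspace, hence the
  -- generalization over Φ and G.
  suffices H : ∀ (N : ℕ) (Φ : (Fin 4 → ℂ) → ℂ) (G : (Fin 4 → ℕ) → ℂ), HasMonomialSum Φ G →
      (∀ᶠ p in 𝓝 0, Φ (polVec (polDiag p)) = 0) → ∀ n, ∑ i, n i = N → G n = 0 from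
    funext fun n => H _ Φ G h h0 n rfl
  intro N
  induction N with
  | zero =>
    intro Φ G h h0 n hn
    have : n = 0 := funext fun i => by simpa using (Finset.sum_eq_zero_iff.1 hn) i (by simp)
    rw [this, ← h.apply_zero]
    simpa [polDiag_zero] using h0.self_of_nhds
  | succ N ih =>
    intro Φ G h h0 n hn
    obtain ⟨i, hi⟩ : ∃ i, n i ≠ 0 := by
      by_contra! hne
      simp [hne] at hn
    have hz := eventually_fderiv_eq_zero_of_polDiag (Φ := Φ ∘ polVec)
      ((show Tendsto polVec (𝓝 0) (𝓝 0) by simpa using polVec.continuous.tendsto 0).eventually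
        (h.hasFDerivAt.mono fun v hv => hv.1) |>.mono fun v hv =>
          hv.comp v polVec.differentiableAt) h0
    have hz' : ∀ᶠ p in 𝓝 0, fderiv ℂ Φ (polVec (polDiag p)) (Pi.single i 1) = 0 := by
      filter_upwards [hz] with p hp
      have := congrArg (fun T => T (polVec.symm (Pi.single i 1))) hp
      rw [ContinuousLinearEquiv.comp_right_fderiv] at this
      simpa using this
    have hm : (n - Pi.single i 1) + Pi.single i 1 = n := by
      funext j
      by_cases hj : j = i
      · subst hj; simp; omega
      · simp [Pi.single_eq_of_ne hj]
    have := ih _ _ (h.fderiv_single i) hz' (n - Pi.single i 1) (by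
      have h1 : ∑ j, ((n - Pi.single i 1) + Pi.single i 1 : Fin 4 → ℕ) j = N + 1 := by rw [hm, hn]
      simp only [Pi.add_apply, Finset.sum_add_distrib, Finset.sum_pi_single', Finset.mem_univ,
        if_true] at h1
      have h2 : ∑ j, (Pi.single i 1 : Fin 4 → ℕ) j = 1 := by simp
      omega)
    rw [hm] at this
    exact (mul_eq_zero.1 this).resolve_left (Nat.cast_add_one_ne_zero _)

/-! ### Analytic functions as series over words; existence of the polarization -/

section Words

/-- The power series of an analytic function, expanded in coordinates. -/
theorem AnalyticAt.exists_word_expansion {𝕜 V ι : Type*} [RCLike 𝕜] [NormedAddCommGroup V]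
    [NormedSpace 𝕜 V] [NormedSpace 𝕜 ℂ] [Fintype ι] {e : ι → V} {l : ι → V →L[𝕜] 𝕜}
    (hl : ∀ v, v = ∑ i, l i v • e i) {f : V → ℂ} (hf : AnalyticAt 𝕜 f 0) :
    ∃ (c : ∀ n, (Fin n → ι) → ℂ) (C K : ℝ), 0 ≤ K ∧ (∀ n i, ‖c n i‖ ≤ C * K ^ n) ∧
      ∀ᶠ v in 𝓝 0, HasSum (fun n => ∑ i : Fin n → ι, (∏ j, l (i j) v) • c n i) (f v) := by
  classical
  obtain ⟨p, r, hp⟩ := hf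
  obtain ⟨ρ, hρ0, hρ⟩ := ENNReal.lt_iff_exists_nnreal_btwn.1 (hp.r_pos.trans_le hp.r_le)
  obtain ⟨C, hC, hb⟩ := p.norm_mul_pow_le_of_lt_radius hρ
  have hρ0' : (0 : ℝ) < ρ := by exact_mod_cast hρ0
  set M : ℝ := ∑ i, ‖e i‖ with hM
  have hM0 : 0 ≤ M := Finset.sum_nonneg fun _ _ => norm_nonneg _
  have hMe : ∀ i, ‖e i‖ ≤ M := fun i =>
    Finset.single_le_sum (f := fun i => ‖e i‖) (fun _ _ => norm_nonneg _) (Finset.mem_univ i)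
  -- The term of degree n has norm at most C / ρ ^ n, and each letter of the word contributes at
  -- most M.
  refine ⟨fun n i => p n fun j => e (i j), C, M / ρ, by positivity, fun n i => ?_, ?_⟩
  · have h1 : ‖p n fun j => e (i j)‖ ≤ ‖p n‖ * M ^ n := by
      refine ((p n).le_opNorm _).trans (mul_le_mul_of_nonneg_left ?_ (norm_nonneg _))
      calc ∏ j, ‖e (i j)‖ ≤ ∏ _j : Fin n, M :=
            Finset.prod_le_prod (fun _ _ => norm_nonneg _) fun j _ => hMe _
        _ = M ^ n := by simp
    have h2 : ‖p n‖ ≤ C / ρ ^ n := by rw [le_div_iff₀ (by positivity)]; exact hb n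
    calc _ ≤ ‖p n‖ * M ^ n := h1
      _ ≤ C / ρ ^ n * M ^ n := by gcongr
      _ = _ := by rw [div_pow]; ring
  · filter_upwards [Metric.eball_mem_nhds (0 : V) hp.r_pos] with v hv
    have := hp.hasSum hv
    rw [zero_add] at this
    have hn : ∀ n, (p n fun _ => v) =
        ∑ i : Fin n → ι, (∏ j, l (i j) v) • p n fun j => e (i j) := by
      intro n
      conv_lhs => rw [show (fun _ : Fin n => v) = fun _ => ∑ i, l i v • e i from
        funext fun _ => hl v]
      rw [ContinuousMultilinearMap.map_sum]
      refine Finset.sum_congr rfl fun i _ => ?_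
      rw [ContinuousMultilinearMap.map_smul_univ]
    simpa only [hn] using this

/-- A word series with geometrically bounded coefficients defines an analytic function. -/
theorem exists_analyticAt_of_words {V ι : Type*} [NormedAddCommGroup V]
    [NormedSpace ℂ V] [Fintype ι] (L : ι → V →L[ℂ] ℂ) (c : ∀ n, (Fin n → ι) → ℂ) {C K : ℝ}
    (hK : 0 ≤ K) (hc : ∀ n i, ‖c n i‖ ≤ C * K ^ n) :
    ∃ Φ : V → ℂ, AnalyticAt ℂ Φ 0 ∧
      ∀ᶠ v in 𝓝 0, HasSum (fun n => ∑ i : Fin n → ι, (∏ j, L (i j) v) * c n i) (Φ v) := by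
  classical
  set M : ℝ := ∑ i, ‖L i‖ with hM
  have hM0 : 0 ≤ M := Finset.sum_nonneg fun _ _ => norm_nonneg _
  have hMe : ∀ i, ‖L i‖ ≤ M := fun i =>
    Finset.single_le_sum (f := fun i => ‖L i‖) (fun _ _ => norm_nonneg _) (Finset.mem_univ i)
  let P : FormalMultilinearSeries ℂ V ℂ := fun n => ∑ i : Fin n → ι,
    c n i • (ContinuousMultilinearMap.mkPiAlgebraFin ℂ n ℂ).compContinuousLinearMap
      fun j => L (i j)
  have hP : ∀ n, ‖P n‖ ≤ C * (Fintype.card ι * K * M) ^ n := by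
    intro n
    have h1 : ∀ i ∈ (Finset.univ : Finset (Fin n → ι)), ‖c n i •
        (ContinuousMultilinearMap.mkPiAlgebraFin ℂ n ℂ).compContinuousLinearMap
          fun j => L (i j)‖ ≤ C * K ^ n * M ^ n := by
      intro i _
      rw [norm_smul]
      refine mul_le_mul (hc n i) ?_ (norm_nonneg _) ((norm_nonneg _).trans (hc n i))
      refine (ContinuousMultilinearMap.norm_compContinuousLinearMap_le _ _).trans ?_
      rw [ContinuousMultilinearMap.norm_mkPiAlgebraFin, one_mul]
      calc ∏ j, ‖L (i j)‖ ≤ ∏ _j : Fin n, M :=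
            Finset.prod_le_prod (fun _ _ => norm_nonneg _) fun j _ => hMe _
        _ = M ^ n := by simp
    refine (norm_sum_le_of_le _ h1).trans (le_of_eq ?_)
    simp only [Finset.sum_const, Finset.card_univ, Fintype.card_fun, Fintype.card_fin,
      nsmul_eq_mul, mul_pow, Nat.cast_pow]
    ring
  set A : ℝ := Fintype.card ι * K * M with hA
  have hA0 : 0 ≤ A := by positivity
  -- There are (card ι) ^ n words of length n, so the n-th term grows at most like A ^ n; the radius
  -- 1 / (A + 1) is safe even for A = 0.
  have hrad : 0 < P.radius := by
    refine lt_of_lt_of_le ?_ (P.le_radius_of_bound (r := ⟨1 / (A + 1), by positivity⟩) C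
      fun n => ?_)
    · exact ENNReal.coe_pos.2 (show (0 : ℝ) < 1 / (A + 1) by positivity)
    · have hC : 0 ≤ C := by
        have := (norm_nonneg _).trans (hP 0)
        simpa using this
      calc ‖P n‖ * (1 / (A + 1)) ^ n ≤ C * A ^ n * (1 / (A + 1)) ^ n := by gcongr; exact hP n
        _ = C * (A / (A + 1)) ^ n := by rw [mul_assoc, ← mul_pow, mul_one_div]
        _ ≤ C * 1 := by
          gcongr
          exact pow_le_one₀ (by positivity) (by rw [div_le_one (by positivity)]; linarith)
        _ = C := mul_one C
  have hs := P.hasFPowerSeriesOnBall hrad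
  refine ⟨P.sum, hs.analyticAt, ?_⟩
  filter_upwards [Metric.eball_mem_nhds (0 : V) hrad] with v hv
  have := hs.hasSum hv
  rw [zero_add] at this
  have hn : ∀ n, (P n fun _ => v) = ∑ i : Fin n → ι, (∏ j, L (i j) v) * c n i := by
    intro n
    simp only [P, sum_apply, smul_apply,
      ContinuousMultilinearMap.compContinuousLinearMap_apply,
      ContinuousMultilinearMap.mkPiAlgebraFin_apply, List.prod_ofFn, smul_eq_mul]
    exact Finset.sum_congr rfl fun i _ => mul_comm _ _
  simpa only [hn] using this

/-- A real-analytic function near the origin of `ℂ²` is the restriction of a holomorphic function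
of the polarized variables. -/
theorem AnalyticAt.exists_polarization {φ : ℂ × ℂ → ℂ} (hφ : AnalyticAt ℝ φ 0) :
    ∃ Φ : Pol → ℂ, AnalyticAt ℂ Φ 0 ∧ ∀ᶠ p in 𝓝 0, Φ (polDiag p) = φ p := by
  let e : Fin 4 → ℂ × ℂ := ![(1, 0), (I, 0), (0, 1), (0, I)]
  let l : Fin 4 → ℂ × ℂ →L[ℝ] ℝ := ![reCLM ∘L ContinuousLinearMap.fst ℝ ℂ ℂ,
    imCLM ∘L ContinuousLinearMap.fst ℝ ℂ ℂ, reCLM ∘L ContinuousLinearMap.snd ℝ ℂ ℂ,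
    imCLM ∘L ContinuousLinearMap.snd ℝ ℂ ℂ]
  have hl : ∀ v, v = ∑ i, l i v • e i := by
    intro v
    simp only [Fin.sum_univ_four]
    ext <;> simp [e, l]
  obtain ⟨c, C, K, hK, hc, hs⟩ := hφ.exists_word_expansion hl
  let z : Pol →L[ℂ] ℂ := ContinuousLinearMap.fst ℂ ℂ ℂ ∘L ContinuousLinearMap.fst ℂ _ _
  let ζ : Pol →L[ℂ] ℂ := ContinuousLinearMap.snd ℂ ℂ ℂ ∘L ContinuousLinearMap.fst ℂ _ _
  let w : Pol →L[ℂ] ℂ := ContinuousLinearMap.fst ℂ ℂ ℂ ∘L ContinuousLinearMap.snd ℂ _ _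
  let η : Pol →L[ℂ] ℂ := ContinuousLinearMap.snd ℂ ℂ ℂ ∘L ContinuousLinearMap.snd ℂ _ _
  -- On w = z̄, η = ζ̄ these forms are Re z, Im z, Re ζ, Im ζ. The words of the real expansion, with
  -- unchanged coefficients, thus define the holomorphic extension.
  let L : Fin 4 → Pol →L[ℂ] ℂ := ![(1 / 2 : ℂ) • (z + w), (-I / 2 : ℂ) • (z - w),
    (1 / 2 : ℂ) • (ζ + η), (-I / 2 : ℂ) • (ζ - η)]
  obtain ⟨Φ, hΦ, hsΦ⟩ := exists_analyticAt_of_words L c hK hc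
  have hLl : ∀ i p, L i (polDiag p) = (l i p : ℂ) := by
    intro i p
    fin_cases i
    · simp [L, l, z, w, polDiag, Complex.ext_iff]; ring
    · simp [L, l, z, w, polDiag, Complex.ext_iff]; ring
    · simp [L, l, ζ, η, polDiag, Complex.ext_iff]; ring
    · simp [L, l, ζ, η, polDiag, Complex.ext_iff]; ring
  refine ⟨Φ, hΦ, ?_⟩
  filter_upwards [tendsto_polDiag.eventually hsΦ, hs] with p h1 h2
  refine h1.unique ?_
  convert h2 using 2 with n
  refine Finset.sum_congr rfl fun i _ => ?_
  simp only [hLl, Complex.real_smul, Complex.ofReal_prod]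

theorem prod_word_eq_monom {ι : Type*} [Fintype ι] [DecidableEq ι] {n : ℕ} (i : Fin n → ι)
    (v : ι → ℂ) : ∏ j, v (i j) = monom (fun a => (Finset.univ.filter fun j => i j = a).card) v := by
  rw [monom, ← Finset.prod_fiberwise_of_maps_to (g := i) (t := Finset.univ)
    (fun j _ => Finset.mem_univ (i j))]
  refine Finset.prod_congr rfl fun a _ => ?_
  rw [Finset.prod_congr rfl (g := fun _ => v a) (fun j hj => by rw [(Finset.mem_filter.1 hj).2])]
  simp

/-- A holomorphic function of several variables is the sum of a power series in the monomials. -/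
theorem AnalyticAt.exists_hasMonomialSum {ι : Type*} [Fintype ι] {Φ : (ι → ℂ) → ℂ}
    (hΦ : AnalyticAt ℂ Φ 0) : ∃ G, HasMonomialSum Φ G := by
  classical
  obtain ⟨c, C, K, hK, hc, hs⟩ := hΦ.exists_word_expansion
    (e := fun i => Pi.single i (1 : ℂ)) (l := fun i => ContinuousLinearMap.proj i)
    (fun v => by
      funext i
      simp [Finset.sum_apply, Pi.single_apply])
  -- Words with the same letter counts give the same monomial, so the coefficient of a monomial is
  -- the sum over a fibre of the counting map.
  let cnt : (Σ n, Fin n → ι) → ι → ℕ := fun x a => (Finset.univ.filter fun j => x.2 j = a).card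
  refine ⟨fun α => ∑' x : {x // cnt x = α}, c x.1.1 x.1.2, ?_⟩
  set A : ℝ := Fintype.card ι * K with hA
  have hA0 : 0 ≤ A := by positivity
  -- On this ball A ‖v‖ < 1, so the (card ι) ^ n words of each length n are together bounded by a
  -- geometric series.
  have hr : 0 < 1 / (2 * (A + 1)) := by positivity
  filter_upwards [hs, Metric.ball_mem_nhds (0 : ι → ℂ) hr] with v hv hvr
  have hvn : ‖v‖ ≤ 1 / (2 * (A + 1)) := (mem_ball_zero_iff.1 hvr).le
  let t : (Σ n, Fin n → ι) → ℂ := fun x => c x.1 x.2 * monom (cnt x) v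
  have ht : ∀ x, ‖t x‖ ≤ C * (K * ‖v‖) ^ x.1 := by
    rintro ⟨n, i⟩
    have : monom (cnt ⟨n, i⟩) v = ∏ j, v (i j) := (prod_word_eq_monom i v).symm
    simp only [t, this, norm_mul, norm_prod]
    have h2 : ∏ j, ‖v (i j)‖ ≤ ‖v‖ ^ n := by
      calc ∏ j, ‖v (i j)‖ ≤ ∏ _j : Fin n, ‖v‖ :=
            Finset.prod_le_prod (fun _ _ => norm_nonneg _) fun j _ => norm_le_pi_norm v _
        _ = _ := by simp
    calc _ ≤ (C * K ^ n) * ‖v‖ ^ n :=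
          mul_le_mul (hc n i) h2 (by positivity) ((norm_nonneg _).trans (hc n i))
      _ = _ := by rw [mul_pow]; ring
  have hC : 0 ≤ C := by simpa using (norm_nonneg _).trans (hc 0 Fin.elim0)
  have hAv : A * ‖v‖ < 1 := by
    calc A * ‖v‖ ≤ A * (1 / (2 * (A + 1))) := by gcongr
      _ < 1 := by rw [mul_one_div, div_lt_one (by positivity)]; linarith
  have hsum : Summable t := by
    refine Summable.of_norm_bounded (g := fun x : (Σ n, Fin n → ι) => C * (K * ‖v‖) ^ x.1) ?_ ht
    rw [summable_sigma_of_nonneg (fun x => by positivity)]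
    refine ⟨fun n => Summable.of_finite, ?_⟩
    have : Summable fun n : ℕ => C * (A * ‖v‖) ^ n :=
      (summable_geometric_of_lt_one (by positivity) hAv).mul_left C
    refine this.congr fun n => ?_
    rw [tsum_fintype]
    simp [hA, mul_pow]
    ring
  have hval : HasSum t (Φ v) := by
    have h1 : HasSum (fun n => ∑' i : Fin n → ι, t ⟨n, i⟩) (∑' x, t x) :=
      hsum.hasSum.sigma fun n => (Summable.of_finite).hasSum
    have h2 : (fun n => ∑' i : Fin n → ι, t ⟨n, i⟩) =
        fun n => ∑ i : Fin n → ι, (∏ j, v (i j)) • c n i := by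
      funext n
      rw [tsum_fintype]
      refine Finset.sum_congr rfl fun i _ => ?_
      rw [prod_word_eq_monom, smul_eq_mul, mul_comm]
    rw [h2] at h1
    rw [hv.unique h1]
    exact hsum.hasSum
  have h3 := (Equiv.hasSum_iff (Equiv.sigmaFiberEquiv cnt)).2 hval
  refine h3.sigma fun α => ?_
  have h4 : ∀ x : {x // cnt x = α}, t x.1 = c x.1.1 x.1.2 * monom α v := fun x => by
    simp only [t, x.2]
  have h5 : Summable fun x : {x // cnt x = α} => c x.1.1 x.1.2 * monom α v :=
    ((hsum.comp_injective Subtype.val_injective : Summable fun x : {x // cnt x = α} => t x.1)).congr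
      h4
  rw [← tsum_mul_right]
  convert h5.hasSum using 1
  funext x
  exact h4 x

end Words

/-! ### Directional derivatives of holomorphic functions -/

section DirectionalDerivative

variable {V V' : Type*} [NormedAddCommGroup V] [NormedSpace ℂ V] [NormedAddCommGroup V']
  [NormedSpace ℂ V']

/-- The directional derivative of a holomorphic function. -/
noncomputable def dirD (u : V) (Φ : V → ℂ) (v : V) : ℂ := fderiv ℂ Φ v u

theorem AnalyticAt.dirD {Φ : V → ℂ} {a : V} (h : AnalyticAt ℂ Φ a) (u : V) :
    AnalyticAt ℂ (dirD u Φ) a :=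
  ((ContinuousLinearMap.apply ℂ ℂ u).analyticAt _).comp h.fderiv

theorem Filter.EventuallyEq.dirD {Φ Ψ : V → ℂ} {a : V} (h : Φ =ᶠ[𝓝 a] Ψ) (u : V) :
    dirD u Φ =ᶠ[𝓝 a] dirD u Ψ :=
  (EventuallyEq.fderiv (𝕜 := ℂ) h).mono fun v hv => by simp only [_root_.dirD, hv]

theorem Filter.EventuallyEq.dirD_eq {Φ Ψ : V → ℂ} {a : V} (h : Φ =ᶠ[𝓝 a] Ψ) (u : V) :
    _root_.dirD u Φ a = _root_.dirD u Ψ a := (h.dirD u).self_of_nhds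

theorem dirD_add_dir (u u' : V) (Φ : V → ℂ) (v : V) :
    dirD (u + u') Φ v = dirD u Φ v + dirD u' Φ v := by simp [dirD]

theorem dirD_smul_dir (c : ℂ) (u : V) (Φ : V → ℂ) (v : V) :
    dirD (c • u) Φ v = c * dirD u Φ v := by simp [dirD]

theorem dirD_add {Φ Ψ : V → ℂ} {v : V} (hΦ : DifferentiableAt ℂ Φ v)
    (hΨ : DifferentiableAt ℂ Ψ v) (u : V) :
    dirD u (fun x => Φ x + Ψ x) v = dirD u Φ v + dirD u Ψ v := by
  simp only [dirD]
  rw [fderiv_fun_add hΦ hΨ, add_apply]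

theorem dirD_sub {Φ Ψ : V → ℂ} {v : V} (hΦ : DifferentiableAt ℂ Φ v)
    (hΨ : DifferentiableAt ℂ Ψ v) (u : V) :
    dirD u (fun x => Φ x - Ψ x) v = dirD u Φ v - dirD u Ψ v := by
  simp only [dirD]
  rw [fderiv_fun_sub hΦ hΨ, sub_apply]

theorem dirD_mul {Φ Ψ : V → ℂ} {v : V} (hΦ : DifferentiableAt ℂ Φ v)
    (hΨ : DifferentiableAt ℂ Ψ v) (u : V) :
    dirD u (fun x => Φ x * Ψ x) v = dirD u Φ v * Ψ v + Φ v * dirD u Ψ v := by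
  simp only [dirD]
  rw [fderiv_fun_mul hΦ hΨ, add_apply, smul_apply, smul_apply, smul_eq_mul, smul_eq_mul]
  ring

theorem dirD_const_mul {Φ : V → ℂ} {v : V} (hΦ : DifferentiableAt ℂ Φ v) (c : ℂ) (u : V) :
    dirD u (fun x => c * Φ x) v = c * dirD u Φ v := by
  simp only [dirD]
  rw [fderiv_const_mul hΦ, smul_apply, smul_eq_mul]

theorem dirD_const (c : ℂ) (v u : V) : dirD u (fun _ => c) v = 0 := by
  simp [dirD]

theorem dirD_clm (L : V →L[ℂ] ℂ) (v u : V) : dirD u L v = L u := by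
  simp [dirD]

theorem dirD_comp_clm {Φ : V' → ℂ} (L : V →L[ℂ] V') {v : V} (h : DifferentiableAt ℂ Φ (L v))
    (u : V) : dirD u (fun x => Φ (L x)) v = dirD (L u) Φ (L v) := by
  have := (h.hasFDerivAt.comp v L.hasFDerivAt).fderiv
  simp only [dirD]
  rw [show (fun x => Φ (L x)) = Φ ∘ L from rfl, this]
  rfl

theorem deriv_comp_curve {Φ : V → ℂ} {c : ℂ → V} {t : ℂ} (h : DifferentiableAt ℂ Φ (c t))
    (hc : DifferentiableAt ℂ c t) : deriv (fun s => Φ (c s)) t = dirD (deriv c t) Φ (c t) :=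
  (h.hasFDerivAt.comp_hasDerivAt t hc.hasDerivAt).deriv

theorem deriv_comp_line {Φ : V → ℂ} {v : V} (h : DifferentiableAt ℂ Φ v) (u : V) :
    deriv (fun s : ℂ => Φ (v + s • u)) 0 = dirD u Φ v := by
  have hc : HasDerivAt (fun s : ℂ => v + s • u) u 0 := by
    simpa using ((hasDerivAt_id (0 : ℂ)).smul_const u).const_add v
  have h' : DifferentiableAt ℂ Φ ((fun s : ℂ => v + s • u) 0) := by simpa using h
  rw [deriv_comp_curve (c := fun s : ℂ => v + s • u) h' hc.differentiableAt, hc.deriv]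
  simp

theorem dirD_comm {Φ : V → ℂ} {a : V} (h : AnalyticAt ℂ Φ a) (u u' : V) :
    dirD u (dirD u' Φ) a = dirD u' (dirD u Φ) a := by
  have hs := (h.contDiffAt (n := ⊤)).isSymmSndFDerivAt_of_omega
  have e : ∀ x y, dirD x (dirD y Φ) a = fderiv ℂ (fderiv ℂ Φ) a x y := fun x y => by
    have := ((ContinuousLinearMap.apply ℂ ℂ y).hasFDerivAt.comp a
      h.fderiv.differentiableAt.hasFDerivAt).fderiv
    show fderiv ℂ ((ContinuousLinearMap.apply ℂ ℂ y) ∘ fderiv ℂ Φ) a x = _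
    rw [this]
    rfl
  rw [e, e, hs.eq]

theorem dirD_comm_eventually {Φ : V → ℂ} {a : V} (h : AnalyticAt ℂ Φ a) (u u' : V) :
    dirD u (dirD u' Φ) =ᶠ[𝓝 a] dirD u' (dirD u Φ) :=
  h.eventually_analyticAt.mono fun _ hv => dirD_comm hv u u'

end DirectionalDerivative

/-! ### Series in the polarized variables: uniqueness and Hermitian symmetry -/

section PolarizedSeries

/-- The coordinate directions in the space of polarized variables. -/
abbrev ez : Pol := ((1, 0), 0)
abbrev eζ : Pol := ((0, 1), 0)
abbrev ew : Pol := (0, (1, 0))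
abbrev eη : Pol := (0, (0, 1))

/-- Near the origin, `Φ` is the sum of the power series with coefficients `G`. -/
def HasPolSum (Φ : Pol → ℂ) (G : ℕ → ℕ → ℕ → ℕ → ℂ) : Prop :=
  ∀ᶠ v in 𝓝 (0 : Pol),
    HasSum (fun n : ℕ × ℕ × ℕ × ℕ =>
      G n.1 n.2.1 n.2.2.1 n.2.2.2 *
        (v.1.1 ^ n.1 * v.1.2 ^ n.2.1 * v.2.1 ^ n.2.2.1 * v.2.2 ^ n.2.2.2)) (Φ v)

/-- Multi-indices of length four. -/
def multiIndexEquiv : ℕ × ℕ × ℕ × ℕ ≃ (Fin 4 → ℕ) where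
  toFun n := ![n.1, n.2.1, n.2.2.1, n.2.2.2]
  invFun n := (n 0, n 1, n 2, n 3)
  left_inv n := by simp
  right_inv n := by ext i; fin_cases i <;> rfl

theorem tendsto_polVec : Tendsto polVec (𝓝 0) (𝓝 0) := by
  simpa using polVec.continuous.tendsto 0

theorem tendsto_polVec_symm : Tendsto polVec.symm (𝓝 0) (𝓝 0) := by
  simpa using polVec.symm.continuous.tendsto 0

theorem hasSum_monom_iff (v : Pol) (G : (Fin 4 → ℕ) → ℂ) (x : ℂ) :
    HasSum (fun n => G n * monom n (polVec v)) x ↔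
    HasSum (fun n : ℕ × ℕ × ℕ × ℕ =>
      G ![n.1, n.2.1, n.2.2.1, n.2.2.2] *
        (v.1.1 ^ n.1 * v.1.2 ^ n.2.1 * v.2.1 ^ n.2.2.1 * v.2.2 ^ n.2.2.2)) x := by
  rw [← multiIndexEquiv.hasSum_iff]
  simp only [Function.comp_def, monom, Fin.prod_univ_four]
  rfl

theorem hasPolSum_iff {Φ : Pol → ℂ} {G : (Fin 4 → ℕ) → ℂ} :
    HasMonomialSum (fun x => Φ (polVec.symm x)) G ↔
      HasPolSum Φ fun a b c d => G ![a, b, c, d] := by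
  constructor
  · intro h
    filter_upwards [tendsto_polVec.eventually h] with v hv
    rw [hasSum_monom_iff] at hv
    simpa using hv
  · intro h
    filter_upwards [tendsto_polVec_symm.eventually h] with x hx
    have := (hasSum_monom_iff (polVec.symm x) G _).2 hx
    simpa using this

theorem hasPolSum_iff' {Φ : Pol → ℂ} {G : ℕ → ℕ → ℕ → ℕ → ℂ} :
    HasPolSum Φ G ↔
      HasMonomialSum (fun x => Φ (polVec.symm x)) (fun n => G (n 0) (n 1) (n 2) (n 3)) :=
  (hasPolSum_iff (G := fun n => G (n 0) (n 1) (n 2) (n 3))).symm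

theorem AnalyticAt.exists_hasPolSum {Φ : Pol → ℂ} (h : AnalyticAt ℂ Φ 0) :
    ∃ G, HasPolSum Φ G := by
  have h1 : AnalyticAt ℂ (fun x => Φ (polVec.symm x)) 0 :=
    AnalyticAt.comp (g := Φ) (by simpa using h)
      ((polVec.symm : (Fin 4 → ℂ) →L[ℂ] Pol).analyticAt 0)
  obtain ⟨G, hG⟩ := h1.exists_hasMonomialSum
  exact ⟨_, hasPolSum_iff.1 hG⟩

theorem HasPolSum.apply_zero {Φ : Pol → ℂ} {G : ℕ → ℕ → ℕ → ℕ → ℂ} (h : HasPolSum Φ G) :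
    Φ 0 = G 0 0 0 0 := by
  have := (hasPolSum_iff'.1 h).apply_zero
  simpa using this

theorem HasPolSum.dirD_single {Φ : Pol → ℂ} {G : ℕ → ℕ → ℕ → ℕ → ℂ} (h : HasPolSum Φ G)
    (i : Fin 4) {u : Pol} (hu : polVec u = Pi.single i 1) :
    HasMonomialSum (fun x => dirD u Φ (polVec.symm x))
      (fun n => (n i + 1) * G ((n + Pi.single i 1 : Fin 4 → ℕ) 0) ((n + Pi.single i 1 : Fin 4 → ℕ) 1)
        ((n + Pi.single i 1 : Fin 4 → ℕ) 2) ((n + Pi.single i 1 : Fin 4 → ℕ) 3)) := by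
  have h1 := (hasPolSum_iff'.1 h).fderiv_single i
  convert h1 using 2 with x
  have := ContinuousLinearEquiv.comp_right_fderiv (f := Φ) (x := x) polVec.symm
  rw [show (fun x => Φ (polVec.symm x)) = Φ ∘ polVec.symm from rfl, this, ← hu]
  simp [dirD]

theorem HasPolSum.dirD_z {Φ : Pol → ℂ} {G : ℕ → ℕ → ℕ → ℕ → ℂ} (h : HasPolSum Φ G) :
    HasPolSum (dirD ez Φ) fun a b c d => (a + 1) * G (a + 1) b c d := by
  have := h.dirD_single 0 (u := ez) (by ext i; fin_cases i <;> simp [polVec_apply])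
  simpa using hasPolSum_iff.1 this

theorem HasPolSum.dirD_w {Φ : Pol → ℂ} {G : ℕ → ℕ → ℕ → ℕ → ℂ} (h : HasPolSum Φ G) :
    HasPolSum (dirD ew Φ) fun a b c d => (c + 1) * G a b (c + 1) d := by
  have := h.dirD_single 2 (u := ew) (by ext i; fin_cases i <;> simp [polVec_apply])
  simpa using hasPolSum_iff.1 this

theorem HasPolSum.dirD_η {Φ : Pol → ℂ} {G : ℕ → ℕ → ℕ → ℕ → ℂ} (h : HasPolSum Φ G) :
    HasPolSum (dirD eη Φ) fun a b c d => (d + 1) * G a b c (d + 1) := by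
  have := h.dirD_single 3 (u := eη) (by ext i; fin_cases i <;> simp [polVec_apply])
  simpa using hasPolSum_iff.1 this

theorem HasPolSum.hasExpansion {Φ : Pol → ℂ} {G : ℕ → ℕ → ℕ → ℕ → ℂ} (h : HasPolSum Φ G)
    {φ : ℂ × ℂ → ℂ} (hφ : ∀ᶠ p in 𝓝 0, Φ (polDiag p) = φ p) : HasExpansion φ G := by
  filter_upwards [tendsto_polDiag.eventually h, hφ] with p h1 h2
  rw [h2] at h1
  exact h1

/-- The coefficients of an expansion in `z, ζ, z̄, ζ̄` are unique. -/
theorem HasExpansion.unique {φ : ℂ × ℂ → ℂ} {G G' : ℕ → ℕ → ℕ → ℕ → ℂ} (h : HasExpansion φ G)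
    (h' : HasExpansion φ G') : G = G' := by
  let Γ : (Fin 4 → ℕ) → ℂ := fun n => G (n 0) (n 1) (n 2) (n 3) - G' (n 0) (n 1) (n 2) (n 3)
  have hd : ∀ᶠ p in 𝓝 (0 : ℂ × ℂ), HasSum (fun n => Γ n * monom n (polVec (polDiag p))) 0 := by
    filter_upwards [h, h'] with p h1 h2
    rw [hasSum_monom_iff]
    have := h1.sub h2
    simp only [sub_self, ← sub_mul] at this
    exact this
  -- Convergence is known only on the totally real subspace. At the real points z = ζ = t all four
  -- variables equal t, which already gives absolute convergence on a full polydisc.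
  obtain ⟨r, hr, hs⟩ := exists_summable_of_eventually (G := Γ) (by
    have hc : Tendsto (fun t : ℝ => ((t : ℂ), (t : ℂ))) (𝓝 0) (𝓝 0) := by
      have : Continuous (fun t : ℝ => ((t : ℂ), (t : ℂ))) := by fun_prop
      exact this.tendsto' 0 0 (by simp)
    filter_upwards [hc.eventually hd] with t ht
    have e : polVec (polDiag ((t : ℂ), (t : ℂ))) = fun _ => (t : ℂ) := by
      ext i; fin_cases i <;> simp [polVec_apply, polDiag]
    rw [e] at ht
    exact ht.summable)
  have hm := hasMonomialSum_tsum hr hs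
  have h0 := hm.eq_zero_of_polDiag (hd.mono fun p hp => hp.tsum_eq)
  funext a b c d
  have := congrFun h0 ![a, b, c, d]
  exact sub_eq_zero.1 this

theorem HasPolSum.unique {Φ : Pol → ℂ} {G G' : ℕ → ℕ → ℕ → ℕ → ℂ} (h : HasPolSum Φ G)
    (h' : HasPolSum Φ G') : G = G' :=
  (h.hasExpansion (.of_forall fun _ => rfl)).unique (h'.hasExpansion (.of_forall fun _ => rfl))

theorem HasPolSum.eventuallyEq {Φ Φ' : Pol → ℂ} {G : ℕ → ℕ → ℕ → ℕ → ℂ} (h : HasPolSum Φ G)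
    (h' : HasPolSum Φ' G) : Φ =ᶠ[𝓝 0] Φ' := by
  filter_upwards [h, h'] with v h1 h2 using h1.unique h2

theorem HasExpansion.hasPolSum {φ : ℂ × ℂ → ℂ} {G : ℕ → ℕ → ℕ → ℕ → ℂ} (h : HasExpansion φ G)
    {Φ : Pol → ℂ} (hΦ : AnalyticAt ℂ Φ 0) (hφ : ∀ᶠ p in 𝓝 0, Φ (polDiag p) = φ p) :
    HasPolSum Φ G := by
  obtain ⟨G', hG'⟩ := hΦ.exists_hasPolSum
  rwa [h.unique (hG'.hasExpansion hφ)]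

/-- Holomorphic functions that agree on the totally real subspace agree. -/
theorem eventuallyEq_of_polDiag {Φ Ψ : Pol → ℂ} (hΦ : AnalyticAt ℂ Φ 0) (hΨ : AnalyticAt ℂ Ψ 0)
    (h : ∀ᶠ p in 𝓝 0, Φ (polDiag p) = Ψ (polDiag p)) : Φ =ᶠ[𝓝 0] Ψ := by
  obtain ⟨G, hG⟩ := hΦ.exists_hasPolSum
  obtain ⟨G', hG'⟩ := hΨ.exists_hasPolSum
  have := (hG.hasExpansion h).unique (hG'.hasExpansion (.of_forall fun _ => rfl))
  exact hG.eventuallyEq (this ▸ hG')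

/-- The antilinear involution `(Z, W) ↦ (W̄, Z̄)`. -/
def polSwap (v : Pol) : Pol := (star v.2, star v.1)

theorem continuous_polSwap : Continuous polSwap := by unfold polSwap; fun_prop

theorem tendsto_polSwap : Tendsto polSwap (𝓝 0) (𝓝 0) := by
  exact continuous_polSwap.tendsto' 0 0 (by simp [polSwap])

theorem polSwap_add_smul (v u : Pol) (t : ℂ) :
    polSwap (v + t • u) = polSwap v + (starRingEnd ℂ t) • polSwap u := by
  ext <;> simp [polSwap]

/-- Since `polSwap` is antilinear, on a complex line the hypothesis has the form conj ∘
(holomorphic) ∘ conj, whose derivative is the conjugate one. -/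
theorem dirD_conj_polSwap {Φ Ψ : Pol → ℂ} {a : Pol} (hΦ : AnalyticAt ℂ Φ a)
    (hΨ : AnalyticAt ℂ Ψ (polSwap a)) (h : ∀ᶠ v in 𝓝 a, Φ v = star (Ψ (polSwap v))) (u : Pol) :
    ∀ᶠ v in 𝓝 a, dirD u Φ v = star (dirD (polSwap u) Ψ (polSwap v)) := by
  filter_upwards [h.eventually_nhds, hΦ.eventually_analyticAt,
    (continuous_polSwap.tendsto a).eventually hΨ.eventually_analyticAt] with v hv h1 h2
  rw [← deriv_comp_line h1.differentiableAt, ← deriv_comp_line h2.differentiableAt]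
  have hc : Tendsto (fun s : ℂ => v + s • u) (𝓝 0) (𝓝 v) := by
    have : Continuous (fun s : ℂ => v + s • u) := by fun_prop
    simpa using this.tendsto 0
  have e : (fun s : ℂ => Φ (v + s • u)) =ᶠ[𝓝 0]
      (starRingEnd ℂ) ∘ (fun s : ℂ => Ψ (polSwap v + s • polSwap u)) ∘ (starRingEnd ℂ) := by
    filter_upwards [hc.eventually hv] with s hs
    rw [hs, polSwap_add_smul]
    rfl
  rw [e.deriv_eq, deriv_conj_conj]
  simp

/-- `Φ` is the polarization of a real-valued function. -/
def IsHermitian (Φ : Pol → ℂ) : Prop := ∀ᶠ v in 𝓝 0, Φ v = star (Φ (polSwap v))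

theorem HasExpansion.coeff_conj {F : ℂ × ℂ → ℂ} {G : ℕ → ℕ → ℕ → ℕ → ℂ}
    (hF : ∀ᶠ p in 𝓝 0, star (F p) = F p) (h : HasExpansion F G) (a b c d : ℕ) :
    G a b c d = star (G c d a b) := by
  have h' : HasExpansion F fun a b c d => star (G c d a b) := by
    filter_upwards [h, hF] with p hp hFp
    have h1 := hp.star
    rw [hFp] at h1
    let e : ℕ × ℕ × ℕ × ℕ ≃ ℕ × ℕ × ℕ × ℕ :=
      ⟨fun n => (n.2.2.1, n.2.2.2, n.1, n.2.1), fun n => (n.2.2.1, n.2.2.2, n.1, n.2.1),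
        fun n => rfl, fun n => rfl⟩
    rw [← e.hasSum_iff] at h1
    convert h1 using 2 with n
    simp [e]
    left
    ring
  exact congrFun (congrFun (congrFun (congrFun (h.unique h') a) b) c) d

/-- Reality on W = Z̄ is a symmetry of the coefficients, and this symmetry is an identity of the
series off the subspace as well. -/
theorem isHermitian_of_real {Φ : Pol → ℂ} (hΦ : AnalyticAt ℂ Φ 0) {F : ℂ × ℂ → ℝ}
    (h : ∀ᶠ p in 𝓝 0, Φ (polDiag p) = F p) : IsHermitian Φ := by
  obtain ⟨G, hG⟩ := hΦ.exists_hasPolSum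
  have hc := (hG.hasExpansion h).coeff_conj (.of_forall fun p => by simp)
  filter_upwards [hG, tendsto_polSwap.eventually hG] with v h1 h2
  have h3 := h2.star
  let e : ℕ × ℕ × ℕ × ℕ ≃ ℕ × ℕ × ℕ × ℕ :=
    ⟨fun n => (n.2.2.1, n.2.2.2, n.1, n.2.1), fun n => (n.2.2.1, n.2.2.2, n.1, n.2.1),
      fun n => rfl, fun n => rfl⟩
  rw [← e.hasSum_iff] at h3
  refine h1.unique ?_
  convert h3 using 2 with n
  rw [hc]
  simp [e, polSwap]
  left
  ring

end PolarizedSeries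

/-! ### Wirtinger derivatives read on the polarization -/

section Wirtinger

theorem hasFDerivAt_polDiag {Φ : Pol → ℂ} (hΦ : AnalyticAt ℂ Φ 0) {φ : ℂ × ℂ → ℂ}
    (h : ∀ᶠ p in 𝓝 0, Φ (polDiag p) = φ p) :
    ∀ᶠ p in 𝓝 0, ∀ u, fderiv ℝ φ p u = fderiv ℂ Φ (polDiag p) (polDiag u) := by
  filter_upwards [h.eventually_nhds, tendsto_polDiag.eventually hΦ.eventually_analyticAt]
    with p hp hp' u
  have h1 : HasFDerivAt (Φ ∘ polDiagL) ((fderiv ℂ Φ (polDiag p)).restrictScalars ℝ ∘L polDiagL) p :=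
    HasFDerivAt.comp p (hp'.differentiableAt.hasFDerivAt.restrictScalars ℝ) polDiagL.hasFDerivAt
  have h2 : φ =ᶠ[𝓝 p] Φ ∘ polDiagL := hp.mono fun q hq => hq.symm
  rw [h2.fderiv_eq, h1.fderiv]
  rfl

/-- The real differential of φ is the complex differential of Φ along `polDiag`. The antiholomorphic
half changes sign under u ↦ I • u relative to the holomorphic one, so the Wirtinger combination
cancels it. -/
theorem dHol_polDiag {Φ : Pol → ℂ} (hΦ : AnalyticAt ℂ Φ 0) {φ : ℂ × ℂ → ℂ}
    (h : ∀ᶠ p in 𝓝 0, Φ (polDiag p) = φ p) (j : Fin 2) :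
    ∀ᶠ p in 𝓝 0, dirD (coordDir j, 0) Φ (polDiag p) = dHol j φ p := by
  filter_upwards [hasFDerivAt_polDiag hΦ h] with p hp
  rw [dHol, hp, hp, dirD]
  have e1 : polDiag (coordDir j) = (coordDir j, 0) + (0, coordDir j) := by
    fin_cases j <;> simp [polDiag, coordDir, Prod.star_def]
  have e2 : polDiag (I • coordDir j) = I • (coordDir j, (0 : ℂ × ℂ)) -
      I • ((0 : ℂ × ℂ), coordDir j) := by
    fin_cases j <;> simp [polDiag, coordDir, Prod.star_def]
  rw [e1, e2, map_add, map_sub, map_smul, map_smul, smul_eq_mul, smul_eq_mul]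
  linear_combination (-(fderiv ℂ Φ (polDiag p)) (coordDir j, 0) +
    (fderiv ℂ Φ (polDiag p)) (0, coordDir j)) / 2 * -I_mul_I

theorem dAnti_polDiag {Φ : Pol → ℂ} (hΦ : AnalyticAt ℂ Φ 0) {φ : ℂ × ℂ → ℂ}
    (h : ∀ᶠ p in 𝓝 0, Φ (polDiag p) = φ p) (j : Fin 2) :
    ∀ᶠ p in 𝓝 0, dirD (0, coordDir j) Φ (polDiag p) = dAnti j φ p := by
  filter_upwards [hasFDerivAt_polDiag hΦ h] with p hp
  rw [dAnti, hp, hp, dirD]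
  have e1 : polDiag (coordDir j) = (coordDir j, 0) + (0, coordDir j) := by
    fin_cases j <;> simp [polDiag, coordDir, Prod.star_def]
  have e2 : polDiag (I • coordDir j) = I • (coordDir j, (0 : ℂ × ℂ)) -
      I • ((0 : ℂ × ℂ), coordDir j) := by
    fin_cases j <;> simp [polDiag, coordDir, Prod.star_def]
  rw [e1, e2, map_add, map_sub, map_smul, map_smul, smul_eq_mul, smul_eq_mul]
  linear_combination (-(fderiv ℂ Φ (polDiag p)) (coordDir j, 0) +
    (fderiv ℂ Φ (polDiag p)) (0, coordDir j)) / 2 * I_mul_I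

end Wirtinger

/-! ### Uniqueness for Goursat problems -/

section Goursat

theorem tendsto_pair_left : Tendsto (fun x : ℂ => (x, (0 : ℂ))) (𝓝 0) (𝓝 0) :=
  (by fun_prop : Continuous fun x : ℂ => (x, (0 : ℂ))).tendsto' 0 0 rfl

theorem tendsto_pair_right : Tendsto (fun x : ℂ => ((0 : ℂ), x)) (𝓝 0) (𝓝 0) :=
  (by fun_prop : Continuous fun x : ℂ => ((0 : ℂ), x)).tendsto' 0 0 rfl

theorem norm_sub_le_of_norm_dirD_le {Φ : ℂ × ℂ → ℂ} {s N : ℝ} {a u : ℂ × ℂ}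
    (hd : ∀ t : ℂ, ‖t‖ ≤ s → DifferentiableAt ℂ Φ (a + t • u) ∧ ‖dirD u Φ (a + t • u)‖ ≤ N)
    {t : ℂ} (ht : ‖t‖ ≤ s) : ‖Φ (a + t • u) - Φ a‖ ≤ N * ‖t‖ := by
  have hs : 0 ≤ s := (norm_nonneg _).trans ht
  have hc : ∀ t : ℂ, HasDerivAt (fun t : ℂ => a + t • u) u t := fun t => by
    simpa using ((hasDerivAt_id t).smul_const u).const_add a
  have := (convex_closedBall (0 : ℂ) s).norm_image_sub_le_of_norm_deriv_le
    (f := fun t : ℂ => Φ (a + t • u)) (C := N) (𝕜 := ℂ)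
    (fun t ht => by
      have h1 := (hd t (by simpa using ht)).1
      exact (h1.comp t (hc t).differentiableAt : _))
    (fun t ht => by
      have h1 := hd t (by simpa using ht)
      rw [deriv_comp_curve (c := fun t : ℂ => a + t • u) h1.1 (hc t).differentiableAt, (hc t).deriv]
      exact h1.2)
    (show (0 : ℂ) ∈ Metric.closedBall 0 s by simpa using hs)
    (show t ∈ Metric.closedBall 0 s by simpa using ht)
  simpa using this

/-- Uniqueness for linear Goursat problems: the derivatives of the `U i` in the second variable and
of the `V i` in the first one are controlled by the values of all of them. -/
theorem goursat_unique {ι : Type*} [Fintype ι] {U V : ι → ℂ × ℂ → ℂ}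
    (hU : ∀ i, AnalyticAt ℂ (U i) 0) (hV : ∀ i, AnalyticAt ℂ (V i) 0) {M : ℝ}
    (hU' : ∀ i, ∀ᶠ p in 𝓝 0, ‖dirD (0, 1) (U i) p‖ ≤ M * ∑ j, (‖U j p‖ + ‖V j p‖))
    (hV' : ∀ i, ∀ᶠ p in 𝓝 0, ‖dirD (1, 0) (V i) p‖ ≤ M * ∑ j, (‖U j p‖ + ‖V j p‖))
    (hU0 : ∀ i, ∀ᶠ x in 𝓝 0, U i (x, 0) = 0) (hV0 : ∀ i, ∀ᶠ x in 𝓝 0, V i (0, x) = 0) :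
    ∀ᶠ p in 𝓝 0, ∀ i, U i p = 0 ∧ V i p = 0 := by
  wlog hM : 0 ≤ M generalizing M
  · refine this (M := 0) (fun i => (hU' i).mono fun p hp => hp.trans ?_)
      (fun i => (hV' i).mono fun p hp => hp.trans ?_) le_rfl
    all_goals exact mul_le_mul_of_nonneg_right (not_le.1 hM).le (by positivity)
  let g : ℂ × ℂ → ℝ := fun p => ∑ j, (‖U j p‖ + ‖V j p‖)
  have hall : ∀ᶠ p in 𝓝 (0 : ℂ × ℂ), ∀ i, AnalyticAt ℂ (U i) p ∧ AnalyticAt ℂ (V i) p ∧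
      ‖dirD (0, 1) (U i) p‖ ≤ M * g p ∧ ‖dirD (1, 0) (V i) p‖ ≤ M * g p := by
    rw [eventually_all]
    intro i
    filter_upwards [(hU i).eventually_analyticAt, (hV i).eventually_analyticAt, hU' i, hV' i]
      with p h1 h2 h3 h4 using ⟨h1, h2, h3, h4⟩
  have hall0 : ∀ᶠ x in 𝓝 (0 : ℂ), ∀ i, U i (x, 0) = 0 ∧ V i (0, x) = 0 := by
    rw [eventually_all]
    intro i
    filter_upwards [hU0 i, hV0 i] with x h1 h2 using ⟨h1, h2⟩
  obtain ⟨r₁, hr₁, h1⟩ := Metric.eventually_nhds_iff_ball.1 hall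
  obtain ⟨r₂, hr₂, h2⟩ := Metric.eventually_nhds_iff_ball.1 hall0
  -- The choice s < 1 / B makes the contraction factor 2 · card ι · M · s smaller than one.
  set B : ℝ := 2 * Fintype.card ι * M + 1 with hB
  have hBpos : 0 < B := by positivity
  obtain ⟨s, hs0, hs⟩ : ∃ s > 0, s < r₁ ∧ s < r₂ ∧ s < 1 / B := by
    refine ⟨min (min r₁ r₂) (1 / B) / 2, by positivity, ?_, ?_, ?_⟩
    · have := (min_le_left (min r₁ r₂) (1 / B)).trans (min_le_left _ _); linarith
    · have := (min_le_left (min r₁ r₂) (1 / B)).trans (min_le_right _ _); linarith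
    · have := min_le_right (min r₁ r₂) (1 / B)
      have : 0 < 1 / B := by positivity
      linarith
  have hin : ∀ p : ℂ × ℂ, ‖p.1‖ ≤ s → ‖p.2‖ ≤ s → p ∈ Metric.ball (0 : ℂ × ℂ) r₁ := by
    intro p h1 h2
    rw [mem_ball_zero_iff]
    exact lt_of_le_of_lt (max_le h1 h2) hs.1
  have hmem : ∀ p ∈ Metric.closedBall (0 : ℂ × ℂ) s, ‖p.1‖ ≤ s ∧ ‖p.2‖ ≤ s := fun p hp => by
    rw [mem_closedBall_zero_iff] at hp
    exact ⟨(norm_fst_le p).trans hp, (norm_snd_le p).trans hp⟩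
  have hgc : ContinuousOn g (Metric.closedBall 0 s) := by
    refine continuousOn_finsetSum _ fun j _ => ?_
    refine ContinuousOn.add ?_ ?_
    all_goals refine ContinuousOn.norm fun p hp => ContinuousAt.continuousWithinAt ?_
    · exact (h1 p (hin p (hmem p hp).1 (hmem p hp).2) j).1.continuousAt
    · exact (h1 p (hin p (hmem p hp).1 (hmem p hp).2) j).2.1.continuousAt
  obtain ⟨p₀, hp₀, hmax⟩ := (isCompact_closedBall (0 : ℂ × ℂ) s).exists_isMaxOn
    ⟨0, by simpa using hs0.le⟩ hgc
  have hgn : ∀ p, 0 ≤ g p := fun p => Finset.sum_nonneg fun j _ => by positivity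
  obtain ⟨hp1, hp2⟩ := hmem p₀ hp₀
  have hle : ∀ p : ℂ × ℂ, ‖p.1‖ ≤ s → ‖p.2‖ ≤ s → M * g p ≤ M * g p₀ := fun p h1 h2 => by
    refine mul_le_mul_of_nonneg_left (hmax ?_) hM
    rw [mem_closedBall_zero_iff]
    exact max_le h1 h2
  -- Closed balls of ℂ × ℂ are bidiscs. From the face where U i (or V i) vanishes one reaches the
  -- maximum point p₀ of g along a segment inside the bidisc, and the mean value inequality applies.
  have hb : ∀ i, ‖U i p₀‖ ≤ M * g p₀ * s ∧ ‖V i p₀‖ ≤ M * g p₀ * s := by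
    intro i
    constructor
    · have := norm_sub_le_of_norm_dirD_le (Φ := U i) (a := (p₀.1, 0)) (u := (0, 1)) (s := s)
        (N := M * g p₀) (fun t ht => by
          have e : ((p₀.1, 0) : ℂ × ℂ) + t • ((0 : ℂ), (1 : ℂ)) = (p₀.1, t) := by simp
          rw [e]
          have := h1 _ (hin (p₀.1, t) hp1 ht) i
          exact ⟨this.1.differentiableAt, this.2.2.1.trans (hle (p₀.1, t) hp1 ht)⟩) hp2
      have e : ((p₀.1, 0) : ℂ × ℂ) + p₀.2 • ((0 : ℂ), (1 : ℂ)) = p₀ := by ext <;> simp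
      rw [e, (h2 p₀.1 (by simpa using lt_of_le_of_lt hp1 hs.2.1) i).1, sub_zero] at this
      exact this.trans (mul_le_mul_of_nonneg_left hp2 (mul_nonneg hM (hgn _)))
    · have := norm_sub_le_of_norm_dirD_le (Φ := V i) (a := (0, p₀.2)) (u := (1, 0)) (s := s)
        (N := M * g p₀) (fun t ht => by
          have e : ((0, p₀.2) : ℂ × ℂ) + t • ((1 : ℂ), (0 : ℂ)) = (t, p₀.2) := by simp
          rw [e]
          have := h1 _ (hin (t, p₀.2) ht hp2) i
          exact ⟨this.2.1.differentiableAt, this.2.2.2.trans (hle (t, p₀.2) ht hp2)⟩) hp1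
      have e : ((0, p₀.2) : ℂ × ℂ) + p₀.1 • ((1 : ℂ), (0 : ℂ)) = p₀ := by ext <;> simp
      rw [e, (h2 p₀.2 (by simpa using lt_of_le_of_lt hp2 hs.2.1) i).2, sub_zero] at this
      exact this.trans (mul_le_mul_of_nonneg_left hp1 (mul_nonneg hM (hgn _)))
  have hg0 : g p₀ ≤ 0 := by
    have h3 : g p₀ ≤ ∑ _j : ι, 2 * (M * g p₀ * s) :=
      Finset.sum_le_sum fun j _ => by linarith [(hb j).1, (hb j).2]
    simp only [Finset.sum_const, Finset.card_univ, nsmul_eq_mul] at h3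
    by_contra hpos
    push Not at hpos
    have h4 : (B - 1) * s < 1 := by
      have := (lt_div_iff₀ hBpos).1 hs.2.2
      nlinarith
    have h5 : g p₀ ≤ ((B - 1) * s) * g p₀ := by
      rw [hB]; linarith
    nlinarith
  filter_upwards [Metric.closedBall_mem_nhds (0 : ℂ × ℂ) hs0] with p hp i
  have h6 : g p ≤ 0 := (hmax hp).trans hg0
  have h7 : ‖U i p‖ + ‖V i p‖ ≤ g p :=
    Finset.single_le_sum (f := fun j => ‖U j p‖ + ‖V j p‖) (fun j _ => by positivity)
      (Finset.mem_univ i)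
  constructor
  · exact norm_le_zero_iff.1 (by linarith [norm_nonneg (V i p)])
  · exact norm_le_zero_iff.1 (by linarith [norm_nonneg (U i p)])

theorem AnalyticAt.eventually_norm_le {V : Type*} [NormedAddCommGroup V] [NormedSpace ℂ V]
    {f : V → ℂ} {a : V} (h : AnalyticAt ℂ f a) : ∀ᶠ p in 𝓝 a, ‖f p‖ ≤ ‖f a‖ + 1 :=
  (h.continuousAt.norm.eventually_lt_const (lt_add_one _)).mono fun _ hp => hp.le

/-- Uniqueness for `∂₂ f = α f` with data on `{η = 0}`. -/
theorem eventually_eq_zero_of_dirD_snd {f α : ℂ × ℂ → ℂ} (hf : AnalyticAt ℂ f 0)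
    (hα : AnalyticAt ℂ α 0) (h : ∀ᶠ p in 𝓝 0, dirD (0, 1) f p = α p * f p)
    (h0 : ∀ᶠ x in 𝓝 0, f (x, 0) = 0) : ∀ᶠ p in 𝓝 0, f p = 0 := by
  have := goursat_unique (ι := Unit) (U := fun _ => f) (V := fun _ _ => 0) (fun _ => hf)
    (fun _ => analyticAt_const) (M := ‖α 0‖ + 1)
    (fun _ => by
      filter_upwards [h, hα.eventually_norm_le] with p h1 h2
      rw [h1, norm_mul]
      simp only [Finset.univ_unique, Finset.sum_singleton, norm_zero, add_zero]
      gcongr)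
    (fun _ => .of_forall fun p => by rw [dirD_const]; simp; positivity)
    (fun _ => h0) (fun _ => .of_forall fun _ => rfl)
  exact this.mono fun p hp => (hp ()).1

/-- Uniqueness for `∂₁ f = α f` with data on `{ζ = 0}`. -/
theorem eventually_eq_zero_of_dirD_fst {f α : ℂ × ℂ → ℂ} (hf : AnalyticAt ℂ f 0)
    (hα : AnalyticAt ℂ α 0) (h : ∀ᶠ p in 𝓝 0, dirD (1, 0) f p = α p * f p)
    (h0 : ∀ᶠ x in 𝓝 0, f (0, x) = 0) : ∀ᶠ p in 𝓝 0, f p = 0 := by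
  have := goursat_unique (ι := Unit) (V := fun _ => f) (U := fun _ _ => 0)
    (fun _ => analyticAt_const) (fun _ => hf) (M := ‖α 0‖ + 1)
    (fun _ => .of_forall fun p => by rw [dirD_const]; simp; positivity)
    (fun _ => by
      filter_upwards [h, hα.eventually_norm_le] with p h1 h2
      rw [h1, norm_mul]
      simp only [Finset.univ_unique, Finset.sum_singleton, norm_zero, zero_add]
      gcongr)
    (fun _ => .of_forall fun _ => rfl) (fun _ => h0)
  exact this.mono fun p hp => (hp ()).2

end Goursat

/-! ### The Levi kernel and its conjugate -/

section LeviKernel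

variable {V : Type*} [NormedAddCommGroup V] [NormedSpace ℂ V]

theorem eventually_dirD_mul_add {A k B : V → ℂ} {a : V} (hA : AnalyticAt ℂ A a)
    (hk : AnalyticAt ℂ k a) (hB : AnalyticAt ℂ B a) (h : ∀ᶠ v in 𝓝 a, A v * k v + B v = 0)
    (u : V) : ∀ᶠ v in 𝓝 a, dirD u A v * k v + A v * dirD u k v + dirD u B v = 0 := by
  have h' : (fun v => A v * k v + B v) =ᶠ[𝓝 a] fun _ => 0 := h
  filter_upwards [h'.dirD u, hA.eventually_analyticAt, hk.eventually_analyticAt,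
    hB.eventually_analyticAt] with v h1 h2 h3 h4
  rw [dirD_const, dirD_add (Φ := fun v => A v * k v) (h2.differentiableAt.mul h3.differentiableAt) h4.differentiableAt,
    dirD_mul h2.differentiableAt h3.differentiableAt] at h1
  exact h1

/-- The coefficient of the Levi kernel field is annihilated by the conjugate kernel field. -/
theorem levi_kernel_involutive {Φ k l : V → ℂ} {a : V} (hΦ : AnalyticAt ℂ Φ a)
    (hk : AnalyticAt ℂ k a) (hl : AnalyticAt ℂ l a) (e₁ e₂ e₃ e₄ : V)
    (hA : dirD e₁ (dirD e₃ Φ) a ≠ 0)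
    (h₁ : ∀ᶠ v in 𝓝 a, dirD e₁ (dirD e₃ Φ) v * k v + dirD e₂ (dirD e₃ Φ) v = 0)
    (h₂ : ∀ᶠ v in 𝓝 a, dirD e₁ (dirD e₃ Φ) v * l v + dirD e₁ (dirD e₄ Φ) v = 0)
    (hdet : ∀ᶠ v in 𝓝 a, dirD e₁ (dirD e₃ Φ) v * dirD e₂ (dirD e₄ Φ) v =
      dirD e₁ (dirD e₄ Φ) v * dirD e₂ (dirD e₃ Φ) v) :
    ∀ᶠ v in 𝓝 a, l v * dirD e₃ k v + dirD e₄ k v = 0 := by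
  have an : ∀ x y, AnalyticAt ℂ (dirD x (dirD y Φ)) a := fun x y => (hΦ.dirD y).dirD x
  have hA' : ∀ᶠ v in 𝓝 a, dirD e₁ (dirD e₃ Φ) v ≠ 0 :=
    (an e₁ e₃).continuousAt.eventually_ne hA
  -- The determinant vanishes, so the kernel relation for the row of e₁ implies the one for the row
  -- of e₂.
  have h₃ : ∀ᶠ v in 𝓝 a, dirD e₂ (dirD e₃ Φ) v * l v + dirD e₂ (dirD e₄ Φ) v = 0 := by
    filter_upwards [h₂, hdet, hA'] with v h2 h3 h4
    have : dirD e₁ (dirD e₃ Φ) v * (dirD e₂ (dirD e₃ Φ) v * l v + dirD e₂ (dirD e₄ Φ) v) = 0 := by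
      linear_combination dirD e₂ (dirD e₃ Φ) v * h2 + h3
    exact (mul_eq_zero.1 this).resolve_left h4
  have comm : ∀ x y, ∀ᶠ v in 𝓝 a,
      dirD x (dirD y (dirD e₃ Φ)) v = dirD y (dirD x (dirD e₃ Φ)) v :=
    fun x y => dirD_comm_eventually (hΦ.dirD e₃) x y
  have c : ∀ y, ∀ᶠ v in 𝓝 a,
      dirD e₄ (dirD y (dirD e₃ Φ)) v = dirD e₃ (dirD y (dirD e₄ Φ)) v := by
    intro y
    have i1 := dirD_comm_eventually (hΦ.dirD e₃) e₄ y
    have i2 := (dirD_comm_eventually hΦ e₄ e₃).dirD y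
    have i3 := dirD_comm_eventually (hΦ.dirD e₄) y e₃
    filter_upwards [i1, i2, i3] with v j1 j2 j3
    rw [j1, j2, j3]
  filter_upwards [eventually_dirD_mul_add (an _ _) hk (an _ _) h₁ e₄,
    eventually_dirD_mul_add (an _ _) hk (an _ _) h₁ e₃,
    eventually_dirD_mul_add (an _ _) hl (an _ _) h₂ e₃,
    eventually_dirD_mul_add (an _ _) hl (an _ _) h₃ e₃, hA', h₁, c e₁, c e₂]
    with v a1 a2 a3 a4 a5 a6 c1 c2
  -- Differentiating the kernel relations along e₃ and e₄, all third derivatives of Φ cancel by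
  -- symmetry; what is left is the claim times a nonzero Levi coefficient.
  have : dirD e₁ (dirD e₃ Φ) v * (l v * dirD e₃ k v + dirD e₄ k v) = 0 := by
    rw [c1, c2] at a1
    linear_combination a1 + l v * a2 - k v * a3 - a4 + dirD e₃ l v * a6
  exact (mul_eq_zero.1 this).resolve_left a5

end LeviKernel

/-! ### Initial values of the kernel coefficients; prenormal functions -/

section OrderThree

variable {V : Type*} [NormedAddCommGroup V] [NormedSpace ℂ V]

theorem dirD_comp_clm_eventually {V' : Type*} [NormedAddCommGroup V'] [NormedSpace ℂ V']
    {f : V → ℂ} (hf : AnalyticAt ℂ f 0) (j : V' →L[ℂ] V) (u : V') :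
    ∀ᶠ p in 𝓝 0, dirD u (fun q => f (j q)) p = dirD (j u) f (j p) := by
  have hj : Tendsto j (𝓝 0) (𝓝 0) := j.continuous.tendsto' 0 0 (map_zero j)
  filter_upwards [hj.eventually hf.eventually_analyticAt] with p hp
  exact dirD_comp_clm j hp.differentiableAt u

theorem AnalyticAt.comp_clm {V' : Type*} [NormedAddCommGroup V'] [NormedSpace ℂ V'] {f : V → ℂ}
    (hf : AnalyticAt ℂ f 0) (j : V' →L[ℂ] V) : AnalyticAt ℂ (fun q => f (j q)) 0 :=
  AnalyticAt.comp (g := f) (by simpa using hf) (j.analyticAt 0)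

theorem eventually_comp_clm {V' : Type*} [NormedAddCommGroup V'] [NormedSpace ℂ V'] {P : V → Prop}
    (hP : ∀ᶠ v in 𝓝 0, P v) (j : V' →L[ℂ] V) : ∀ᶠ p in 𝓝 0, P (j p) :=
  (j.continuous.tendsto' 0 0 (map_zero j)).eventually hP

/-- Values along `{W = 0}` of the Levi kernel coefficient and of its derivatives. -/
theorem levi_kernel_initial {Φ k : V → ℂ} (hΦ : AnalyticAt ℂ Φ 0) (hk : AnalyticAt ℂ k 0)
    (j : ℂ × ℂ →L[ℂ] V) (e₃ : V)
    (h₁ : ∀ᶠ v in 𝓝 0, dirD (j (1, 0)) (dirD e₃ Φ) v * k v + dirD (j (0, 1)) (dirD e₃ Φ) v = 0)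
    (one : ∀ᶠ Z in 𝓝 0, dirD e₃ Φ (j Z) = Z.1)
    (two : ∀ᶠ Z in 𝓝 0, dirD e₃ (dirD e₃ Φ) (j Z) = Z.2) :
    ∀ᶠ Z in 𝓝 0, dirD (j (1, 0)) (dirD e₃ Φ) (j Z) = 1 ∧ k (j Z) = 0 ∧
      dirD (j (1, 0)) k (j Z) = 0 ∧ dirD e₃ k (j Z) = -1 := by
  have an : ∀ x y, AnalyticAt ℂ (dirD x (dirD y Φ)) 0 := fun x y => (hΦ.dirD y).dirD x
  have dfst : ∀ u Z : ℂ × ℂ, dirD u (fun Z : ℂ × ℂ => Z.1) Z = u.1 := fun u Z =>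
    dirD_clm (ContinuousLinearMap.fst ℂ ℂ ℂ) Z u
  have dsnd : ∀ u Z : ℂ × ℂ, dirD u (fun Z : ℂ × ℂ => Z.2) Z = u.2 := fun u Z =>
    dirD_clm (ContinuousLinearMap.snd ℂ ℂ ℂ) Z u
  have h3 : ∀ u, ∀ᶠ Z in 𝓝 0, dirD (j u) (dirD e₃ Φ) (j Z) = u.1 := fun u => by
    filter_upwards [dirD_comp_clm_eventually (hΦ.dirD e₃) j u,
      EventuallyEq.dirD (show (fun Z => dirD e₃ Φ (j Z)) =ᶠ[𝓝 0] fun Z => Z.1 from one) u]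
      with Z h1 h2
    rw [← h1, h2, dfst]
  have h4 : ∀ u, ∀ᶠ Z in 𝓝 0, dirD (j u) (dirD e₃ (dirD e₃ Φ)) (j Z) = u.2 := fun u => by
    filter_upwards [dirD_comp_clm_eventually (an e₃ e₃) j u,
      EventuallyEq.dirD (show (fun Z => dirD e₃ (dirD e₃ Φ) (j Z)) =ᶠ[𝓝 0] fun Z => Z.2 from two) u]
      with Z h1 h2
    rw [← h1, h2, dsnd]
  have h5 : ∀ᶠ Z in 𝓝 0, k (j Z) = 0 := by
    filter_upwards [h3 (1, 0), h3 (0, 1), eventually_comp_clm h₁ j] with Z a b c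
    rw [a, b] at c
    simpa using c
  have h6 : ∀ᶠ Z in 𝓝 0, dirD (j (1, 0)) k (j Z) = 0 := by
    filter_upwards [dirD_comp_clm_eventually hk j (1, 0),
      EventuallyEq.dirD (show (fun Z => k (j Z)) =ᶠ[𝓝 0] fun _ => 0 from h5) (1, 0)] with Z a b
    rw [← a, b, dirD_const]
  filter_upwards [h3 (1, 0), h5, h6, eventually_comp_clm
    (eventually_dirD_mul_add (an _ _) hk (an _ _) h₁ e₃) j, h4 (0, 1),
    eventually_comp_clm (dirD_comm_eventually (hΦ.dirD e₃) e₃ (j (0, 1))) j] with Z a b c d e f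
  -- In the e₃-derivative of the kernel relation, k = 0 and Φ_zw = 1 on the slice, and the last term
  -- is ∂_ζ of Φ_ww = ζ.
  refine ⟨a, b, c, ?_⟩
  rw [a, b, f, e] at d
  linear_combination d

/-- The slice `{z = w = 0}`. -/
noncomputable def leafSlice : ℂ × ℂ →L[ℂ] Pol :=
  ((0 : ℂ × ℂ →L[ℂ] ℂ).prod (ContinuousLinearMap.fst ℂ ℂ ℂ)).prod
    ((0 : ℂ × ℂ →L[ℂ] ℂ).prod (ContinuousLinearMap.snd ℂ ℂ ℂ))

/-- The slice `{W = 0}`. -/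
noncomputable def holSlice : ℂ × ℂ →L[ℂ] Pol := ContinuousLinearMap.inl ℂ (ℂ × ℂ) (ℂ × ℂ)

/-- The slice `{Z = 0}`. -/
noncomputable def antiSlice : ℂ × ℂ →L[ℂ] Pol := ContinuousLinearMap.inr ℂ (ℂ × ℂ) (ℂ × ℂ)

theorem leafSlice_apply (p : ℂ × ℂ) : leafSlice p = ((0, p.1), (0, p.2)) := rfl
theorem holSlice_apply (p : ℂ × ℂ) : holSlice p = (p, 0) := rfl
theorem antiSlice_apply (p : ℂ × ℂ) : antiSlice p = (0, p) := rfl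

/-- The Levi determinant of a polarized defining function vanishes identically. -/
def LeviDegenerate (Φ : Pol → ℂ) : Prop :=
  ∀ᶠ v in 𝓝 0, dirD ez (dirD ew Φ) v * dirD eζ (dirD eη Φ) v =
    dirD ez (dirD eη Φ) v * dirD eζ (dirD ew Φ) v

/-- The first three coefficients in `z̄` of the defining function at `ζ̄ = 0` are `0`, `z` and
`ζ / 2`, and it is real with degenerate Levi form. -/
structure Prenormal (Φ : Pol → ℂ) : Prop where
  analytic : AnalyticAt ℂ Φ 0
  hermitian : IsHermitian Φ
  levi : LeviDegenerate Φ
  zero : ∀ᶠ Z in 𝓝 (0 : ℂ × ℂ), Φ (Z, 0) = 0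
  one : ∀ᶠ Z in 𝓝 (0 : ℂ × ℂ), dirD ew Φ (Z, 0) = Z.1
  two : ∀ᶠ Z in 𝓝 (0 : ℂ × ℂ), dirD ew (dirD ew Φ) (Z, 0) = Z.2

theorem polSwap_zero : polSwap 0 = 0 := by simp [polSwap]

theorem IsHermitian.dirD {Φ : Pol → ℂ} (hΦ : AnalyticAt ℂ Φ 0) (h : IsHermitian Φ) (u : Pol) :
    ∀ᶠ v in 𝓝 0, dirD u Φ v = star (dirD (polSwap u) Φ (polSwap v)) :=
  dirD_conj_polSwap hΦ (polSwap_zero.symm ▸ hΦ) h u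

theorem IsHermitian.dirD_dirD {Φ : Pol → ℂ} (hΦ : AnalyticAt ℂ Φ 0) (h : IsHermitian Φ)
    (u u' : Pol) : ∀ᶠ v in 𝓝 0,
      _root_.dirD u (_root_.dirD u' Φ) v =
        star (_root_.dirD (polSwap u) (_root_.dirD (polSwap u') Φ) (polSwap v)) :=
  dirD_conj_polSwap (hΦ.dirD u') (polSwap_zero.symm ▸ hΦ.dirD _) (h.dirD hΦ u') u

theorem tendsto_star_pair : Tendsto (fun W : ℂ × ℂ => star W) (𝓝 0) (𝓝 0) :=
  continuous_star.tendsto' 0 0 (star_zero _)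

namespace Prenormal

variable {Φ : Pol → ℂ}

theorem zero_conj (h : Prenormal Φ) : ∀ᶠ W in 𝓝 0, Φ (antiSlice W) = 0 := by
  filter_upwards [eventually_comp_clm h.hermitian antiSlice, tendsto_star_pair.eventually h.zero]
    with W h1 h2
  rw [h1]
  simp [polSwap, antiSlice_apply, h2]

theorem one_conj (h : Prenormal Φ) : ∀ᶠ W in 𝓝 0, dirD ez Φ (antiSlice W) = W.1 := by
  filter_upwards [eventually_comp_clm (h.hermitian.dirD h.analytic ez) antiSlice,
    tendsto_star_pair.eventually h.one] with W h1 h2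
  rw [h1]
  have e : polSwap ez = ew := by simp [polSwap, Prod.star_def]
  have e' : polSwap (antiSlice W) = (star W, 0) := by simp [polSwap, antiSlice_apply]
  rw [e, e', h2]
  simp

theorem two_conj (h : Prenormal Φ) : ∀ᶠ W in 𝓝 0, dirD ez (dirD ez Φ) (antiSlice W) = W.2 := by
  filter_upwards [eventually_comp_clm (h.hermitian.dirD_dirD h.analytic ez ez) antiSlice,
    tendsto_star_pair.eventually h.two] with W h1 h2
  rw [h1]
  have e : polSwap ez = ew := by simp [polSwap, Prod.star_def]
  have e' : polSwap (antiSlice W) = (star W, 0) := by simp [polSwap, antiSlice_apply]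
  rw [e, e', h2]
  simp

end Prenormal

/-- `1 / (1 - ζ η)` as a function of `(ζ, η)`. -/
noncomputable def geomKernel (p : ℂ × ℂ) : ℂ := (1 - p.1 * p.2)⁻¹

theorem eventually_one_sub_ne_zero : ∀ᶠ p in 𝓝 (0 : ℂ × ℂ), 1 - p.1 * p.2 ≠ 0 := by
  have : ContinuousAt (fun p : ℂ × ℂ => 1 - p.1 * p.2) 0 := by fun_prop
  exact this.eventually_ne (by simp)

theorem analyticAt_geomKernel : AnalyticAt ℂ geomKernel 0 := by
  unfold geomKernel
  refine AnalyticAt.inv ?_ (by simp)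
  exact analyticAt_const.sub (analyticAt_fst.mul analyticAt_snd)

theorem dirD_geomKernel (u : ℂ × ℂ) :
    ∀ᶠ p in 𝓝 0, dirD u geomKernel p = (u.1 * p.2 + p.1 * u.2) * geomKernel p ^ 2 := by
  have dfst : ∀ u Z : ℂ × ℂ, dirD u (fun Z : ℂ × ℂ => Z.1) Z = u.1 := fun u Z =>
    dirD_clm (ContinuousLinearMap.fst ℂ ℂ ℂ) Z u
  have dsnd : ∀ u Z : ℂ × ℂ, dirD u (fun Z : ℂ × ℂ => Z.2) Z = u.2 := fun u Z =>
    dirD_clm (ContinuousLinearMap.snd ℂ ℂ ℂ) Z u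
  have h1 : (fun p : ℂ × ℂ => (1 - p.1 * p.2) * geomKernel p) =ᶠ[𝓝 0] fun _ => 1 := by
    filter_upwards [eventually_one_sub_ne_zero] with p hp
    exact mul_inv_cancel₀ hp
  filter_upwards [h1.dirD u, h1, analyticAt_geomKernel.eventually_analyticAt] with p h2 h3 h4
  have hd : DifferentiableAt ℂ (fun p : ℂ × ℂ => 1 - p.1 * p.2) p := by fun_prop
  rw [dirD_const, dirD_mul hd h4.differentiableAt,
    dirD_sub (differentiableAt_const _) (by fun_prop), dirD_const,
    dirD_mul differentiableAt_fst differentiableAt_snd, dfst, dsnd] at h2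
  linear_combination geomKernel p * h2 - dirD u geomKernel p * h3

end OrderThree

/-! ### Agreement with the model on the leaf z = w = 0 -/

section OrderThree

theorem leafSlice_fst : leafSlice (1, 0) = eζ := by simp [leafSlice_apply]
theorem leafSlice_snd : leafSlice (0, 1) = eη := by simp [leafSlice_apply]
theorem holSlice_fst : holSlice (1, 0) = ez := rfl
theorem holSlice_snd : holSlice (0, 1) = eζ := rfl
theorem antiSlice_snd : antiSlice (0, 1) = eη := rfl

theorem eventually_leafSlice_left {P : Pol → Prop} (h : ∀ᶠ Z in 𝓝 0, P (holSlice Z)) :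
    ∀ᶠ x in 𝓝 (0 : ℂ), P (leafSlice (x, 0)) :=
  (tendsto_pair_right.eventually h).mono fun _ hx => hx

theorem eventually_leafSlice_right {P : Pol → Prop} (h : ∀ᶠ Z in 𝓝 0, P (antiSlice Z)) :
    ∀ᶠ x in 𝓝 (0 : ℂ), P (leafSlice (0, x)) :=
  (tendsto_pair_right.eventually h).mono fun _ hx => hx

/-- For a pair of kernel coefficients with the same initial data as the model, the restrictions to
the leaf `{z = w = 0}` agree with the model. -/
theorem levi_kernel_leaf {k l : Pol → ℂ} (hk : AnalyticAt ℂ k 0) (hl : AnalyticAt ℂ l 0)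
    (hkl : ∀ᶠ v in 𝓝 0, l v * dirD ew k v + dirD eη k v = 0)
    (hlk : ∀ᶠ v in 𝓝 0, k v * dirD ez l v + dirD eζ l v = 0)
    (hk0 : ∀ᶠ Z in 𝓝 0, k (holSlice Z) = 0 ∧ dirD ez k (holSlice Z) = 0 ∧
      dirD ew k (holSlice Z) = -1)
    (hl0 : ∀ᶠ W in 𝓝 0, l (antiSlice W) = 0 ∧ dirD ew l (antiSlice W) = 0 ∧
      dirD ez l (antiSlice W) = -1) :
    ∀ᶠ p in 𝓝 0, k (leafSlice p) = 0 ∧ l (leafSlice p) = 0 ∧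
      dirD ez k (leafSlice p) = -(p.2 * geomKernel p) ∧
      dirD ez l (leafSlice p) = -geomKernel p := by
  have hkl' : ∀ u, ∀ᶠ v in 𝓝 0, dirD u l v * dirD ew k v + l v * dirD u (dirD ew k) v +
      dirD u (dirD eη k) v = 0 := eventually_dirD_mul_add hl (hk.dirD ew) (hk.dirD eη) hkl
  have hlk' : ∀ u, ∀ᶠ v in 𝓝 0, dirD u k v * dirD ez l v + k v * dirD u (dirD ez l) v +
      dirD u (dirD eζ l) v = 0 := eventually_dirD_mul_add hk (hl.dirD ez) (hl.dirD eζ) hlk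
  have hX := (hk.dirD ew).comp_clm leafSlice
  have hP := (hk.dirD ez).comp_clm leafSlice
  have hY := (hl.dirD ez).comp_clm leafSlice
  have hQ := (hl.dirD ew).comp_clm leafSlice
  have hC := analyticAt_geomKernel
  have hζC : AnalyticAt ℂ (fun p : ℂ × ℂ => p.1 * geomKernel p) 0 := analyticAt_fst.mul hC
  have hηC : AnalyticAt ℂ (fun p : ℂ × ℂ => p.2 * geomKernel p) 0 := analyticAt_snd.mul hC
  have dfst : ∀ u Z : ℂ × ℂ, dirD u (fun Z : ℂ × ℂ => Z.1) Z = u.1 := fun u Z =>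
    dirD_clm (ContinuousLinearMap.fst ℂ ℂ ℂ) Z u
  have dsnd : ∀ u Z : ℂ × ℂ, dirD u (fun Z : ℂ × ℂ => Z.2) Z = u.2 := fun u Z =>
    dirD_clm (ContinuousLinearMap.snd ℂ ℂ ℂ) Z u
  -- the leaf through the origin is `{z = 0}`
  have hu : ∀ᶠ p in 𝓝 0, k (leafSlice p) = 0 ∧ l (leafSlice p) = 0 := by
    have := goursat_unique (ι := Unit) (U := fun _ p => k (leafSlice p))
      (V := fun _ p => l (leafSlice p)) (fun _ => hk.comp_clm _) (fun _ => hl.comp_clm _)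
      (M := (‖dirD ew k (leafSlice 0)‖ + 1) + (‖dirD ez l (leafSlice 0)‖ + 1))
      (fun _ => by
        filter_upwards [dirD_comp_clm_eventually hk leafSlice (0, 1),
          eventually_comp_clm hkl leafSlice, hX.eventually_norm_le] with p h1 h2 h3
        rw [h1, leafSlice_snd, eq_neg_of_add_eq_zero_right h2, norm_neg, norm_mul]
        simp only [Finset.univ_unique, Finset.sum_singleton]
        nlinarith [norm_nonneg (k (leafSlice p)), norm_nonneg (l (leafSlice p)),
          norm_nonneg (dirD ew k (leafSlice 0)), norm_nonneg (dirD ez l (leafSlice 0)),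
          norm_nonneg (dirD ew k (leafSlice p))])
      (fun _ => by
        filter_upwards [dirD_comp_clm_eventually hl leafSlice (1, 0),
          eventually_comp_clm hlk leafSlice, hY.eventually_norm_le] with p h1 h2 h3
        rw [h1, leafSlice_fst, eq_neg_of_add_eq_zero_right h2, norm_neg, norm_mul]
        simp only [Finset.univ_unique, Finset.sum_singleton]
        nlinarith [norm_nonneg (k (leafSlice p)), norm_nonneg (l (leafSlice p)),
          norm_nonneg (dirD ew k (leafSlice 0)), norm_nonneg (dirD ez l (leafSlice 0)),
          norm_nonneg (dirD ez l (leafSlice p))])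
      (fun _ => (eventually_leafSlice_left (P := fun v => k v = 0) (hk0.mono fun _ h => h.1)))
      (fun _ => (eventually_leafSlice_right (P := fun v => l v = 0) (hl0.mono fun _ h => h.1)))
    exact this.mono fun p hp => hp ()
  -- derivatives of `k` and `l` along the leaf
  have dk : ∀ u, ∀ᶠ p in 𝓝 0, dirD (0, 1) (fun p => dirD u k (leafSlice p)) p =
      -(dirD u l (leafSlice p) * dirD ew k (leafSlice p)) := by
    intro u
    filter_upwards [dirD_comp_clm_eventually (hk.dirD u) leafSlice (0, 1),
      eventually_comp_clm (hkl' u) leafSlice, hu,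
      eventually_comp_clm (dirD_comm_eventually hk eη u) leafSlice] with p h1 h2 h3 h4
    rw [h1, leafSlice_snd, h4]
    rw [h3.2] at h2
    linear_combination h2
  have dl : ∀ u, ∀ᶠ p in 𝓝 0, dirD (1, 0) (fun p => dirD u l (leafSlice p)) p =
      -(dirD u k (leafSlice p) * dirD ez l (leafSlice p)) := by
    intro u
    filter_upwards [dirD_comp_clm_eventually (hl.dirD u) leafSlice (1, 0),
      eventually_comp_clm (hlk' u) leafSlice, hu,
      eventually_comp_clm (dirD_comm_eventually hl eζ u) leafSlice] with p h1 h2 h3 h4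
    rw [h1, leafSlice_fst, h4]
    rw [h3.1] at h2
    linear_combination h2
  have hCeq : ∀ᶠ p in 𝓝 (0 : ℂ × ℂ), (1 - p.1 * p.2) * geomKernel p = 1 := by
    filter_upwards [eventually_one_sub_ne_zero] with p hp using mul_inv_cancel₀ hp
  have dηC : ∀ᶠ p in 𝓝 (0 : ℂ × ℂ), dirD (0, 1) (fun p : ℂ × ℂ => p.2 * geomKernel p) p =
      geomKernel p ^ 2 := by
    filter_upwards [dirD_geomKernel (0, 1), hC.eventually_analyticAt, hCeq] with p h1 h2 h3
    rw [dirD_mul differentiableAt_snd h2.differentiableAt, dsnd, h1]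
    linear_combination -geomKernel p * h3
  have dζC : ∀ᶠ p in 𝓝 (0 : ℂ × ℂ), dirD (1, 0) (fun p : ℂ × ℂ => p.1 * geomKernel p) p =
      geomKernel p ^ 2 := by
    filter_upwards [dirD_geomKernel (1, 0), hC.eventually_analyticAt, hCeq] with p h1 h2 h3
    rw [dirD_mul differentiableAt_fst h2.differentiableAt, dfst, h1]
    linear_combination -geomKernel p * h3
  -- Put C = 1 / (1 - ζη). The system `dk`, `dl` is quadratic in (k_w, k_z, l_z, l_w), and (-C, -ηC,
  -- -C, -ζC) is the solution belonging to the model. The four differences therefore satisfy a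
  -- linear Goursat system, with zero data by `hk0` and `hl0`.
  let U : Fin 2 → ℂ × ℂ → ℂ := ![fun p => dirD ew k (leafSlice p) + geomKernel p,
    fun p => dirD ez k (leafSlice p) + p.2 * geomKernel p]
  let W : Fin 2 → ℂ × ℂ → ℂ := ![fun p => dirD ez l (leafSlice p) + geomKernel p,
    fun p => dirD ew l (leafSlice p) + p.1 * geomKernel p]
  set M : ℝ := (‖dirD ew k (leafSlice 0)‖ + 1) + (‖dirD ez l (leafSlice 0)‖ + 1) +
    (‖geomKernel 0‖ + 1) + (‖(0 : ℂ × ℂ).1 * geomKernel 0‖ + 1) +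
    (‖(0 : ℂ × ℂ).2 * geomKernel 0‖ + 1)
  have bound : ∀ᶠ p in 𝓝 (0 : ℂ × ℂ), ∀ α β : ℂ,
      (α = dirD ew k (leafSlice p) ∨ α = dirD ez l (leafSlice p) ∨ α = geomKernel p ∨
        α = p.1 * geomKernel p ∨ α = p.2 * geomKernel p) → ‖α * β‖ ≤ M * ‖β‖ := by
    filter_upwards [hX.eventually_norm_le, hY.eventually_norm_le, hC.eventually_norm_le,
      hζC.eventually_norm_le, hηC.eventually_norm_le] with p h1 h2 h3 h4 h5 α β hα
    rw [norm_mul]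
    refine mul_le_mul_of_nonneg_right ?_ (norm_nonneg _)
    have n1 := norm_nonneg (dirD ew k (leafSlice 0))
    have n2 := norm_nonneg (dirD ez l (leafSlice 0))
    have n3 := norm_nonneg (geomKernel 0)
    have n4 := norm_nonneg ((0 : ℂ × ℂ).1 * geomKernel 0)
    have n5 := norm_nonneg ((0 : ℂ × ℂ).2 * geomKernel 0)
    rcases hα with rfl | rfl | rfl | rfl | rfl <;> simp only [M] <;> linarith
  have key := goursat_unique (U := U) (V := W) (M := M)
    (fun i => by
      fin_cases i
      · exact hX.add hC
      · exact hP.add hηC)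
    (fun i => by
      fin_cases i
      · exact hY.add hC
      · exact hQ.add hζC)
    (fun i => by
      fin_cases i
      · filter_upwards [dk ew, dirD_geomKernel (0, 1), bound, hX.eventually_analyticAt,
          hC.eventually_analyticAt] with p h1 h2 h3 h4 h5
        have e : dirD (0, 1) (U 0) p = p.1 * geomKernel p * U 0 p -
            dirD ew k (leafSlice p) * W 1 p := by
          simp only [U, W, Matrix.cons_val_zero, Matrix.cons_val_one]
          rw [dirD_add h4.differentiableAt h5.differentiableAt, h1, h2]
          ring
        rw [Fin.sum_univ_two]
        change ‖dirD (0, 1) (U 0) p‖ ≤ _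
        rw [e]
        have b1 := h3 _ (U 0 p) (Or.inr (Or.inr (Or.inr (Or.inl rfl))))
        have b2 := h3 _ (W 1 p) (Or.inl rfl)
        have hM : 0 ≤ M := by positivity
        have b3 := norm_sub_le (p.1 * geomKernel p * U 0 p) (dirD ew k (leafSlice p) * W 1 p)
        have n1 := mul_nonneg hM (norm_nonneg (U 1 p))
        have n2 := mul_nonneg hM (norm_nonneg (W 0 p))
        linarith
      · filter_upwards [dk ez, dηC, bound, hP.eventually_analyticAt,
          hηC.eventually_analyticAt] with p h1 h2 h3 h4 h5
        have e : dirD (0, 1) (U 1) p = geomKernel p * U 0 p -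
            dirD ew k (leafSlice p) * W 0 p := by
          simp only [U, W, Matrix.cons_val_zero, Matrix.cons_val_one]
          rw [dirD_add h4.differentiableAt h5.differentiableAt, h1, h2]
          ring
        rw [Fin.sum_univ_two]
        change ‖dirD (0, 1) (U 1) p‖ ≤ _
        rw [e]
        have b1 := h3 _ (U 0 p) (Or.inr (Or.inr (Or.inl rfl)))
        have b2 := h3 _ (W 0 p) (Or.inl rfl)
        have hM : 0 ≤ M := by positivity
        have b3 := norm_sub_le (geomKernel p * U 0 p) (dirD ew k (leafSlice p) * W 0 p)
        have n1 := mul_nonneg hM (norm_nonneg (U 1 p))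
        have n2 := mul_nonneg hM (norm_nonneg (W 1 p))
        linarith)
    (fun i => by
      fin_cases i
      · filter_upwards [dl ez, dirD_geomKernel (1, 0), bound, hY.eventually_analyticAt,
          hC.eventually_analyticAt] with p h1 h2 h3 h4 h5
        have e : dirD (1, 0) (W 0) p = p.2 * geomKernel p * W 0 p -
            dirD ez l (leafSlice p) * U 1 p := by
          simp only [U, W, Matrix.cons_val_zero, Matrix.cons_val_one]
          rw [dirD_add h4.differentiableAt h5.differentiableAt, h1, h2]
          ring
        rw [Fin.sum_univ_two]
        change ‖dirD (1, 0) (W 0) p‖ ≤ _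
        rw [e]
        have b1 := h3 _ (W 0 p) (Or.inr (Or.inr (Or.inr (Or.inr rfl))))
        have b2 := h3 _ (U 1 p) (Or.inr (Or.inl rfl))
        have hM : 0 ≤ M := by positivity
        have b3 := norm_sub_le (p.2 * geomKernel p * W 0 p) (dirD ez l (leafSlice p) * U 1 p)
        have n1 := mul_nonneg hM (norm_nonneg (U 0 p))
        have n2 := mul_nonneg hM (norm_nonneg (W 1 p))
        linarith
      · filter_upwards [dl ew, dζC, bound, hQ.eventually_analyticAt,
          hζC.eventually_analyticAt] with p h1 h2 h3 h4 h5
        have e : dirD (1, 0) (W 1) p = geomKernel p * W 0 p -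
            dirD ez l (leafSlice p) * U 0 p := by
          simp only [U, W, Matrix.cons_val_zero, Matrix.cons_val_one]
          rw [dirD_add h4.differentiableAt h5.differentiableAt, h1, h2]
          ring
        rw [Fin.sum_univ_two]
        change ‖dirD (1, 0) (W 1) p‖ ≤ _
        rw [e]
        have b1 := h3 _ (W 0 p) (Or.inr (Or.inr (Or.inl rfl)))
        have b2 := h3 _ (U 0 p) (Or.inr (Or.inl rfl))
        have hM : 0 ≤ M := by positivity
        have b3 := norm_sub_le (geomKernel p * W 0 p) (dirD ez l (leafSlice p) * U 0 p)
        have n1 := mul_nonneg hM (norm_nonneg (U 1 p))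
        have n2 := mul_nonneg hM (norm_nonneg (W 1 p))
        linarith)
    (fun i => by
      have h0 := eventually_leafSlice_left (P := fun v => dirD ez k v = 0 ∧ dirD ew k v = -1)
        (hk0.mono fun _ h => h.2)
      fin_cases i
      · exact h0.mono fun x hx => by simp [U, hx.2, geomKernel]
      · exact h0.mono fun x hx => by simp [U, hx.1])
    (fun i => by
      have h0 := eventually_leafSlice_right (P := fun v => dirD ew l v = 0 ∧ dirD ez l v = -1)
        (hl0.mono fun _ h => h.2)
      fin_cases i
      · exact h0.mono fun x hx => by simp [W, hx.2, geomKernel]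
      · exact h0.mono fun x hx => by simp [W, hx.1])
  filter_upwards [hu, key] with p h1 h2
  exact ⟨h1.1, h1.2, eq_neg_of_add_eq_zero_left (h2 1).1, eq_neg_of_add_eq_zero_left (h2 0).2⟩

theorem eventually_dirD_slice {V V' : Type*} [NormedAddCommGroup V] [NormedSpace ℂ V]
    [NormedAddCommGroup V'] [NormedSpace ℂ V'] {f : V → ℂ} (hf : AnalyticAt ℂ f 0)
    (j : V' →L[ℂ] V) (h : ∀ᶠ Z in 𝓝 0, f (j Z) = 0) (u : V') :
    ∀ᶠ Z in 𝓝 0, dirD (j u) f (j Z) = 0 := by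
  filter_upwards [dirD_comp_clm_eventually hf j u,
    EventuallyEq.dirD (show (fun Z => f (j Z)) =ᶠ[𝓝 0] fun _ => 0 from h) u] with Z a b
  rw [← a, b, dirD_const]

/-- In prenormal coordinates the defining function agrees with the model up to order three in
`(z, z̄)`. -/
theorem Prenormal.leaf {Φ : Pol → ℂ} (h : Prenormal Φ) : ∀ᶠ p in 𝓝 0,
    Φ (leafSlice p) = 0 ∧ dirD ez Φ (leafSlice p) = 0 ∧ dirD ew Φ (leafSlice p) = 0 ∧
      dirD ez (dirD ew Φ) (leafSlice p) = geomKernel p ∧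
      dirD ez (dirD ez Φ) (leafSlice p) = p.2 * geomKernel p ∧
      dirD ew (dirD ew Φ) (leafSlice p) = p.1 * geomKernel p := by
  have hΦ := h.analytic
  have an : ∀ x y, AnalyticAt ℂ (dirD x (dirD y Φ)) 0 := fun x y => (hΦ.dirD y).dirD x
  have comm := fun x y => dirD_comm_eventually hΦ x y
  have one : ∀ᶠ Z in 𝓝 0, dirD ew Φ (holSlice Z) = Z.1 := h.one
  have two : ∀ᶠ Z in 𝓝 0, dirD ew (dirD ew Φ) (holSlice Z) = Z.2 := h.two
  have hA : dirD ez (dirD ew Φ) 0 = 1 := by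
    have h1 := (dirD_comp_clm_eventually (hΦ.dirD ew) holSlice (1, 0)).self_of_nhds
    have h2 := (EventuallyEq.dirD (show (fun Z => dirD ew Φ (holSlice Z)) =ᶠ[𝓝 0] fun Z => Z.1
      from one) (1, 0)).self_of_nhds
    rw [h1, map_zero, holSlice_fst] at h2
    rw [h2]
    exact dirD_clm (ContinuousLinearMap.fst ℂ ℂ ℂ) _ _
  have hA0 : dirD ez (dirD ew Φ) 0 ≠ 0 := by rw [hA]; exact one_ne_zero
  have hAe : ∀ᶠ v in 𝓝 0, dirD ez (dirD ew Φ) v ≠ 0 := (an _ _).continuousAt.eventually_ne hA0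
  -- The fields k ∂_z + ∂_ζ and l ∂_w + ∂_η span the Levi kernel and its conjugate.
  obtain ⟨k, hk, h₁⟩ : ∃ k, AnalyticAt ℂ k 0 ∧
      ∀ᶠ v in 𝓝 0, dirD ez (dirD ew Φ) v * k v + dirD eζ (dirD ew Φ) v = 0 :=
    ⟨fun v => -dirD eζ (dirD ew Φ) v / dirD ez (dirD ew Φ) v, (an _ _).neg.div (an _ _) hA0, by
      filter_upwards [hAe] with v hv
      field_simp
      ring⟩
  obtain ⟨l, hl, h₂⟩ : ∃ l, AnalyticAt ℂ l 0 ∧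
      ∀ᶠ v in 𝓝 0, dirD ez (dirD ew Φ) v * l v + dirD ez (dirD eη Φ) v = 0 :=
    ⟨fun v => -dirD ez (dirD eη Φ) v / dirD ez (dirD ew Φ) v, (an _ _).neg.div (an _ _) hA0, by
      filter_upwards [hAe] with v hv
      field_simp
      ring⟩
  have h₁' : ∀ᶠ v in 𝓝 0, dirD ew (dirD ez Φ) v * k v + dirD ew (dirD eζ Φ) v = 0 := by
    filter_upwards [h₁, comm ez ew, comm eζ ew] with v a b c
    rwa [← b, ← c]
  have h₂' : ∀ᶠ v in 𝓝 0, dirD ew (dirD ez Φ) v * l v + dirD eη (dirD ez Φ) v = 0 := by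
    filter_upwards [h₂, comm ez ew, comm ez eη] with v a b c
    rwa [← b, ← c]
  have hkl := levi_kernel_involutive hΦ hk hl ez eζ ew eη hA0 h₁ h₂ h.levi
  -- The same statement with the roles of Z and W exchanged.
  have hlk := levi_kernel_involutive hΦ hl hk ew eη ez eζ
    (by rwa [(comm ew ez).self_of_nhds]) h₂' h₁' (by
      filter_upwards [h.levi, comm ez ew, comm eζ ew, comm ez eη, comm eζ eη] with v a b c d e
      rw [← b, ← c, ← d, ← e, a]
      ring)
  have hk0 := levi_kernel_initial hΦ hk holSlice ew h₁ one two
  have hl0 := levi_kernel_initial hΦ hl antiSlice ez h₂' h.one_conj h.two_conj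
  have hleaf := levi_kernel_leaf hk hl hkl hlk (hk0.mono fun _ a => a.2) (hl0.mono fun _ a => a.2)
  have hC := analyticAt_geomKernel
  have fin := fun {f : Pol → ℂ} (hf : AnalyticAt ℂ f 0) u => dirD_comp_clm_eventually hf leafSlice u
  have hηC : AnalyticAt ℂ (fun p : ℂ × ℂ => p.2 * geomKernel p) 0 := analyticAt_snd.mul hC
  have hζC : AnalyticAt ℂ (fun p : ℂ × ℂ => p.1 * geomKernel p) 0 := analyticAt_fst.mul hC
  have dfst : ∀ u Z : ℂ × ℂ, dirD u (fun Z : ℂ × ℂ => Z.1) Z = u.1 := fun u Z =>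
    dirD_clm (ContinuousLinearMap.fst ℂ ℂ ℂ) Z u
  have dsnd : ∀ u Z : ℂ × ℂ, dirD u (fun Z : ℂ × ℂ => Z.2) Z = u.2 := fun u Z =>
    dirD_clm (ContinuousLinearMap.snd ℂ ℂ ℂ) Z u
  have hCeq : ∀ᶠ p in 𝓝 (0 : ℂ × ℂ), (1 - p.1 * p.2) * geomKernel p = 1 := by
    filter_upwards [eventually_one_sub_ne_zero] with p hp using mul_inv_cancel₀ hp
  -- On the leaf k = 0 and k_z = -ηC, so the z-derivative of the kernel relation reads ∂_ζ Φ_zw = ηC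
  -- Φ_zw. The function C solves the same equation, and both equal 1 at ζ = 0.
  have hzw : ∀ᶠ p in 𝓝 0, dirD ez (dirD ew Φ) (leafSlice p) - geomKernel p = 0 := by
    refine eventually_eq_zero_of_dirD_fst (((an _ _).comp_clm leafSlice).sub hC) hηC ?_ ?_
    · filter_upwards [fin (an ez ew) (1, 0), hleaf, dirD_geomKernel (1, 0),
        ((an ez ew).comp_clm leafSlice).eventually_analyticAt, hC.eventually_analyticAt,
        eventually_comp_clm (eventually_dirD_mul_add (an _ _) hk (an _ _) h₁ ez) leafSlice,
        eventually_comp_clm (dirD_comm_eventually (hΦ.dirD ew) eζ ez) leafSlice]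
        with p a b c d e f g
      rw [dirD_sub d.differentiableAt e.differentiableAt, a, leafSlice_fst, g, c]
      rw [b.1, b.2.2.1] at f
      linear_combination f
    · exact (eventually_leafSlice_right (P := fun v => dirD ew (dirD ez Φ) v = 1 ∧
        dirD ez (dirD ew Φ) v = dirD ew (dirD ez Φ) v) (by
          filter_upwards [hl0, eventually_comp_clm (comm ez ew) antiSlice] with W a b
          exact ⟨a.1, b⟩)).mono fun x hx => by simp [hx.2, hx.1, geomKernel]
  have hz := eventually_dirD_slice hΦ holSlice h.zero (1, 0)
  have hw := eventually_dirD_slice hΦ antiSlice h.zero_conj (1, 0)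
  have hη := eventually_dirD_slice hΦ antiSlice h.zero_conj (0, 1)
  -- The z-derivative of the conjugate relation gives ∂_η Φ_zz = -Φ_zw l_z = C² = ∂_η(ηC), and both
  -- functions vanish at η = 0.
  have hzz : ∀ᶠ p in 𝓝 0, dirD ez (dirD ez Φ) (leafSlice p) - p.2 * geomKernel p = 0 := by
    refine eventually_eq_zero_of_dirD_snd (α := fun _ => 0) (((an _ _).comp_clm leafSlice).sub hηC)
      analyticAt_const ?_ ?_
    · filter_upwards [fin (an ez ez) (0, 1), hleaf, dirD_geomKernel (0, 1),
        ((an ez ez).comp_clm leafSlice).eventually_analyticAt, hηC.eventually_analyticAt,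
        eventually_comp_clm (eventually_dirD_mul_add (an _ _) hl (an _ _) h₂ ez) leafSlice,
        eventually_comp_clm (dirD_comm_eventually (hΦ.dirD ez) eη ez) leafSlice,
        eventually_comp_clm ((comm eη ez).dirD ez) leafSlice, hC.eventually_analyticAt, hCeq, hzw]
        with p a b c d e f g g' i o m
      rw [dirD_sub d.differentiableAt e.differentiableAt, a, leafSlice_snd, g, g',
        dirD_mul differentiableAt_snd i.differentiableAt, c, dsnd]
      rw [b.2.1, b.2.2.2, sub_eq_zero.1 m] at f
      linear_combination f + geomKernel p * o
    · exact (eventually_leafSlice_left (P := fun v => dirD ez (dirD ez Φ) v = 0)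
        (eventually_dirD_slice (hΦ.dirD ez) holSlice hz (1, 0))).mono fun x hx => by simp [hx]
  -- Hermitian symmetry transports `hzz`.
  have hww : ∀ᶠ p in 𝓝 0, dirD ew (dirD ew Φ) (leafSlice p) - p.1 * geomKernel p = 0 := by
    have hsym : ∀ᶠ p in 𝓝 0, dirD ew (dirD ew Φ) (leafSlice p) =
        star (dirD ez (dirD ez Φ) (leafSlice (star (p.2, p.1)))) := by
      filter_upwards [eventually_comp_clm (h.hermitian.dirD_dirD hΦ ew ew) leafSlice] with p a
      rw [a]
      simp [polSwap, leafSlice_apply, Prod.star_def]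
    have ht : Tendsto (fun p : ℂ × ℂ => star (p.2, p.1)) (𝓝 0) (𝓝 0) :=
      (by fun_prop : Continuous fun p : ℂ × ℂ => star (p.2, p.1)).tendsto' 0 0 (by simp)
    filter_upwards [hsym, ht.eventually hzz] with p a b
    rw [a, sub_eq_zero.1 b]
    simp [geomKernel, mul_comm p.2]
  have hz1 : ∀ᶠ p in 𝓝 0, dirD ez Φ (leafSlice p) = 0 := by
    refine eventually_eq_zero_of_dirD_snd (α := fun _ => 0) ((hΦ.dirD ez).comp_clm leafSlice)
      analyticAt_const ?_ (eventually_leafSlice_left (P := fun v => dirD ez Φ v = 0) hz)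
    filter_upwards [fin (hΦ.dirD ez) (0, 1), hleaf, eventually_comp_clm h₂ leafSlice,
      eventually_comp_clm (comm eη ez) leafSlice] with p a b c d
    rw [a, leafSlice_snd, d]
    rw [b.2.1] at c
    linear_combination c
  have hw1 : ∀ᶠ p in 𝓝 0, dirD ew Φ (leafSlice p) = 0 := by
    refine eventually_eq_zero_of_dirD_fst (α := fun _ => 0) ((hΦ.dirD ew).comp_clm leafSlice)
      analyticAt_const ?_ (eventually_leafSlice_right (P := fun v => dirD ew Φ v = 0) hw)
    filter_upwards [fin (hΦ.dirD ew) (1, 0), hleaf, eventually_comp_clm h₁ leafSlice] with p a b c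
    rw [a, leafSlice_fst]
    rw [b.1] at c
    linear_combination c
  -- Since k = 0 gives Φ_ζw = 0 on the leaf, the vanishing determinant leaves Φ_ζη = 0 there.
  have hη1 : ∀ᶠ p in 𝓝 0, dirD eη Φ (leafSlice p) = 0 := by
    refine eventually_eq_zero_of_dirD_fst (α := fun _ => 0) ((hΦ.dirD eη).comp_clm leafSlice)
      analyticAt_const ?_ (eventually_leafSlice_right (P := fun v => dirD eη Φ v = 0) hη)
    filter_upwards [fin (hΦ.dirD eη) (1, 0), hleaf, eventually_comp_clm h₁ leafSlice,
      eventually_comp_clm h.levi leafSlice, eventually_comp_clm hAe leafSlice] with p a b c d e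
    rw [a, leafSlice_fst]
    rw [b.1] at c
    have c' : dirD eζ (dirD ew Φ) (leafSlice p) = 0 := by linear_combination c
    rw [c', mul_zero] at d
    rw [(mul_eq_zero.1 d).resolve_left e, zero_mul]
  have h0 : ∀ᶠ p in 𝓝 0, Φ (leafSlice p) = 0 := by
    refine eventually_eq_zero_of_dirD_snd (α := fun _ => 0) (hΦ.comp_clm leafSlice)
      analyticAt_const ?_ (eventually_leafSlice_left (P := fun v => Φ v = 0) h.zero)
    filter_upwards [fin hΦ (0, 1), hη1] with p a b
    rw [a, leafSlice_snd, b, zero_mul]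
  filter_upwards [hzw, hzz, hww, hz1, hw1, h0] with p a b c d e f
  exact ⟨f, d, e, sub_eq_zero.1 a, sub_eq_zero.1 b, sub_eq_zero.1 c⟩

end OrderThree

/-! ### Coefficients on slices; derivatives of the polarized model -/

section NormalFormCoefficients

theorem HasSum.congr_arg {ι : Type*} {f g : ι → ℂ} {x : ℂ} (h : HasSum f x)
    (e : ∀ n, g n = f n) : HasSum g x := by
  rwa [show g = f from funext e]

theorem HasPolSum.eventually_holSlice_eq_zero {Φ : Pol → ℂ} {G : ℕ → ℕ → ℕ → ℕ → ℂ}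
    (h : HasPolSum Φ G) (h0 : ∀ a b, G a b 0 0 = 0) : ∀ᶠ Z in 𝓝 0, Φ (holSlice Z) = 0 := by
  filter_upwards [eventually_comp_clm h holSlice] with Z hZ
  refine hZ.unique ?_
  convert hasSum_zero using 2 with n
  obtain ⟨a, b, c, d⟩ := n
  by_cases hc : c = 0
  · by_cases hd : d = 0
    · subst hc hd; simp [h0]
    · simp [holSlice_apply, hd]
  · simp [holSlice_apply, hc]

theorem HasPolSum.eq_zero_of_eventually {Φ : Pol → ℂ} {G : ℕ → ℕ → ℕ → ℕ → ℂ}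
    (h : HasPolSum Φ G) (h0 : ∀ᶠ v in 𝓝 0, Φ v = 0) : ∀ a b c d, G a b c d = 0 := by
  have h1 : HasPolSum Φ fun _ _ _ _ => 0 := by
    filter_upwards [h0] with v hv
    rw [hv]
    simp
  intro a b c d
  rw [h.unique h1]

/-- Composing the restriction with the projection to Z gives a polarized series again, to which
uniqueness of coefficients applies. -/
theorem HasPolSum.coeff_eq_zero_of_holSlice {Φ : Pol → ℂ} {G : ℕ → ℕ → ℕ → ℕ → ℂ}
    (h : HasPolSum Φ G) (h0 : ∀ᶠ Z in 𝓝 0, Φ (holSlice Z) = 0) (a b : ℕ) : G a b 0 0 = 0 := by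
  have h1 : HasPolSum (fun v => Φ (holSlice v.1))
      fun a b c d => if c = 0 ∧ d = 0 then G a b 0 0 else 0 := by
    filter_upwards [eventually_comp_clm h
      (holSlice ∘L ContinuousLinearMap.fst ℂ (ℂ × ℂ) (ℂ × ℂ))] with v hv
    refine hv.congr_arg fun n => ?_
    obtain ⟨a, b, c, d⟩ := n
    by_cases hc : c = 0
    · by_cases hd : d = 0
      · subst hc hd; simp [holSlice_apply]
      · simp [holSlice_apply, hd]
    · simp [holSlice_apply, hc]
  have h2 := h1.eq_zero_of_eventually
    (eventually_comp_clm h0 (ContinuousLinearMap.fst ℂ (ℂ × ℂ) (ℂ × ℂ))) a b 0 0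
  simpa using h2

theorem HasPolSum.coeff_eq_zero_of_leafSlice {Φ : Pol → ℂ} {G : ℕ → ℕ → ℕ → ℕ → ℂ}
    (h : HasPolSum Φ G) (h0 : ∀ᶠ p in 𝓝 0, Φ (leafSlice p) = 0) (b d : ℕ) : G 0 b 0 d = 0 := by
  let π : Pol →L[ℂ] ℂ × ℂ :=
    (ContinuousLinearMap.snd ℂ ℂ ℂ ∘L ContinuousLinearMap.fst ℂ (ℂ × ℂ) (ℂ × ℂ)).prod
      (ContinuousLinearMap.snd ℂ ℂ ℂ ∘L ContinuousLinearMap.snd ℂ (ℂ × ℂ) (ℂ × ℂ))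
  have h1 : HasPolSum (fun v => Φ (leafSlice (π v)))
      fun a b c d => if a = 0 ∧ c = 0 then G 0 b 0 d else 0 := by
    filter_upwards [eventually_comp_clm h (leafSlice ∘L π)] with v hv
    refine hv.congr_arg fun n => ?_
    obtain ⟨a, b, c, d⟩ := n
    by_cases ha : a = 0
    · by_cases hc : c = 0
      · subst ha hc; simp [leafSlice_apply, π]
      · simp [leafSlice_apply, hc]
    · simp [leafSlice_apply, ha]
  have h2 := h1.eq_zero_of_eventually (eventually_comp_clm h0 π) 0 b 0 d
  simpa using h2

/-- The polarized Gaussier–Merker function. -/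
noncomputable def modelPol (v : Pol) : ℂ :=
  (v.1.1 * v.2.1 + 1 / 2 * v.1.1 ^ 2 * v.2.2 + 1 / 2 * v.2.1 ^ 2 * v.1.2) *
    geomKernel (v.1.2, v.2.2)

theorem modelPol_polDiag (p : ℂ × ℂ) : modelPol (polDiag p) = gmModel p.1 p.2 := by
  simp [modelPol, gmModel, polDiag, geomKernel, div_eq_mul_inv]

noncomputable def leafProj : Pol →L[ℂ] ℂ × ℂ :=
  (ContinuousLinearMap.snd ℂ ℂ ℂ ∘L ContinuousLinearMap.fst ℂ (ℂ × ℂ) (ℂ × ℂ)).prod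
    (ContinuousLinearMap.snd ℂ ℂ ℂ ∘L ContinuousLinearMap.snd ℂ (ℂ × ℂ) (ℂ × ℂ))

theorem analyticAt_geomKernel_leafProj :
    AnalyticAt ℂ (fun v : Pol => geomKernel (v.1.2, v.2.2)) 0 :=
  analyticAt_geomKernel.comp_clm leafProj

theorem analyticAt_coord_z (a : Pol) : AnalyticAt ℂ (fun v : Pol => v.1.1) a :=
  (ContinuousLinearMap.fst ℂ ℂ ℂ ∘L ContinuousLinearMap.fst ℂ (ℂ × ℂ) (ℂ × ℂ)).analyticAt a

theorem analyticAt_coord_ζ (a : Pol) : AnalyticAt ℂ (fun v : Pol => v.1.2) a :=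
  (ContinuousLinearMap.snd ℂ ℂ ℂ ∘L ContinuousLinearMap.fst ℂ (ℂ × ℂ) (ℂ × ℂ)).analyticAt a

theorem analyticAt_coord_w (a : Pol) : AnalyticAt ℂ (fun v : Pol => v.2.1) a :=
  (ContinuousLinearMap.fst ℂ ℂ ℂ ∘L ContinuousLinearMap.snd ℂ (ℂ × ℂ) (ℂ × ℂ)).analyticAt a

theorem analyticAt_coord_η (a : Pol) : AnalyticAt ℂ (fun v : Pol => v.2.2) a :=
  (ContinuousLinearMap.snd ℂ ℂ ℂ ∘L ContinuousLinearMap.snd ℂ (ℂ × ℂ) (ℂ × ℂ)).analyticAt a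

theorem analyticAt_modelPol : AnalyticAt ℂ modelPol 0 := by
  refine AnalyticAt.mul ?_ analyticAt_geomKernel_leafProj
  have hz := analyticAt_coord_z 0
  have hζ := analyticAt_coord_ζ 0
  have hw := analyticAt_coord_w 0
  have hη := analyticAt_coord_η 0
  exact ((hz.mul hw).add ((analyticAt_const.mul (hz.pow 2)).mul hη)).add
    ((analyticAt_const.mul (hw.pow 2)).mul hζ)

/-- Directions without ζ and η components do not see the denominator, so in z and w the model is
differentiated like its quadratic numerator. -/
theorem dirD_mul_geomKernel {q : Pol → ℂ} (hq : Differentiable ℂ q) (u : Pol) (h1 : u.1.2 = 0)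
    (h2 : u.2.2 = 0) : dirD u (fun v => q v * geomKernel (v.1.2, v.2.2)) =ᶠ[𝓝 0]
      fun v => dirD u q v * geomKernel (v.1.2, v.2.2) := by
  filter_upwards [analyticAt_geomKernel_leafProj.eventually_analyticAt,
    dirD_comp_clm_eventually analyticAt_geomKernel leafProj u,
    eventually_comp_clm (dirD_geomKernel (leafProj u)) leafProj] with v a b c
  rw [dirD_mul (hq v) a.differentiableAt]
  have : dirD u (fun v : Pol => geomKernel (v.1.2, v.2.2)) v = 0 := by
    have e : leafProj u = 0 := by
      ext <;> simp [leafProj, h1, h2]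
    rw [e] at b c
    exact b.trans (c.trans (by simp))
  rw [this]
  ring

theorem dirD_eq_of_quadratic {V : Type*} [NormedAddCommGroup V] [NormedSpace ℂ V] {q : V → ℂ}
    {u v : V} {B C : ℂ} (hq : DifferentiableAt ℂ q v)
    (h : ∀ s : ℂ, q (v + s • u) = q v + s * B + s ^ 2 * C) : dirD u q v = B := by
  rw [← deriv_comp_line hq, funext h]
  have : HasDerivAt (fun s : ℂ => q v + s * B + s ^ 2 * C) (1 * B + (2 : ℕ) * 0 ^ (2 - 1) * C) 0 :=
    ((hasDerivAt_id 0).mul_const B).const_add (q v) |>.add ((hasDerivAt_pow 2 0).mul_const C)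
  rw [this.deriv]
  simp

theorem dirD_modelPol : 
    dirD ez modelPol =ᶠ[𝓝 0] (fun v => (v.2.1 + v.1.1 * v.2.2) * geomKernel (v.1.2, v.2.2)) ∧
    dirD ew modelPol =ᶠ[𝓝 0] (fun v => (v.1.1 + v.2.1 * v.1.2) * geomKernel (v.1.2, v.2.2)) ∧
    dirD ez (dirD ez modelPol) =ᶠ[𝓝 0] (fun v => v.2.2 * geomKernel (v.1.2, v.2.2)) ∧
    dirD ez (dirD ew modelPol) =ᶠ[𝓝 0] (fun v => 1 * geomKernel (v.1.2, v.2.2)) ∧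
    dirD ew (dirD ew modelPol) =ᶠ[𝓝 0] (fun v => v.1.2 * geomKernel (v.1.2, v.2.2)) ∧
    dirD ez (dirD ez (dirD ez modelPol)) =ᶠ[𝓝 0] fun _ => 0 := by
  have a1 : dirD ez modelPol =ᶠ[𝓝 0]
      fun v => (v.2.1 + v.1.1 * v.2.2) * geomKernel (v.1.2, v.2.2) := by
    refine (dirD_mul_geomKernel (by fun_prop) ez rfl rfl).trans (.of_forall fun v => ?_)
    simp only
    rw [dirD_eq_of_quadratic (B := v.2.1 + v.1.1 * v.2.2) (C := 1 / 2 * v.2.2) (by fun_prop)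
      (fun s => by simp; ring)]
  have a2 : dirD ew modelPol =ᶠ[𝓝 0]
      fun v => (v.1.1 + v.2.1 * v.1.2) * geomKernel (v.1.2, v.2.2) := by
    refine (dirD_mul_geomKernel (by fun_prop) ew rfl rfl).trans (.of_forall fun v => ?_)
    simp only
    rw [dirD_eq_of_quadratic (B := v.1.1 + v.2.1 * v.1.2) (C := 1 / 2 * v.1.2) (by fun_prop)
      (fun s => by simp; ring)]
  have a3 : dirD ez (dirD ez modelPol) =ᶠ[𝓝 0] fun v => v.2.2 * geomKernel (v.1.2, v.2.2) := by
    refine (a1.dirD ez).trans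
      ((dirD_mul_geomKernel (by fun_prop) ez rfl rfl).trans (.of_forall fun v => ?_))
    simp only
    rw [dirD_eq_of_quadratic (B := v.2.2) (C := 0) (by fun_prop) (fun s => by simp; ring)]
  have a4 : dirD ez (dirD ew modelPol) =ᶠ[𝓝 0] fun v => 1 * geomKernel (v.1.2, v.2.2) := by
    refine (a2.dirD ez).trans
      ((dirD_mul_geomKernel (by fun_prop) ez rfl rfl).trans (.of_forall fun v => ?_))
    simp only
    rw [dirD_eq_of_quadratic (B := 1) (C := 0) (by fun_prop) (fun s => by simp; ring)]
  have a5 : dirD ew (dirD ew modelPol) =ᶠ[𝓝 0] fun v => v.1.2 * geomKernel (v.1.2, v.2.2) := by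
    refine (a2.dirD ew).trans
      ((dirD_mul_geomKernel (by fun_prop) ew rfl rfl).trans (.of_forall fun v => ?_))
    simp only
    rw [dirD_eq_of_quadratic (B := v.1.2) (C := 0) (by fun_prop) (fun s => by simp; ring)]
  refine ⟨a1, a2, a3, a4, a5, (a3.dirD ez).trans
      ((dirD_mul_geomKernel (by fun_prop) ez rfl rfl).trans (.of_forall fun v => ?_))⟩
  simp only
  rw [dirD_eq_of_quadratic (B := 0) (C := 0) (by fun_prop) (fun s => by simp), zero_mul]

theorem dirD_comm_three {Φ : Pol → ℂ} (h : AnalyticAt ℂ Φ 0) (u t : Pol) :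
    dirD u (dirD u (dirD u (dirD t Φ))) =ᶠ[𝓝 0] dirD t (dirD u (dirD u (dirD u Φ))) :=
  (((dirD_comm_eventually h u t).dirD u).dirD u).trans
    (((dirD_comm_eventually (h.dirD u) u t).dirD u).trans
      (dirD_comm_eventually ((h.dirD u).dirD u) u t))

/-- The model is quadratic in z, so it contributes nothing to derivatives of order three in z; the
sporadic quantities of Φ are those of the remainder. -/
theorem dirD_three_modelPol (t : Pol) :
    dirD ez (dirD ez (dirD ez (dirD t modelPol))) =ᶠ[𝓝 0] fun _ => 0 := by
  refine (dirD_comm_three analyticAt_modelPol ez t).trans ((dirD_modelPol.2.2.2.2.2.dirD t).trans ?_)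
  exact .of_forall fun v => dirD_const _ _ _

theorem dirD_three_dirD_modelPol (t t' : Pol) :
    dirD ez (dirD ez (dirD ez (dirD t (dirD t' modelPol)))) =ᶠ[𝓝 0] fun _ => 0 := by
  refine (dirD_comm_three (analyticAt_modelPol.dirD t') ez t).trans
    (((dirD_three_modelPol t').dirD t).trans ?_)
  exact .of_forall fun v => dirD_const _ _ _

theorem dirD_sub_eventually {V : Type*} [NormedAddCommGroup V] [NormedSpace ℂ V] {Φ Ψ : V → ℂ}
    {a : V} (hΦ : AnalyticAt ℂ Φ a) (hΨ : AnalyticAt ℂ Ψ a) (u : V) :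
    dirD u (fun x => Φ x - Ψ x) =ᶠ[𝓝 a] fun v => dirD u Φ v - dirD u Ψ v := by
  filter_upwards [hΦ.eventually_analyticAt, hΨ.eventually_analyticAt] with v h1 h2
  exact dirD_sub h1.differentiableAt h2.differentiableAt u

theorem dirD_dirD_sub_eventually {V : Type*} [NormedAddCommGroup V] [NormedSpace ℂ V]
    {Φ Ψ : V → ℂ} {a : V} (hΦ : AnalyticAt ℂ Φ a) (hΨ : AnalyticAt ℂ Ψ a) (u u' : V) :
    dirD u (dirD u' (fun x => Φ x - Ψ x)) =ᶠ[𝓝 a]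
      fun v => dirD u (dirD u' Φ) v - dirD u (dirD u' Ψ) v :=
  ((dirD_sub_eventually hΦ hΨ u').dirD u).trans
    (dirD_sub_eventually (hΦ.dirD u') (hΨ.dirD u') u)

end NormalFormCoefficients

/-! ### The Levi conditions on the polarization -/

section LeviPolarized

theorem coordDir_zero_hol : ((coordDir 0, 0) : Pol) = ez := rfl
theorem coordDir_one_hol : ((coordDir 1, 0) : Pol) = eζ := rfl
theorem coordDir_zero_anti : ((0, coordDir 0) : Pol) = ew := rfl
theorem coordDir_one_anti : ((0, coordDir 1) : Pol) = eη := rfl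

/-- `Φ` is the polarization of the germ of `F` at the origin. -/
structure IsPolarization (Φ : Pol → ℂ) (F : ℂ × ℂ → ℝ) : Prop where
  analytic : AnalyticAt ℂ Φ 0
  eq : ∀ᶠ p in 𝓝 0, Φ (polDiag p) = F p

variable {Φ : Pol → ℂ} {F : ℂ × ℂ → ℝ}

theorem InClassC21.exists_polarization (h : InClassC21 F) : ∃ Φ, IsPolarization Φ F := by
  have : AnalyticAt ℝ (fun p => (F p : ℂ)) 0 := (ofRealCLM.analyticAt _).comp h.analytic
  obtain ⟨Φ, h1, h2⟩ := this.exists_polarization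
  exact ⟨Φ, h1, h2⟩

namespace IsPolarization

theorem hermitian (h : IsPolarization Φ F) : IsHermitian Φ := isHermitian_of_real h.analytic h.eq

theorem dAnti (h : IsPolarization Φ F) (k : Fin 2) :
    ∀ᶠ p in 𝓝 0, dirD (0, coordDir k) Φ (polDiag p) = dAnti k (fun q => (F q : ℂ)) p :=
  dAnti_polDiag h.analytic h.eq k

theorem dAnti_dAnti (h : IsPolarization Φ F) (k l : Fin 2) :
    ∀ᶠ p in 𝓝 0, dirD (0, coordDir k) (dirD (0, coordDir l) Φ) (polDiag p) =
      _root_.dAnti k (_root_.dAnti l fun q => (F q : ℂ)) p :=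
  dAnti_polDiag (h.analytic.dirD _) (h.dAnti l) k

theorem levi_apply (h : IsPolarization Φ F) (j k : Fin 2) :
    ∀ᶠ p in 𝓝 0, dirD (coordDir j, 0) (dirD (0, coordDir k) Φ) (polDiag p) = leviMatrix F p j k :=
  dHol_polDiag (h.analytic.dirD _) (h.dAnti k) j

theorem leviMatrix_eq (h : IsPolarization Φ F) : ∀ᶠ p in 𝓝 0, leviMatrix F p =
    !![dirD ez (dirD ew Φ) (polDiag p), dirD ez (dirD eη Φ) (polDiag p);
      dirD eζ (dirD ew Φ) (polDiag p), dirD eζ (dirD eη Φ) (polDiag p)] := by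
  filter_upwards [h.levi_apply 0 0, h.levi_apply 0 1, h.levi_apply 1 0, h.levi_apply 1 1]
    with p a b c d
  rw [coordDir_zero_hol, coordDir_zero_anti] at a
  rw [coordDir_zero_hol, coordDir_one_anti] at b
  rw [coordDir_one_hol, coordDir_zero_anti] at c
  rw [coordDir_one_hol, coordDir_one_anti] at d
  rw [a, b, c, d]
  exact Matrix.eta_fin_two _

/-- Rank one kills the determinant on the totally real subspace, and a holomorphic germ vanishing
there vanishes identically. -/
theorem leviDegenerate (h : IsPolarization Φ F) (hF : InClassC21 F) : LeviDegenerate Φ := by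
  have an : ∀ x y, AnalyticAt ℂ (dirD x (dirD y Φ)) 0 := fun x y => (h.analytic.dirD y).dirD x
  refine eventuallyEq_of_polDiag ((an _ _).mul (an _ _)) ((an _ _).mul (an _ _)) ?_
  filter_upwards [h.leviMatrix_eq, hF.levi_rank_one] with p h1 h2
  have hdet : (leviMatrix F p).det = 0 := by
    by_contra hne
    have := Matrix.rank_of_isUnit _ ((Matrix.isUnit_iff_isUnit_det _).2 (isUnit_iff_ne_zero.2 hne))
    rw [h2] at this
    simp at this
  rw [h1, Matrix.det_fin_two_of] at hdet
  exact sub_eq_zero.1 hdet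

theorem rank_one_of_leviDegenerate (h : IsPolarization Φ F) (hd : LeviDegenerate Φ)
    (h0 : dirD ez (dirD ew Φ) 0 ≠ 0) : ∀ᶠ p in 𝓝 0, (leviMatrix F p).rank = 1 := by
  have an : ∀ x y, AnalyticAt ℂ (dirD x (dirD y Φ)) 0 := fun x y => (h.analytic.dirD y).dirD x
  filter_upwards [h.leviMatrix_eq, tendsto_polDiag.eventually hd,
    tendsto_polDiag.eventually ((an _ _).continuousAt.eventually_ne h0)] with p h1 h2 h3
  rw [h1]
  set A := dirD ez (dirD ew Φ) (polDiag p)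
  set B := dirD ez (dirD eη Φ) (polDiag p)
  set C := dirD eζ (dirD ew Φ) (polDiag p)
  set D := dirD eζ (dirD eη Φ) (polDiag p)
  refine le_antisymm ?_ ?_
  -- With A ≠ 0, a vanishing determinant makes the matrix an outer product.
  · have : !![A, B; C, D] = Matrix.vecMulVec ![A, C] ![1, B / A] := by
      ext i j
      fin_cases i <;> fin_cases j
      · simp [Matrix.vecMulVec]
      · simp [Matrix.vecMulVec]; field_simp
      · simp [Matrix.vecMulVec]
      · simp [Matrix.vecMulVec]; field_simp; linear_combination h2
    rw [this]
    exact Matrix.rank_vecMulVec_le _ _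
  · rw [Nat.one_le_iff_ne_zero]
    intro hr
    rw [Matrix.rank, Submodule.finrank_eq_zero, LinearMap.range_eq_bot] at hr
    have := congrFun (congrArg (fun T => T (Pi.single 0 1)) hr) 0
    exact h3 (by simpa using this)

end IsPolarization

theorem Prenormal.dirD_zw_zero (h : Prenormal Φ) : dirD ez (dirD ew Φ) 0 = 1 := by
  have := h.leaf.self_of_nhds.2.2.2.1
  simpa [geomKernel] using this

theorem Prenormal.dirD_hol_dirD_w (h : Prenormal Φ) (u : ℂ × ℂ) :
    ∀ᶠ Z in 𝓝 0, dirD (u, 0) (dirD ew Φ) (holSlice Z) = u.1 := by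
  filter_upwards [dirD_comp_clm_eventually (h.analytic.dirD ew) holSlice u,
    EventuallyEq.dirD (show (fun Z => dirD ew Φ (holSlice Z)) =ᶠ[𝓝 0] fun Z => Z.1
      from h.one) u] with Z a b
  rw [b] at a
  exact a.symm.trans (dirD_clm (ContinuousLinearMap.fst ℂ ℂ ℂ) _ _)

theorem Prenormal.dirD_hol_dirD_ww (h : Prenormal Φ) (u : ℂ × ℂ) :
    ∀ᶠ Z in 𝓝 0, dirD (u, 0) (dirD ew (dirD ew Φ)) (holSlice Z) = u.2 := by
  filter_upwards [dirD_comp_clm_eventually ((h.analytic.dirD ew).dirD ew) holSlice u,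
    EventuallyEq.dirD (show (fun Z => dirD ew (dirD ew Φ) (holSlice Z)) =ᶠ[𝓝 0] fun Z => Z.2
      from h.two) u] with Z a b
  rw [b] at a
  exact a.symm.trans (dirD_clm (ContinuousLinearMap.snd ℂ ℂ ℂ) _ _)

/-- The relations Φ_w = z and Φ_ww = ζ on {W = 0} exhibit the gradients (1, 0) and (0, 1), which
span. -/
theorem InClassC21.of_prenormal (hΦ : Prenormal Φ) (h : IsPolarization Φ F)
    (hF : AnalyticAt ℝ F 0) : InClassC21 F where
  analytic := hF
  through_origin := by
    have h1 := h.eq.self_of_nhds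
    have h2 := hΦ.zero.self_of_nhds
    rw [polDiag_zero] at h1
    have : (F 0 : ℂ) = 0 := by rw [← h1]; exact h2
    exact_mod_cast this
  levi_rank_one := h.rank_one_of_leviDegenerate hΦ.levi (by simp [hΦ.dirD_zw_zero])
  two_nondegenerate := by
    have e1 : ∀ j, holGrad (dAnti 0 fun q => (F q : ℂ)) 0 j = (coordDir j).1 := fun j => by
      have h1 := (h.levi_apply j 0).self_of_nhds
      have h2 := (hΦ.dirD_hol_dirD_w (coordDir j)).self_of_nhds
      rw [polDiag_zero] at h1
      exact h1.symm.trans h2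
    have e2 : ∀ j, holGrad (dAnti 0 (dAnti 0 fun q => (F q : ℂ))) 0 j = (coordDir j).2 := fun j => by
      have h1 := (dHol_polDiag ((h.analytic.dirD _).dirD _) (h.dAnti_dAnti 0 0) j).self_of_nhds
      have h2 := (hΦ.dirD_hol_dirD_ww (coordDir j)).self_of_nhds
      rw [polDiag_zero] at h1
      exact h1.symm.trans h2
    rw [SpansAtOrderTwo, eq_top_iff]
    intro x _
    have hx : x = x 0 • holGrad (dAnti 0 fun q => (F q : ℂ)) 0 +
        x 1 • holGrad (dAnti 0 (dAnti 0 fun q => (F q : ℂ))) 0 := by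
      funext j
      fin_cases j <;> simp [e1, e2, coordDir]
    rw [hx]
    refine Submodule.add_mem _ (Submodule.smul_mem _ _ (Submodule.subset_span ?_))
      (Submodule.smul_mem _ _ (Submodule.subset_span ?_))
    · exact Or.inl ⟨0, rfl⟩
    · exact Or.inr ⟨(0, 0), rfl⟩

/-- The derivative `∂_z³ ∂_ζ̄` at the origin. -/
noncomputable def sporadicFour (Φ : Pol → ℂ) : ℂ := dirD ez (dirD ez (dirD ez (dirD eη Φ))) 0

/-- The derivative `∂_z³ ∂_z̄ ∂_ζ̄` at the origin. -/
noncomputable def sporadicFive (Φ : Pol → ℂ) : ℂ :=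
  dirD ez (dirD ez (dirD ez (dirD ew (dirD eη Φ)))) 0

theorem star_gmModel (z ζ : ℂ) : star (gmModel z ζ) = gmModel z ζ := by
  simp only [gmModel, star_def, map_div₀, map_add, map_mul, map_sub, map_one, map_pow, conj_conj,
    map_ofNat]
  ring

/-! ### The normal form conditions as conditions on the polarization -/

section Remainder

variable {G : ℕ → ℕ → ℕ → ℕ → ℂ}

theorem sporadicFour_eq (hΦ : AnalyticAt ℂ Φ 0) (h : HasPolSum (fun v => Φ v - modelPol v) G) :
    sporadicFour Φ = 6 * G 3 0 0 1 := by
  have hm := analyticAt_modelPol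
  have h1 := h.dirD_η.dirD_z.dirD_z.dirD_z.apply_zero
  have h2 := (((dirD_sub_eventually hΦ hm eη).dirD ez).trans
    (dirD_sub_eventually (hΦ.dirD eη) (hm.dirD eη) ez)).dirD ez
  have h3 := (h2.trans (dirD_sub_eventually ((hΦ.dirD eη).dirD ez) ((hm.dirD eη).dirD ez) ez)).dirD ez
  have h4 := (h3.trans (dirD_sub_eventually (((hΦ.dirD eη).dirD ez).dirD ez)
    (((hm.dirD eη).dirD ez).dirD ez) ez)).self_of_nhds
  beta_reduce at h4
  rw [h1, (dirD_three_modelPol eη).self_of_nhds] at h4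
  rw [sporadicFour, ← sub_zero (dirD ez (dirD ez (dirD ez (dirD eη Φ))) 0), ← h4]
  norm_num
  ring

theorem sporadicFive_eq (hΦ : AnalyticAt ℂ Φ 0) (h : HasPolSum (fun v => Φ v - modelPol v) G) :
    sporadicFive Φ = 6 * G 3 0 1 1 := by
  have hm := analyticAt_modelPol
  have h1 := h.dirD_η.dirD_w.dirD_z.dirD_z.dirD_z.apply_zero
  have h2 := (((dirD_dirD_sub_eventually hΦ hm ew eη).dirD ez).trans
    (dirD_sub_eventually ((hΦ.dirD eη).dirD ew) ((hm.dirD eη).dirD ew) ez)).dirD ez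
  have h3 := (h2.trans (dirD_sub_eventually (((hΦ.dirD eη).dirD ew).dirD ez)
    (((hm.dirD eη).dirD ew).dirD ez) ez)).dirD ez
  have h4 := (h3.trans (dirD_sub_eventually ((((hΦ.dirD eη).dirD ew).dirD ez).dirD ez)
    ((((hm.dirD eη).dirD ew).dirD ez).dirD ez) ez)).self_of_nhds
  beta_reduce at h4
  rw [h1, (dirD_three_dirD_modelPol ew eη).self_of_nhds] at h4
  rw [sporadicFive, ← sub_zero (dirD ez (dirD ez (dirD ez (dirD ew (dirD eη Φ)))) 0), ← h4]
  norm_num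
  ring

/-- The order-three condition is supplied by `Prenormal.leaf`; the conditions on conjugate
coefficients follow from reality of F and of the model. -/
theorem IsNormalForm.of_prenormal (hΦ : Prenormal Φ) (h : IsPolarization Φ F)
    (h4 : sporadicFour Φ = 0) (h5 : (sporadicFive Φ).im = 0) : ∃ G, IsNormalForm F G := by
  have hm := analyticAt_modelPol
  have ha := hΦ.analytic
  obtain ⟨G, hG⟩ : ∃ G, HasPolSum (fun v => Φ v - modelPol v) G :=
    AnalyticAt.exists_hasPolSum (ha.sub hm)
  have hexp : HasExpansion (fun p => (F p : ℂ) - gmModel p.1 p.2) G := by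
    refine hG.hasExpansion ?_
    filter_upwards [h.eq] with p hp
    rw [hp, modelPol_polDiag]
  have hconj := hexp.coeff_conj (.of_forall fun p => by simp [star_gmModel])
  have hs4 := sporadicFour_eq ha hG
  have hs5 := sporadicFive_eq ha hG
  rw [h4] at hs4
  have g4 : G 3 0 0 1 = 0 := by simpa using hs4.symm
  have g5 : (G 3 0 1 1).im = 0 := by
    rw [hs5] at h5
    simpa using h5
  obtain ⟨m1, m2, m3, m4, m5, -⟩ := dirD_modelPol
  have leaf := hΦ.leaf
  have l0 := hG.coeff_eq_zero_of_leafSlice (by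
    filter_upwards [leaf] with p hp
    rw [hp.1]
    simp [modelPol, leafSlice_apply])
  have l1 := hG.dirD_z.coeff_eq_zero_of_leafSlice (by
    filter_upwards [leaf, eventually_comp_clm (dirD_sub_eventually ha hm ez) leafSlice,
      eventually_comp_clm m1 leafSlice] with p hp a b
    rw [a, b, hp.2.1]
    simp [leafSlice_apply])
  have l2 := hG.dirD_w.coeff_eq_zero_of_leafSlice (by
    filter_upwards [leaf, eventually_comp_clm (dirD_sub_eventually ha hm ew) leafSlice,
      eventually_comp_clm m2 leafSlice] with p hp a b
    rw [a, b, hp.2.2.1]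
    simp [leafSlice_apply])
  have l3 := hG.dirD_w.dirD_z.coeff_eq_zero_of_leafSlice (by
    filter_upwards [leaf, eventually_comp_clm (dirD_dirD_sub_eventually ha hm ez ew) leafSlice,
      eventually_comp_clm m4 leafSlice] with p hp a b
    rw [a, b, hp.2.2.2.1]
    simp [leafSlice_apply])
  have l4 := hG.dirD_z.dirD_z.coeff_eq_zero_of_leafSlice (by
    filter_upwards [leaf, eventually_comp_clm (dirD_dirD_sub_eventually ha hm ez ez) leafSlice,
      eventually_comp_clm m3 leafSlice] with p hp a b
    rw [a, b, hp.2.2.2.2.1]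
    simp [leafSlice_apply])
  have l5 := hG.dirD_w.dirD_w.coeff_eq_zero_of_leafSlice (by
    filter_upwards [leaf, eventually_comp_clm (dirD_dirD_sub_eventually ha hm ew ew) leafSlice,
      eventually_comp_clm m5 leafSlice] with p hp a b
    rw [a, b, hp.2.2.2.2.2]
    simp [leafSlice_apply])
  have p0 := hG.coeff_eq_zero_of_holSlice (by
    filter_upwards [show ∀ᶠ Z in 𝓝 0, Φ (holSlice Z) = 0 from hΦ.zero] with Z hZ
    rw [hZ]
    simp [modelPol, holSlice_apply])
  have p1 := hG.dirD_w.coeff_eq_zero_of_holSlice (by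
    filter_upwards [show ∀ᶠ Z in 𝓝 0, dirD ew Φ (holSlice Z) = Z.1 from hΦ.one,
      eventually_comp_clm (dirD_sub_eventually ha hm ew) holSlice,
      eventually_comp_clm m2 holSlice] with Z hZ a b
    rw [a, b, hZ]
    simp [holSlice_apply, geomKernel])
  have p2 := hG.dirD_w.dirD_w.coeff_eq_zero_of_holSlice (by
    filter_upwards [show ∀ᶠ Z in 𝓝 0, dirD ew (dirD ew Φ) (holSlice Z) = Z.2 from hΦ.two,
      eventually_comp_clm (dirD_dirD_sub_eventually ha hm ew ew) holSlice,
      eventually_comp_clm m5 holSlice] with Z hZ a b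
    rw [a, b, hZ]
    simp [holSlice_apply, geomKernel])
  norm_num at l1 l2 l3 l4 l5 p1 p2
  refine ⟨G, hexp, ?_, p0, fun c d => ?_, p1, fun c d => ?_, p2, fun c d => ?_, g4, ?_, g5, ?_⟩
  · intro a b c d hac
    have : a = 0 ∧ c = 0 ∨ a = 1 ∧ c = 0 ∨ a = 0 ∧ c = 1 ∨ a = 1 ∧ c = 1 ∨ a = 2 ∧ c = 0 ∨
      a = 0 ∧ c = 2 := by omega
    rcases this with ⟨rfl, rfl⟩ | ⟨rfl, rfl⟩ | ⟨rfl, rfl⟩ | ⟨rfl, rfl⟩ | ⟨rfl, rfl⟩ | ⟨rfl, rfl⟩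
    exacts [l0 b d, l1 b d, l2 b d, l3 b d, l4 b d, l5 b d]
  · rw [hconj, p0, star_zero]
  · rw [hconj, p1, star_zero]
  · rw [hconj, p2, star_zero]
  · rw [hconj, g4, star_zero]
  · rw [hconj, star_def, conj_im, g5, neg_zero]

/-- The coefficients with d = 0 and c = 0, 1, 2 record the remainder and its first two w-derivatives
on {W = 0}, where the model and its w-derivatives take the values 0, z and ζ. -/
theorem IsNormalForm.prenormal (hG : IsNormalForm F G) (hF : InClassC21 F)
    (h : IsPolarization Φ F) : Prenormal Φ ∧ sporadicFour Φ = 0 ∧ (sporadicFive Φ).im = 0 := by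
  have hm := analyticAt_modelPol
  have ha := h.analytic
  have hs : HasPolSum (fun v => Φ v - modelPol v) G := by
    refine hG.expansion.hasPolSum (ha.sub hm) ?_
    filter_upwards [h.eq] with p hp
    rw [hp, modelPol_polDiag]
  obtain ⟨m1, m2, m3, m4, m5, -⟩ := dirD_modelPol
  refine ⟨⟨ha, h.hermitian, h.leviDegenerate hF, ?_, ?_, ?_⟩, ?_, ?_⟩
  · filter_upwards [hs.eventually_holSlice_eq_zero hG.prenormal_zero] with Z hZ
    have : modelPol (holSlice Z) = 0 := by simp [modelPol, holSlice_apply]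
    rw [this, sub_zero] at hZ
    exact hZ
  · filter_upwards [hs.dirD_w.eventually_holSlice_eq_zero (by simp [hG.prenormal_one]),
      eventually_comp_clm (dirD_sub_eventually ha hm ew) holSlice,
      eventually_comp_clm m2 holSlice] with Z hZ a b
    rw [a, b] at hZ
    refine (sub_eq_zero.1 hZ).trans ?_
    simp [holSlice_apply, geomKernel]
  · filter_upwards [hs.dirD_w.dirD_w.eventually_holSlice_eq_zero (by simp [hG.prenormal_two]),
      eventually_comp_clm (dirD_dirD_sub_eventually ha hm ew ew) holSlice,
      eventually_comp_clm m5 holSlice] with Z hZ a b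
    rw [a, b] at hZ
    refine (sub_eq_zero.1 hZ).trans ?_
    simp [holSlice_apply, geomKernel]
  · rw [sporadicFour_eq ha hs, hG.sporadic_order_four, mul_zero]
  · rw [sporadicFive_eq ha hs]
    simp [hG.sporadic_order_five]

end Remainder

end LeviPolarized

/-! ### Conjugate germs and substitution of (φ, φ̄) -/

section ConjugateFunction

/-- The holomorphic function `W ↦ conj (f (conj W))`. -/
noncomputable def conjFun (f : ℂ × ℂ → ℂ) (W : ℂ × ℂ) : ℂ := star (f (star W))

theorem conjFun_zero {f : ℂ × ℂ → ℂ} (h : f 0 = 0) : conjFun f 0 = 0 := by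
  simp [conjFun, h]

/-- Conjugating the coefficients of a power series does not change their geometric bound. -/
theorem analyticAt_conjFun {f : ℂ × ℂ → ℂ} (hf : AnalyticAt ℂ f 0) :
    AnalyticAt ℂ (conjFun f) 0 := by
  let e : Fin 2 → ℂ × ℂ := ![(1, 0), (0, 1)]
  let l : Fin 2 → ℂ × ℂ →L[ℂ] ℂ := ![ContinuousLinearMap.fst ℂ ℂ ℂ, ContinuousLinearMap.snd ℂ ℂ ℂ]
  have hl : ∀ v, v = ∑ i, l i v • e i := fun v => by
    simp only [Fin.sum_univ_two]
    ext <;> simp [e, l]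
  have hls : ∀ i v, l i (star v) = star (l i v) := fun i v => by
    fin_cases i <;> simp [l]
  obtain ⟨c, C, K, hK, hc, hs⟩ := hf.exists_word_expansion hl
  obtain ⟨Ψ, hΨ, hsΨ⟩ := exists_analyticAt_of_words l (fun n i => star (c n i)) hK
    (fun n i => by simpa using hc n i)
  refine hΨ.congr ?_
  filter_upwards [hsΨ, tendsto_star_pair.eventually hs] with W h1 h2
  refine h1.unique (h2.star.congr_arg fun n => ?_)
  simp [star_sum, hls]

theorem dirD_conjFun {f : ℂ × ℂ → ℂ} (hf : AnalyticAt ℂ f 0) (u : ℂ × ℂ) :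
    dirD u (conjFun f) =ᶠ[𝓝 0] conjFun (dirD (star u) f) := by
  filter_upwards [(analyticAt_conjFun hf).eventually_analyticAt,
    tendsto_star_pair.eventually hf.eventually_analyticAt] with W h1 h2
  rw [conjFun, ← deriv_comp_line h1.differentiableAt, ← deriv_comp_line h2.differentiableAt]
  have e : (fun s : ℂ => conjFun f (W + s • u)) =
      (starRingEnd ℂ) ∘ (fun s : ℂ => f (star W + s • star u)) ∘ (starRingEnd ℂ) := by
    funext s
    simp [conjFun]
  rw [e, deriv_conj_conj]
  simp

theorem dirD_conjFun_zero {f : ℂ × ℂ → ℂ} (hf : AnalyticAt ℂ f 0) (u : ℂ × ℂ) :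
    dirD u (conjFun f) 0 = star (dirD (star u) f 0) := by
  rw [(dirD_conjFun hf u).self_of_nhds]
  simp [conjFun]

theorem dirD_dirD_conjFun_zero {f : ℂ × ℂ → ℂ} (hf : AnalyticAt ℂ f 0) (u u' : ℂ × ℂ) :
    dirD u (dirD u' (conjFun f)) 0 = star (dirD (star u) (dirD (star u') f) 0) := by
  rw [((dirD_conjFun hf u').dirD u).self_of_nhds, dirD_conjFun_zero (hf.dirD _)]

/-- The map `(Z, W) ↦ (φ(Z), φ̄(W))` of polarized variables induced by `φ = (f, g)`. -/
noncomputable def polMap (f g : ℂ × ℂ → ℂ) (v : Pol) : Pol :=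
  ((f v.1, g v.1), (conjFun f v.2, conjFun g v.2))

variable {f g : ℂ × ℂ → ℂ}

theorem polMap_polDiag (p : ℂ × ℂ) : polMap f g (polDiag p) = polDiag (f p, g p) := by
  simp [polMap, polDiag, conjFun, Prod.star_def]

theorem polMap_polSwap (v : Pol) : polMap f g (polSwap v) = polSwap (polMap f g v) := by
  simp [polMap, polSwap, conjFun, Prod.star_def]

theorem polMap_zero (hf0 : f 0 = 0) (hg0 : g 0 = 0) : polMap f g 0 = 0 := by
  have h1 := conjFun_zero hf0
  have h2 := conjFun_zero hg0
  have : polMap f g 0 = ((f 0, g 0), (conjFun f 0, conjFun g 0)) := rfl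
  rw [this, h1, h2, hf0, hg0]
  rfl

theorem polMap_holSlice (hf0 : f 0 = 0) (hg0 : g 0 = 0) (Z : ℂ × ℂ) :
    polMap f g (holSlice Z) = holSlice (f Z, g Z) := by
  have h1 := conjFun_zero hf0
  have h2 := conjFun_zero hg0
  have : polMap f g (holSlice Z) = ((f Z, g Z), (conjFun f 0, conjFun g 0)) := rfl
  rw [this, h1, h2]
  rfl

theorem analyticAt_fst_comp {f : ℂ × ℂ → ℂ} (hf : AnalyticAt ℂ f 0) :
    AnalyticAt ℂ (fun v : Pol => f v.1) 0 :=
  hf.comp_clm (ContinuousLinearMap.fst ℂ (ℂ × ℂ) (ℂ × ℂ))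

theorem analyticAt_snd_comp {f : ℂ × ℂ → ℂ} (hf : AnalyticAt ℂ f 0) :
    AnalyticAt ℂ (fun v : Pol => f v.2) 0 :=
  hf.comp_clm (ContinuousLinearMap.snd ℂ (ℂ × ℂ) (ℂ × ℂ))

theorem analyticAt_polMap (hf : AnalyticAt ℂ f 0) (hg : AnalyticAt ℂ g 0) :
    AnalyticAt ℂ (polMap f g) 0 :=
  ((analyticAt_fst_comp hf).prod (analyticAt_fst_comp hg)).prod
    ((analyticAt_snd_comp (analyticAt_conjFun hf)).prod
      (analyticAt_snd_comp (analyticAt_conjFun hg)))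

theorem tendsto_polMap (hf : AnalyticAt ℂ f 0) (hg : AnalyticAt ℂ g 0) (hf0 : f 0 = 0)
    (hg0 : g 0 = 0) : Tendsto (polMap f g) (𝓝 0) (𝓝 0) := by
  have := (analyticAt_polMap hf hg).continuousAt.tendsto
  rwa [polMap_zero hf0 hg0] at this

theorem AnalyticAt.comp_polMap {Ψ : Pol → ℂ} (hΨ : AnalyticAt ℂ Ψ 0) (hf : AnalyticAt ℂ f 0)
    (hg : AnalyticAt ℂ g 0) (hf0 : f 0 = 0) (hg0 : g 0 = 0) :
    AnalyticAt ℂ (fun v => Ψ (polMap f g v)) 0 :=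
  AnalyticAt.comp (g := Ψ) (by rwa [polMap_zero hf0 hg0]) (analyticAt_polMap hf hg)

theorem eventually_dirD_polMap {Ψ : Pol → ℂ} (hΨ : AnalyticAt ℂ Ψ 0) (hf : AnalyticAt ℂ f 0)
    (hg : AnalyticAt ℂ g 0) (hf0 : f 0 = 0) (hg0 : g 0 = 0) (a b : ℂ × ℂ) :
    ∀ᶠ v in 𝓝 0, dirD (a, b) (fun v => Ψ (polMap f g v)) v =
      dirD a f v.1 * dirD ez Ψ (polMap f g v) + dirD a g v.1 * dirD eζ Ψ (polMap f g v) +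
      (dirD b (conjFun f) v.2 * dirD ew Ψ (polMap f g v) +
        dirD b (conjFun g) v.2 * dirD eη Ψ (polMap f g v)) := by
  have tf : Tendsto (fun v : Pol => v.1) (𝓝 0) (𝓝 0) := continuous_fst.tendsto' 0 0 rfl
  have ts : Tendsto (fun v : Pol => v.2) (𝓝 0) (𝓝 0) := continuous_snd.tendsto' 0 0 rfl
  filter_upwards [(tendsto_polMap hf hg hf0 hg0).eventually hΨ.eventually_analyticAt,
    tf.eventually hf.eventually_analyticAt, tf.eventually hg.eventually_analyticAt,
    ts.eventually (analyticAt_conjFun hf).eventually_analyticAt,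
    ts.eventually (analyticAt_conjFun hg).eventually_analyticAt] with v h0 h1 h2 h3 h4
  have hp : HasFDerivAt (polMap f g) _ v :=
    ((h1.differentiableAt.hasFDerivAt.comp v hasFDerivAt_fst).prodMk
      (h2.differentiableAt.hasFDerivAt.comp v hasFDerivAt_fst)).prodMk
    ((h3.differentiableAt.hasFDerivAt.comp v hasFDerivAt_snd).prodMk
      (h4.differentiableAt.hasFDerivAt.comp v hasFDerivAt_snd))
  have hc := (h0.differentiableAt.hasFDerivAt.comp v hp).fderiv
  simp only [dirD]
  rw [show (fun v => Ψ (polMap f g v)) = Ψ ∘ polMap f g from rfl, hc]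
  have e : ∀ x y s t : ℂ, (((x, y), (s, t)) : Pol) = x • ez + y • eζ + (s • ew + t • eη) :=
    fun x y s t => by simp
  simp only [ContinuousLinearMap.comp_apply, ContinuousLinearMap.prod_apply,
    ContinuousLinearMap.coe_fst', ContinuousLinearMap.coe_snd']
  rw [e, map_add, map_add, map_add, map_smul, map_smul, map_smul, map_smul]
  rfl

theorem dirD_zero_dir {V : Type*} [NormedAddCommGroup V] [NormedSpace ℂ V] (Φ : V → ℂ) (v : V) :
    dirD 0 Φ v = 0 := by simp [dirD]

theorem eventually_dirD_polMap_anti {Ψ : Pol → ℂ} (hΨ : AnalyticAt ℂ Ψ 0) (hf : AnalyticAt ℂ f 0)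
    (hg : AnalyticAt ℂ g 0) (hf0 : f 0 = 0) (hg0 : g 0 = 0) (b : ℂ × ℂ) :
    dirD (0, b) (fun v => Ψ (polMap f g v)) =ᶠ[𝓝 0] fun v =>
      dirD b (conjFun f) v.2 * dirD ew Ψ (polMap f g v) +
        dirD b (conjFun g) v.2 * dirD eη Ψ (polMap f g v) := by
  filter_upwards [eventually_dirD_polMap hΨ hf hg hf0 hg0 0 b] with v hv
  rw [hv, dirD_zero_dir, dirD_zero_dir]
  ring

theorem eventually_dirD_polMap_hol {Ψ : Pol → ℂ} (hΨ : AnalyticAt ℂ Ψ 0) (hf : AnalyticAt ℂ f 0)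
    (hg : AnalyticAt ℂ g 0) (hf0 : f 0 = 0) (hg0 : g 0 = 0) (a : ℂ × ℂ) :
    dirD (a, 0) (fun v => Ψ (polMap f g v)) =ᶠ[𝓝 0] fun v =>
      dirD a f v.1 * dirD ez Ψ (polMap f g v) + dirD a g v.1 * dirD eζ Ψ (polMap f g v) := by
  filter_upwards [eventually_dirD_polMap hΨ hf hg hf0 hg0 a 0] with v hv
  rw [hv, dirD_zero_dir, dirD_zero_dir]
  ring

theorem eventually_dirD_snd_mul {q : ℂ × ℂ → ℂ} {Ψ : Pol → ℂ} (hq : AnalyticAt ℂ q 0)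
    (hΨ : AnalyticAt ℂ Ψ 0) (a b : ℂ × ℂ) :
    ∀ᶠ v in 𝓝 0, dirD (a, b) (fun v : Pol => q v.2 * Ψ v) v =
      dirD b q v.2 * Ψ v + q v.2 * dirD (a, b) Ψ v := by
  filter_upwards [(analyticAt_snd_comp hq).eventually_analyticAt, hΨ.eventually_analyticAt,
    dirD_comp_clm_eventually hq (ContinuousLinearMap.snd ℂ (ℂ × ℂ) (ℂ × ℂ)) (a, b)] with v h1 h2 h3
  rw [dirD_mul (Φ := fun v : Pol => q v.2) h1.differentiableAt h2.differentiableAt]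
  congr 2

/-- The mixed second derivatives of `Φ(φ(Z), φ̄(W))`. -/
theorem eventually_mixed_polMap {Ψ : Pol → ℂ} (hΨ : AnalyticAt ℂ Ψ 0) (hf : AnalyticAt ℂ f 0)
    (hg : AnalyticAt ℂ g 0) (hf0 : f 0 = 0) (hg0 : g 0 = 0) (a b : ℂ × ℂ) :
    ∀ᶠ v in 𝓝 0, dirD (a, 0) (dirD (0, b) (fun v => Ψ (polMap f g v))) v =
      dirD b (conjFun f) v.2 * (dirD a f v.1 * dirD ez (dirD ew Ψ) (polMap f g v) +
        dirD a g v.1 * dirD eζ (dirD ew Ψ) (polMap f g v)) +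
      dirD b (conjFun g) v.2 * (dirD a f v.1 * dirD ez (dirD eη Ψ) (polMap f g v) +
        dirD a g v.1 * dirD eζ (dirD eη Ψ) (polMap f g v)) := by
  have cf := (analyticAt_conjFun hf).dirD b
  have cg := (analyticAt_conjFun hg).dirD b
  have kw := (hΨ.dirD ew).comp_polMap hf hg hf0 hg0
  have kη := (hΨ.dirD eη).comp_polMap hf hg hf0 hg0
  filter_upwards [(eventually_dirD_polMap_anti hΨ hf hg hf0 hg0 b).dirD (a, 0),
    eventually_dirD_snd_mul cf kw a 0, eventually_dirD_snd_mul cg kη a 0,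
    eventually_dirD_polMap_hol (hΨ.dirD ew) hf hg hf0 hg0 a,
    eventually_dirD_polMap_hol (hΨ.dirD eη) hf hg hf0 hg0 a,
    ((analyticAt_snd_comp cf).mul kw).eventually_analyticAt,
    ((analyticAt_snd_comp cg).mul kη).eventually_analyticAt] with v h1 h2 h3 h4 h5 h6 h7
  rw [h1, dirD_add (Φ := fun v : Pol => dirD b (conjFun f) v.2 * dirD ew Ψ (polMap f g v))
    (Ψ := fun v : Pol => dirD b (conjFun g) v.2 * dirD eη Ψ (polMap f g v))
    h6.differentiableAt h7.differentiableAt, h2, h3, h4, h5, dirD_zero_dir, dirD_zero_dir]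
  ring

/-- The Levi matrix is multiplied on the two sides by the Jacobian matrices of φ and φ̄, and its
determinant by both Jacobians. -/
theorem LeviDegenerate.comp_polMap {Ψ : Pol → ℂ} (h : LeviDegenerate Ψ) (hΨ : AnalyticAt ℂ Ψ 0)
    (hf : AnalyticAt ℂ f 0) (hg : AnalyticAt ℂ g 0) (hf0 : f 0 = 0) (hg0 : g 0 = 0) :
    LeviDegenerate fun v => Ψ (polMap f g v) := by
  filter_upwards [eventually_mixed_polMap hΨ hf hg hf0 hg0 (1, 0) (1, 0),
    eventually_mixed_polMap hΨ hf hg hf0 hg0 (1, 0) (0, 1),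
    eventually_mixed_polMap hΨ hf hg hf0 hg0 (0, 1) (1, 0),
    eventually_mixed_polMap hΨ hf hg hf0 hg0 (0, 1) (0, 1),
    (tendsto_polMap hf hg hf0 hg0).eventually h] with v h1 h2 h3 h4 h5
  rw [h1, h2, h3, h4]
  linear_combination (dirD (1, 0) (conjFun f) v.2 * dirD (0, 1) (conjFun g) v.2 -
    dirD (0, 1) (conjFun f) v.2 * dirD (1, 0) (conjFun g) v.2) *
    (dirD (1, 0) f v.1 * dirD (0, 1) g v.1 - dirD (0, 1) f v.1 * dirD (1, 0) g v.1) * h5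

theorem IsHermitian.comp_polMap {Ψ : Pol → ℂ} (h : IsHermitian Ψ)
    (hf : AnalyticAt ℂ f 0) (hg : AnalyticAt ℂ g 0) (hf0 : f 0 = 0) (hg0 : g 0 = 0) :
    IsHermitian fun v => Ψ (polMap f g v) := by
  filter_upwards [(tendsto_polMap hf hg hf0 hg0).eventually h] with v hv
  rw [hv, polMap_polSwap]

end ConjugateFunction

/-! ### Third-order jets along curves -/

section CurveJet

variable {V : Type*} [NormedAddCommGroup V] [NormedSpace ℂ V]

/-- The curve `s ↦ s u + γ(s) v`. -/
def jetCurve (u v : V) (γ : ℂ → ℂ) (s : ℂ) : V := s • u + γ s • v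

variable {F : V → ℂ} {γ : ℂ → ℂ}

theorem analyticAt_jetCurve (hγ : AnalyticAt ℂ γ 0) (u v : V) :
    AnalyticAt ℂ (jetCurve u v γ) 0 :=
  (analyticAt_id.smul analyticAt_const).add (hγ.smul analyticAt_const)

theorem jetCurve_zero (h0 : γ 0 = 0) (u v : V) : jetCurve u v γ 0 = 0 := by simp [jetCurve, h0]

theorem AnalyticAt.comp_jetCurve (hF : AnalyticAt ℂ F 0) (hγ : AnalyticAt ℂ γ 0) (h0 : γ 0 = 0)
    (u v : V) : AnalyticAt ℂ (fun s => F (jetCurve u v γ s)) 0 :=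
  AnalyticAt.comp (g := F) (by rwa [jetCurve_zero h0]) (analyticAt_jetCurve hγ u v)

theorem deriv_comp_jetCurve (hF : AnalyticAt ℂ F 0) (hγ : AnalyticAt ℂ γ 0) (h0 : γ 0 = 0)
    (u v : V) : deriv (fun s => F (jetCurve u v γ s)) =ᶠ[𝓝 0] fun s =>
      dirD u F (jetCurve u v γ s) + deriv γ s * dirD v F (jetCurve u v γ s) := by
  have ht : Tendsto (jetCurve u v γ) (𝓝 0) (𝓝 0) := by
    simpa [jetCurve_zero h0] using (analyticAt_jetCurve hγ u v).continuousAt.tendsto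
  filter_upwards [ht.eventually hF.eventually_analyticAt, hγ.eventually_analyticAt] with s h1 h2
  have hc' : HasDerivAt (fun s => s • u + γ s • v) (u + deriv γ s • v) s := by
    simpa using ((hasDerivAt_id s).smul_const u).fun_add (h2.differentiableAt.hasDerivAt.smul_const v)
  have hc : HasDerivAt (jetCurve u v γ) (u + deriv γ s • v) s := hc'
  rw [deriv_comp_curve h1.differentiableAt hc.differentiableAt, hc.deriv, dirD_add_dir,
    dirD_smul_dir]

/-- The derivatives up to order three of a function along a curve tangent to `u`. -/
theorem jet_comp_jetCurve (hF : AnalyticAt ℂ F 0) (hγ : AnalyticAt ℂ γ 0) (h0 : γ 0 = 0)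
    (h1 : deriv γ 0 = 0) (u v : V) :
    deriv (fun s => F (jetCurve u v γ s)) 0 = dirD u F 0 ∧
    deriv (deriv (fun s => F (jetCurve u v γ s))) 0 =
      dirD u (dirD u F) 0 + deriv (deriv γ) 0 * dirD v F 0 ∧
    deriv (deriv (deriv (fun s => F (jetCurve u v γ s)))) 0 =
      dirD u (dirD u (dirD u F)) 0 + 3 * deriv (deriv γ) 0 * dirD u (dirD v F) 0 +
        deriv (deriv (deriv γ)) 0 * dirD v F 0 := by
  have key : ∀ {G : V → ℂ}, AnalyticAt ℂ G 0 → deriv (fun s => G (jetCurve u v γ s)) =ᶠ[𝓝 0]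
      fun s => dirD u G (jetCurve u v γ s) + deriv γ s * dirD v G (jetCurve u v γ s) :=
    fun hG => deriv_comp_jetCurve hG hγ h0 u v
  have an : ∀ {G : V → ℂ}, AnalyticAt ℂ G 0 → AnalyticAt ℂ (fun s => G (jetCurve u v γ s)) 0 :=
    fun hG => hG.comp_jetCurve hγ h0 u v
  have c0 : jetCurve u v γ 0 = 0 := jetCurve_zero h0 u v
  have k1 := key hF
  have k2 : deriv (deriv (fun s => F (jetCurve u v γ s))) =ᶠ[𝓝 0] fun s =>
      (dirD u (dirD u F) (jetCurve u v γ s) + deriv γ s * dirD v (dirD u F) (jetCurve u v γ s)) +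
      (deriv (deriv γ) s * dirD v F (jetCurve u v γ s) + deriv γ s *
        (dirD u (dirD v F) (jetCurve u v γ s) +
          deriv γ s * dirD v (dirD v F) (jetCurve u v γ s))) := by
    filter_upwards [k1.deriv, key (hF.dirD u), key (hF.dirD v), (an (hF.dirD u)).eventually_analyticAt,
      (an (hF.dirD v)).eventually_analyticAt, hγ.deriv.eventually_analyticAt] with s a b c d e f
    rw [a, (d.differentiableAt.hasDerivAt.fun_add
      (f.differentiableAt.hasDerivAt.fun_mul e.differentiableAt.hasDerivAt)).deriv, b, c]
  have v1 := k1.self_of_nhds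
  have v2 := k2.self_of_nhds
  simp only [h1, c0] at v1 v2
  refine ⟨by rw [v1]; ring, by rw [v2]; ring, ?_⟩
  have z : ∀ {G : V → ℂ}, AnalyticAt ℂ G 0 → HasDerivAt (fun s => G (jetCurve u v γ s))
      (dirD u G 0) 0 := fun hG => by
    have := (an hG).differentiableAt.hasDerivAt
    have e := (key hG).self_of_nhds
    simp only [h1, c0, zero_mul, add_zero] at e
    rwa [e] at this
  have g1 := hγ.deriv.differentiableAt.hasDerivAt
  have g2 := hγ.deriv.deriv.differentiableAt.hasDerivAt
  rw [k2.deriv_eq, (((z ((hF.dirD u).dirD u)).fun_add (g1.fun_mul (z ((hF.dirD u).dirD v)))).fun_add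
    ((g2.fun_mul (z (hF.dirD v))).fun_add (g1.fun_mul ((z ((hF.dirD v).dirD u)).fun_add
      (g1.fun_mul (z ((hF.dirD v).dirD v))))))).deriv, h1, c0, dirD_comm hF v u]
  ring

end CurveJet

/-! ### The function κ of a prenormal hypersurface -/

section Kappa

/-- The derivative `∂_ζ̄ Φ` along the `z`-axis. -/
noncomputable def kappa (Φ : Pol → ℂ) (x : ℂ) : ℂ := dirD eη Φ (x • ez)

variable {Φ : Pol → ℂ}

theorem analyticAt_kappa (hΦ : AnalyticAt ℂ Φ 0) : AnalyticAt ℂ (kappa Φ) 0 :=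
  AnalyticAt.comp (g := dirD eη Φ) (by simpa using hΦ.dirD eη)
    (analyticAt_id.smul analyticAt_const)

namespace Prenormal

/-- On {W = 0} prenormality gives Φ_zw = 1 and Φ_ζw = 0, so the vanishing determinant reads Φ_ζη =
0. -/
theorem dirD_η_holSlice (h : Prenormal Φ) :
    ∀ᶠ Z in 𝓝 0, dirD eη Φ (holSlice Z) = kappa Φ Z.1 := by
  have hk := (h.analytic.dirD eη).comp_clm holSlice
  have hk' : AnalyticAt ℂ (fun Z : ℂ × ℂ => kappa Φ Z.1) 0 :=
    (analyticAt_kappa h.analytic).comp_clm (ContinuousLinearMap.fst ℂ ℂ ℂ)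
  have hz : ∀ᶠ Z in 𝓝 0, dirD eη Φ (holSlice Z) - kappa Φ Z.1 = 0 := by
    refine eventually_eq_zero_of_dirD_snd (α := fun _ => 0) (hk.sub hk') analyticAt_const ?_ ?_
    · filter_upwards [dirD_comp_clm_eventually (h.analytic.dirD eη) holSlice (0, 1),
        dirD_comp_clm_eventually (analyticAt_kappa h.analytic) (ContinuousLinearMap.fst ℂ ℂ ℂ) (0, 1),
        h.dirD_hol_dirD_w (1, 0), h.dirD_hol_dirD_w (0, 1), eventually_comp_clm h.levi holSlice,
        hk.eventually_analyticAt, hk'.eventually_analyticAt] with Z a b c d e f g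
      rw [dirD_sub f.differentiableAt g.differentiableAt, a, holSlice_snd]
      have b' : dirD (0, 1) (fun Z : ℂ × ℂ => kappa Φ Z.1) Z = 0 := b.trans (by simp [dirD])
      rw [c, d] at e
      rw [b']
      linear_combination e
    · refine .of_forall fun x => ?_
      have : (x • ez : Pol) = holSlice (x, 0) := by simp [holSlice_apply]
      simp [kappa, this]
  exact hz.mono fun Z hZ => sub_eq_zero.1 hZ

theorem dirD_η_zero (h : Prenormal Φ) : dirD eη Φ 0 = 0 := by
  have := (eventually_dirD_slice h.analytic antiSlice h.zero_conj (0, 1)).self_of_nhds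
  rwa [map_zero, antiSlice_snd] at this

theorem dirD_zη_zero (h : Prenormal Φ) : dirD ez (dirD eη Φ) 0 = 0 := by
  have h1 := (dirD_comp_clm_eventually (h.analytic.dirD ez) antiSlice (0, 1)).self_of_nhds
  rw [map_zero, antiSlice_snd, EventuallyEq.dirD_eq h.one_conj] at h1
  rw [dirD_comm h.analytic, ← h1]
  exact dirD_clm (ContinuousLinearMap.fst ℂ ℂ ℂ) _ _

theorem dirD_zzη_zero (h : Prenormal Φ) : dirD ez (dirD ez (dirD eη Φ)) 0 = 1 := by
  have h1 := (dirD_comp_clm_eventually ((h.analytic.dirD ez).dirD ez) antiSlice (0, 1)).self_of_nhds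
  rw [map_zero, antiSlice_snd, EventuallyEq.dirD_eq h.two_conj] at h1
  rw [((dirD_comm_eventually h.analytic ez eη).dirD ez).self_of_nhds, dirD_comm (h.analytic.dirD ez),
    ← h1]
  exact dirD_clm (ContinuousLinearMap.snd ℂ ℂ ℂ) _ _

/-- The derivatives up to order three of `κ ∘ φ`, where `φ(s) = λ s + γ(s)`. -/
theorem jet_kappa_comp (h : Prenormal Φ) {γ : ℂ → ℂ} (hγ : AnalyticAt ℂ γ 0) (h0 : γ 0 = 0)
    (h1 : deriv γ 0 = 0) (l : ℂ) :
    deriv (fun s => kappa Φ (l * s + γ s)) 0 = 0 ∧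
    deriv (deriv fun s => kappa Φ (l * s + γ s)) 0 = l ^ 2 ∧
    deriv (deriv (deriv fun s => kappa Φ (l * s + γ s))) 0 =
      l ^ 3 * sporadicFour Φ + 3 * deriv (deriv γ) 0 * l := by
  have e : (fun s => kappa Φ (l * s + γ s)) =
      fun s => dirD eη Φ (jetCurve (l • ez) ez γ s) := by
    funext s
    rw [kappa, jetCurve, smul_smul, ← add_smul, mul_comm]
  have hη := h.analytic.dirD eη
  obtain ⟨j1, j2, j3⟩ := jet_comp_jetCurve hη hγ h0 h1 (l • ez) ez
  have s1 : ∀ Ψ : Pol → ℂ, dirD (l • ez) Ψ = fun v => l * dirD ez Ψ v :=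
    fun Ψ => funext fun v => dirD_smul_dir l ez Ψ v
  have s2 : dirD ez (dirD (l • ez) (dirD eη Φ)) =ᶠ[𝓝 0]
      fun v => l * dirD ez (dirD ez (dirD eη Φ)) v := by
    rw [s1]
    filter_upwards [(hη.dirD ez).eventually_analyticAt] with v hv
    rw [dirD_const_mul hv.differentiableAt]
  have s3 : dirD ez (dirD ez (dirD (l • ez) (dirD eη Φ))) 0 =
      l * dirD ez (dirD ez (dirD ez (dirD eη Φ))) 0 := by
    rw [s2.dirD_eq, dirD_const_mul ((hη.dirD ez).dirD ez).differentiableAt]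
  have s4 : dirD ez (dirD (l • ez) (dirD (l • ez) (dirD eη Φ))) 0 =
      l * (l * dirD ez (dirD ez (dirD ez (dirD eη Φ))) 0) := by
    rw [s1 (dirD (l • ez) (dirD eη Φ)),
      dirD_const_mul ((hη.dirD (l • ez)).dirD ez).differentiableAt, s3]
  rw [e]
  refine ⟨?_, ?_, ?_⟩
  · rw [j1, dirD_smul_dir, h.dirD_zη_zero, mul_zero]
  · have s2' : dirD ez (dirD (l • ez) (dirD eη Φ)) 0 = l * dirD ez (dirD ez (dirD eη Φ)) 0 :=
      s2.self_of_nhds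
    rw [j2, dirD_smul_dir, s2', h.dirD_zzη_zero, h.dirD_zη_zero]
    ring
  · rw [j3, dirD_smul_dir, s4, dirD_smul_dir, h.dirD_zzη_zero, h.dirD_zη_zero, sporadicFour]
    ring

theorem kappa_zero (h : Prenormal Φ) : kappa Φ 0 = 0 := by
  rw [kappa, zero_smul, h.dirD_η_zero]

end Prenormal

end Kappa

/-! ### Jets along lines and of linear combinations -/

section Jets

theorem jet_comp_line {V : Type*} [NormedAddCommGroup V] [NormedSpace ℂ V] {F : V → ℂ}
    (hF : AnalyticAt ℂ F 0) (u : V) :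
    deriv (fun s : ℂ => F (s • u)) 0 = dirD u F 0 ∧
    deriv (deriv (fun s : ℂ => F (s • u))) 0 = dirD u (dirD u F) 0 ∧
    deriv (deriv (deriv (fun s : ℂ => F (s • u)))) 0 = dirD u (dirD u (dirD u F)) 0 := by
  have := jet_comp_jetCurve (γ := fun _ => 0) hF analyticAt_const rfl (by simp) u 0
  simpa [jetCurve] using this

theorem jet_linear_combination {f g : ℂ → ℂ} (hf : AnalyticAt ℂ f 0) (hg : AnalyticAt ℂ g 0)
    (a b : ℂ) :
    deriv (fun s => a * f s + b * g s) 0 = a * deriv f 0 + b * deriv g 0 ∧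
    deriv (deriv fun s => a * f s + b * g s) 0 = a * deriv (deriv f) 0 + b * deriv (deriv g) 0 ∧
    deriv (deriv (deriv fun s => a * f s + b * g s)) 0 =
      a * deriv (deriv (deriv f)) 0 + b * deriv (deriv (deriv g)) 0 := by
  have key : ∀ {f g : ℂ → ℂ}, AnalyticAt ℂ f 0 → AnalyticAt ℂ g 0 →
      deriv (fun s => a * f s + b * g s) =ᶠ[𝓝 0] fun s => a * deriv f s + b * deriv g s := by
    intro f g hf hg
    filter_upwards [hf.eventually_analyticAt, hg.eventually_analyticAt] with s h1 h2
    exact ((h1.differentiableAt.hasDerivAt.const_mul a).fun_add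
      (h2.differentiableAt.hasDerivAt.const_mul b)).deriv
  have k1 := key hf hg
  have k2 := k1.deriv.trans (key hf.deriv hg.deriv)
  have k3 := k2.deriv.trans (key hf.deriv.deriv hg.deriv.deriv)
  exact ⟨k1.self_of_nhds, k2.self_of_nhds, k3.self_of_nhds⟩

theorem jet_id : deriv (fun s : ℂ => s) 0 = 1 ∧ deriv (deriv fun s : ℂ => s) 0 = 0 ∧
    deriv (deriv (deriv fun s : ℂ => s)) 0 = 0 := by
  have : deriv (fun s : ℂ => s) = fun _ => 1 := deriv_id''
  simp [this]

theorem Prenormal.jet_kappa {Φ : Pol → ℂ} (h : Prenormal Φ) : deriv (kappa Φ) 0 = 0 ∧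
    deriv (deriv (kappa Φ)) 0 = 1 ∧ deriv (deriv (deriv (kappa Φ))) 0 = sporadicFour Φ := by
  have := h.jet_kappa_comp (γ := fun _ => 0) analyticAt_const rfl (by simp) 1
  simpa using this

end Jets

/-! ### Maps between prenormal hypersurfaces -/

section Rigidity

variable {Ψ : Pol → ℂ} {f g : ℂ × ℂ → ℂ}

/-- Antiholomorphic first derivatives of `Ψ(φ(Z), φ̄(W))` along `{W = 0}`. -/
theorem eventually_dirD_polMap_holSlice (hΨ : AnalyticAt ℂ Ψ 0) (hf : AnalyticAt ℂ f 0)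
    (hg : AnalyticAt ℂ g 0) (hf0 : f 0 = 0) (hg0 : g 0 = 0) (b : ℂ × ℂ) :
    ∀ᶠ Z in 𝓝 0, dirD (0, b) (fun v => Ψ (polMap f g v)) (holSlice Z) =
      star (dirD (star b) f 0) * dirD ew Ψ (holSlice (f Z, g Z)) +
        star (dirD (star b) g 0) * dirD eη Ψ (holSlice (f Z, g Z)) := by
  filter_upwards [eventually_comp_clm (eventually_dirD_polMap_anti hΨ hf hg hf0 hg0 b) holSlice]
    with Z hZ
  rw [hZ, polMap_holSlice hf0 hg0, ← dirD_conjFun_zero hf, ← dirD_conjFun_zero hg]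
  rfl

/-- Antiholomorphic second derivatives of `Ψ(φ(Z), φ̄(W))` along `{W = 0}`. -/
theorem eventually_dirD_dirD_polMap_holSlice (hΨ : AnalyticAt ℂ Ψ 0) (hf : AnalyticAt ℂ f 0)
    (hg : AnalyticAt ℂ g 0) (hf0 : f 0 = 0) (hg0 : g 0 = 0) (b : ℂ × ℂ) :
    ∀ᶠ Z in 𝓝 0, dirD (0, b) (dirD (0, b) (fun v => Ψ (polMap f g v))) (holSlice Z) =
      star (dirD (star b) (dirD (star b) f) 0) * dirD ew Ψ (holSlice (f Z, g Z)) +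
      star (dirD (star b) f 0) *
        (star (dirD (star b) f 0) * dirD ew (dirD ew Ψ) (holSlice (f Z, g Z)) +
          star (dirD (star b) g 0) * dirD eη (dirD ew Ψ) (holSlice (f Z, g Z))) +
      (star (dirD (star b) (dirD (star b) g) 0) * dirD eη Ψ (holSlice (f Z, g Z)) +
      star (dirD (star b) g 0) *
        (star (dirD (star b) f 0) * dirD ew (dirD eη Ψ) (holSlice (f Z, g Z)) +
          star (dirD (star b) g 0) * dirD eη (dirD eη Ψ) (holSlice (f Z, g Z)))) := by
  have cf := (analyticAt_conjFun hf).dirD b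
  have cg := (analyticAt_conjFun hg).dirD b
  have kw := (hΨ.dirD ew).comp_polMap hf hg hf0 hg0
  have kη := (hΨ.dirD eη).comp_polMap hf hg hf0 hg0
  filter_upwards [eventually_comp_clm ((eventually_dirD_polMap_anti hΨ hf hg hf0 hg0 b).dirD (0, b))
      holSlice,
    eventually_comp_clm (eventually_dirD_snd_mul cf kw 0 b) holSlice,
    eventually_comp_clm (eventually_dirD_snd_mul cg kη 0 b) holSlice,
    eventually_dirD_polMap_holSlice (hΨ.dirD ew) hf hg hf0 hg0 b,
    eventually_dirD_polMap_holSlice (hΨ.dirD eη) hf hg hf0 hg0 b,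
    eventually_comp_clm ((analyticAt_snd_comp cf).mul kw).eventually_analyticAt holSlice,
    eventually_comp_clm ((analyticAt_snd_comp cg).mul kη).eventually_analyticAt holSlice]
    with Z h1 h2 h3 h4 h5 h6 h7
  rw [h1, dirD_add (Φ := fun v : Pol => dirD b (conjFun f) v.2 * dirD ew Ψ (polMap f g v))
    (Ψ := fun v : Pol => dirD b (conjFun g) v.2 * dirD eη Ψ (polMap f g v))
    h6.differentiableAt h7.differentiableAt, h2, h3, h4, h5, polMap_holSlice hf0 hg0,
    ← dirD_dirD_conjFun_zero hf, ← dirD_dirD_conjFun_zero hg, ← dirD_conjFun_zero hf,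
    ← dirD_conjFun_zero hg]
  rfl

theorem dirD_const_mul_eventually {V : Type*} [NormedAddCommGroup V] [NormedSpace ℂ V]
    {Φ : V → ℂ} {a : V} (hΦ : AnalyticAt ℂ Φ a) (c : ℂ) (u : V) :
    dirD u (fun x => c * Φ x) =ᶠ[𝓝 a] fun v => c * dirD u Φ v :=
  hΦ.eventually_analyticAt.mono fun _ hv => dirD_const_mul hv.differentiableAt c u

variable {Φ Φ' : Pol → ℂ}

theorem Prenormal.dirD_ζwη_zero (h : Prenormal Φ) : dirD eζ (dirD ew (dirD eη Φ)) 0 = 0 := by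
  have h1 := eventually_dirD_slice (h.analytic.dirD ew) leafSlice (h.leaf.mono fun _ hp => hp.2.2.1)
    (0, 1)
  have h2 := (eventually_dirD_slice ((h.analytic.dirD ew).dirD _) leafSlice h1 (1, 0)).self_of_nhds
  rw [leafSlice_fst, leafSlice_snd, map_zero] at h2
  rw [(dirD_comm_eventually h.analytic ew eη).dirD_eq, h2]

/-- This is the coefficient of ζη in Φ_zw = 1 / (1 - ζη) on the leaf. It is what makes the parameter
c visible in `sporadicFive`. -/
theorem Prenormal.dirD_zζwη_zero (h : Prenormal Φ) :
    dirD ez (dirD eζ (dirD ew (dirD eη Φ))) 0 = 1 := by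
  have hw := h.analytic.dirD ew
  have h0 : (fun p => dirD ez (dirD ew Φ) (leafSlice p)) =ᶠ[𝓝 0] geomKernel :=
    h.leaf.mono fun _ hp => hp.2.2.2.1
  have h1 : (fun p => dirD eη (dirD ez (dirD ew Φ)) (leafSlice p)) =ᶠ[𝓝 0]
      dirD (0, 1) geomKernel := by
    filter_upwards [h0.dirD (0, 1), dirD_comp_clm_eventually (hw.dirD ez) leafSlice (0, 1)]
      with p a b
    rw [← a, b, leafSlice_snd]
  have h2 : (fun p => dirD eη (dirD ez (dirD ew Φ)) (leafSlice p)) =ᶠ[𝓝 0]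
      fun p => p.1 * geomKernel p ^ 2 := by
    filter_upwards [h1, dirD_geomKernel (0, 1)] with p a b
    rw [a, b]
    ring
  have h3 := (dirD_comp_clm_eventually ((hw.dirD ez).dirD eη) leafSlice (1, 0)).self_of_nhds
  have hd : DifferentiableAt ℂ (fun p => geomKernel p ^ 2) 0 :=
    analyticAt_geomKernel.differentiableAt.pow 2
  have h4 : dirD (1, 0) (fun p : ℂ × ℂ => p.1) 0 = 1 :=
    dirD_clm (ContinuousLinearMap.fst ℂ ℂ ℂ) _ _
  rw [h2.dirD_eq, map_zero, leafSlice_fst, dirD_mul differentiableAt_fst hd, h4] at h3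
  rw [((dirD_comm_eventually h.analytic ew eη).dirD eζ).dirD_eq,
    dirD_comm (hw.dirD eη), (dirD_comm_eventually hw ez eη).dirD_eq, ← h3]
  simp [geomKernel]

/-- The effect of `(z, ζ) ↦ (λ z, ν ζ + c κ(λ z))` on the derivative `∂_z³ ∂_z̄ ∂_ζ̄`. -/
theorem Prenormal.sporadicFive_comp (h : Prenormal Φ)
    (hf : AnalyticAt ℂ f 0) (hg : AnalyticAt ℂ g 0) {l ν c : ℂ}
    (ef : ∀ᶠ Z in 𝓝 0, f Z = l * Z.1)
    (eg : ∀ᶠ Z in 𝓝 0, g Z = ν * Z.2 + c * kappa Φ (l * Z.1)) :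
    sporadicFive (fun v => Φ (polMap f g v)) =
      star ν * star l * l ^ 3 * (sporadicFive Φ + 3 * c) := by
  have hΦ := h.analytic
  have hf0 : f 0 = 0 := by simpa using ef.self_of_nhds
  have hg0 : g 0 = 0 := by simpa [h.kappa_zero] using eg.self_of_nhds
  have dfst : ∀ u Z : ℂ × ℂ, dirD u (fun Z : ℂ × ℂ => Z.1) Z = u.1 := fun u Z =>
    dirD_clm (ContinuousLinearMap.fst ℂ ℂ ℂ) Z u
  have dsnd : ∀ u Z : ℂ × ℂ, dirD u (fun Z : ℂ × ℂ => Z.2) Z = u.2 := fun u Z =>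
    dirD_clm (ContinuousLinearMap.snd ℂ ℂ ℂ) Z u
  obtain ⟨k1, k2, k3⟩ := h.jet_kappa_comp (γ := fun _ => 0) analyticAt_const rfl (by simp) l
  simp only [add_zero, deriv_const', mul_zero, zero_mul] at k1 k2 k3
  have hκl : AnalyticAt ℂ (fun s => kappa Φ (l * s)) 0 :=
    AnalyticAt.comp (g := kappa Φ) (by simpa using analyticAt_kappa hΦ)
      (analyticAt_const.mul analyticAt_id)
  have hκl2 : AnalyticAt ℂ (fun Z : ℂ × ℂ => kappa Φ (l * Z.1)) 0 :=
    hκl.comp_clm (ContinuousLinearMap.fst ℂ ℂ ℂ)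
  have dκ : ∀ᶠ Z in 𝓝 (0 : ℂ × ℂ), ∀ u, dirD u (fun Z : ℂ × ℂ => kappa Φ (l * Z.1)) Z =
      u.1 * deriv (fun s => kappa Φ (l * s)) Z.1 := by
    have ht : Tendsto (fun Z : ℂ × ℂ => Z.1) (𝓝 0) (𝓝 0) := continuous_fst.tendsto' 0 0 rfl
    filter_upwards [ht.eventually hκl.eventually_analyticAt] with Z hZ u
    have := dirD_comp_clm (ContinuousLinearMap.fst ℂ ℂ ℂ) (Φ := fun s => kappa Φ (l * s)) (v := Z)
      hZ.differentiableAt u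
    refine this.trans ?_
    have e : (ContinuousLinearMap.fst ℂ ℂ ℂ) u = u.1 • (1 : ℂ) := by simp
    rw [e, dirD_smul_dir]
    rfl
  have df : ∀ u, dirD u f =ᶠ[𝓝 0] fun _ => l * u.1 := fun u => by
    filter_upwards [EventuallyEq.dirD ef u] with Z hZ
    rw [hZ, dirD_const_mul differentiableAt_fst, dfst]
  have dg : ∀ u, dirD u g =ᶠ[𝓝 0] fun Z => ν * u.2 +
      c * (u.1 * deriv (fun s => kappa Φ (l * s)) Z.1) := fun u => by
    filter_upwards [EventuallyEq.dirD eg u, dκ, hκl2.eventually_analyticAt] with Z hZ a b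
    rw [hZ, dirD_add (by fun_prop) (b.differentiableAt.const_mul c),
      dirD_const_mul differentiableAt_snd, dirD_const_mul b.differentiableAt, dsnd, a]
  have n1 : dirD eη (fun v => Φ (polMap f g v)) =ᶠ[𝓝 0] fun v =>
      star ν * dirD eη Φ (polMap f g v) := by
    have ts : Tendsto (fun v : Pol => star v.2) (𝓝 0) (𝓝 0) :=
      (by fun_prop : Continuous fun v : Pol => star v.2).tendsto' 0 0 (by simp)
    have ts' : Tendsto (fun v : Pol => v.2) (𝓝 0) (𝓝 0) := continuous_snd.tendsto' 0 0 rfl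
    filter_upwards [eventually_dirD_polMap_anti hΦ hf hg hf0 hg0 (0, 1),
      ts'.eventually (dirD_conjFun hf (0, 1)), ts'.eventually (dirD_conjFun hg (0, 1)),
      ts.eventually (df (star (0, 1))), ts.eventually (dg (star (0, 1)))] with v a b c d e
    rw [a, b, c, conjFun, conjFun, d, e]
    simp
  -- Since κ'(0) = 0, the germ g has no linear term in z, so the w-derivative meets only the
  -- conjugate of f.
  have n2 : ∀ᶠ Z in 𝓝 0, dirD ew (dirD eη (fun v => Φ (polMap f g v))) (holSlice Z) =
      star ν * star l * dirD ew (dirD eη Φ) (holSlice (f Z, g Z)) := by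
    have d1 : star (dirD (star (1, 0)) f 0) = star l := by
      rw [(df _).self_of_nhds]; simp
    have d2 : star (dirD (star (1, 0)) g 0) = 0 := by
      rw [(dg _).self_of_nhds]; simp [k1]
    filter_upwards [eventually_comp_clm (n1.dirD ew) holSlice,
      eventually_comp_clm (dirD_const_mul_eventually ((hΦ.dirD eη).comp_polMap hf hg hf0 hg0)
        (star ν) ew) holSlice,
      eventually_dirD_polMap_holSlice (hΦ.dirD eη) hf hg hf0 hg0 (1, 0)] with Z a b c
    rw [a, b, c, d1, d2]
    ring
  -- On the z-axis the image curve is s ↦ (l s, c κ(l s)), with γ''(0) = c l². The third derivative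
  -- therefore gains 3 c l² · l · Φ_zζwη(0).
  have n3 : (fun s : ℂ => dirD ew (dirD eη (fun v => Φ (polMap f g v))) (s • ez)) =ᶠ[𝓝 0]
      fun s => star ν * star l * dirD ew (dirD eη Φ)
        (jetCurve (l • ez) eζ (fun s => c * kappa Φ (l * s)) s) + 0 * s := by
    filter_upwards [tendsto_pair_left.eventually n2, tendsto_pair_left.eventually ef,
      tendsto_pair_left.eventually eg] with s a b c
    have e1 : (s • ez : Pol) = holSlice (s, 0) := by simp [holSlice_apply]
    rw [e1, a, b, c]
    simp [holSlice_apply, jetCurve, mul_comm]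
  have hN := hΦ.comp_polMap hf hg hf0 hg0
  have hM := (hΦ.dirD eη).dirD ew
  have hγ : AnalyticAt ℂ (fun s => c * kappa Φ (l * s)) 0 := analyticAt_const.mul hκl
  obtain ⟨g1, g2, g3⟩ := jet_linear_combination hκl analyticAt_id c 0
  simp only [zero_mul, add_zero, k1, k2, mul_zero] at g1 g2
  have γ0 : (fun s => c * kappa Φ (l * s)) 0 = 0 := by simp [h.kappa_zero]
  have J := (jet_comp_jetCurve hM hγ γ0 g1 (l • ez) eζ).2.2
  have L := (jet_linear_combination (hM.comp_jetCurve hγ γ0 (l • ez) eζ) analyticAt_id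
    (star ν * star l) 0).2.2
  have s1 : ∀ Ψ : Pol → ℂ, dirD (l • ez) Ψ = fun v => l * dirD ez Ψ v :=
    fun Ψ => funext fun v => dirD_smul_dir l ez Ψ v
  have s2 : dirD ez (dirD (l • ez) (dirD ew (dirD eη Φ))) =ᶠ[𝓝 0]
      fun v => l * dirD ez (dirD ez (dirD ew (dirD eη Φ))) v := by
    rw [s1]
    exact dirD_const_mul_eventually (hM.dirD ez) _ _
  have s3 : dirD (l • ez) (dirD (l • ez) (dirD (l • ez) (dirD ew (dirD eη Φ)))) 0 =
      l ^ 3 * sporadicFive Φ := by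
    rw [dirD_smul_dir, s1 (dirD (l • ez) (dirD ew (dirD eη Φ))),
      dirD_const_mul ((hM.dirD (l • ez)).dirD ez).differentiableAt, s2.dirD_eq,
      dirD_const_mul ((hM.dirD ez).dirD ez).differentiableAt, sporadicFive]
    ring
  have T := (jet_comp_line ((hN.dirD eη).dirD ew) ez).2.2
  rw [n3.deriv.deriv.deriv_eq] at T
  rw [sporadicFive, ← T]
  refine L.trans ?_
  rw [J, g2, s3, dirD_smul_dir, h.dirD_zζwη_zero, h.dirD_ζwη_zero]
  ring

/-- The identity is compared on {W = 0} after applying ∂_w, ∂_η and ∂_w². The first two relations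
contain only f, and their jets in z make f linear; the third then solves for g. Vanishing of
`sporadicFour` on both sides is what excludes a quadratic term of f. -/
theorem Prenormal.map_eq (h : Prenormal Φ) (h' : Prenormal Φ') (h4 : sporadicFour Φ = 0)
    (h4' : sporadicFour Φ' = 0) (hf : AnalyticAt ℂ f 0) (hg : AnalyticAt ℂ g 0) (hf0 : f 0 = 0)
    (hg0 : g 0 = 0) {ρ : ℝ} (hρ : ρ ≠ 0)
    (he : (fun v => ρ * Φ v) =ᶠ[𝓝 0] fun v => Φ' (polMap f g v)) :
    ∃ l c : ℂ, l ≠ 0 ∧ (ρ : ℂ) = l * star l ∧ star c = -c ∧ (∀ᶠ Z in 𝓝 0, f Z = l * Z.1) ∧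
      ∀ᶠ Z in 𝓝 0, g Z = l / star l * Z.2 + c * kappa Φ' (l * Z.1) := by
  have hρ' : (ρ : ℂ) ≠ 0 := by exact_mod_cast hρ
  have hΦ := h.analytic
  have hΦ' := h'.analytic
  have tfg : Tendsto (fun Z => (f Z, g Z)) (𝓝 0) (𝓝 0) := by
    have := (hf.prod hg).continuousAt.tendsto
    rwa [hf0, hg0] at this
  have st1 : star ((1, 0) : ℂ × ℂ) = (1, 0) := by simp [Prod.star_def]
  have st2 : star ((0, 1) : ℂ × ℂ) = (0, 1) := by simp [Prod.star_def]
  set l := dirD (1, 0) f 0 with hl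
  set β := dirD (0, 1) f 0 with hβ
  set μ := dirD (1, 0) g 0 with hμ
  set ν := dirD (0, 1) g 0 with hν
  have e1 : ∀ᶠ Z in 𝓝 0, ρ * Z.1 = star l * f Z + star μ * kappa Φ' (f Z) := by
    filter_upwards [eventually_dirD_polMap_holSlice hΦ' hf hg hf0 hg0 (1, 0),
      eventually_comp_clm (dirD_const_mul_eventually hΦ ρ ew) holSlice,
      eventually_comp_clm (he.dirD ew) holSlice,
      (show ∀ᶠ Z in 𝓝 0, dirD ew Φ (holSlice Z) = Z.1 from h.one),
      (show ∀ᶠ Z in 𝓝 0, dirD ew Φ' (holSlice (f Z, g Z)) = f Z from tfg.eventually h'.one),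
      tfg.eventually h'.dirD_η_holSlice] with Z a b c d e f
    rw [← d, ← b, c, a, f, e, st1]
  have e2 : ∀ᶠ Z in 𝓝 0, ρ * kappa Φ Z.1 = star β * f Z + star ν * kappa Φ' (f Z) := by
    filter_upwards [eventually_dirD_polMap_holSlice hΦ' hf hg hf0 hg0 (0, 1),
      eventually_comp_clm (dirD_const_mul_eventually hΦ ρ eη) holSlice,
      eventually_comp_clm (he.dirD eη) holSlice, h.dirD_η_holSlice,
      (show ∀ᶠ Z in 𝓝 0, dirD ew Φ' (holSlice (f Z, g Z)) = f Z from tfg.eventually h'.one),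
      tfg.eventually h'.dirD_η_holSlice] with Z a b c d e f
    rw [← d, ← b, c, a, f, e, st2]
  have hφ : AnalyticAt ℂ (fun s : ℂ => f (s • (1, 0))) 0 :=
    AnalyticAt.comp (g := f) (by simpa using hf) (analyticAt_id.smul analyticAt_const)
  have hid : AnalyticAt ℂ (fun s : ℂ => s) 0 := analyticAt_id
  obtain ⟨p1, p2, -⟩ := jet_comp_line hf (1, 0)
  obtain ⟨i1, i2, i3⟩ := jet_id
  -- Write f(s, 0) = l s + γ(s) with γ of order two, the shape required by `jet_kappa_comp`.
  obtain ⟨γ1, γ2, -⟩ := jet_linear_combination hφ hid 1 (-l)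
  rw [p1, i1, ← hl] at γ1
  rw [p2, i2] at γ2
  have hγ : AnalyticAt ℂ (fun s : ℂ => 1 * f (s • (1, 0)) + -l * s) 0 :=
    (analyticAt_const.mul hφ).add (analyticAt_const.mul hid)
  obtain ⟨K1, K2, K3⟩ := h'.jet_kappa_comp hγ (by simp [hf0]) (by rw [γ1]; ring) l
  have eK : (fun s : ℂ => kappa Φ' (l * s + (1 * f (s • (1, 0)) + -l * s))) =
      fun s => kappa Φ' (f (s • (1, 0))) := by
    funext s; congr 1; ring
  rw [eK] at K1 K2 K3
  rw [γ2] at K3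
  have hK : AnalyticAt ℂ (fun s : ℂ => kappa Φ' (f (s • (1, 0)))) 0 :=
    AnalyticAt.comp (g := kappa Φ') (by simpa [hf0] using analyticAt_kappa hΦ') hφ
  obtain ⟨a1, a2, -⟩ := jet_linear_combination hφ hK (star l) (star μ)
  obtain ⟨b1, b2, b3⟩ := jet_linear_combination hφ hK (star β) (star ν)
  obtain ⟨c1, c2, -⟩ := jet_linear_combination hid hid ρ 0
  obtain ⟨d1, d2, d3⟩ := jet_linear_combination (analyticAt_kappa hΦ) hid ρ 0
  obtain ⟨k1, k2, k3⟩ := h.jet_kappa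
  have hs : ∀ s : ℂ, s • ((1, 0) : ℂ × ℂ) = (s, 0) := fun s => by simp
  have E1 : (fun s : ℂ => (ρ : ℂ) * s + 0 * s) =ᶠ[𝓝 0] fun s =>
      star l * f (s • (1, 0)) + star μ * kappa Φ' (f (s • (1, 0))) := by
    filter_upwards [tendsto_pair_left.eventually e1] with s hs'
    rw [hs, ← hs']
    ring
  have E2 : (fun s : ℂ => (ρ : ℂ) * kappa Φ s + 0 * s) =ᶠ[𝓝 0] fun s =>
      star β * f (s • (1, 0)) + star ν * kappa Φ' (f (s • (1, 0))) := by
    filter_upwards [tendsto_pair_left.eventually e2] with s hs'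
    rw [hs, ← hs']
    ring
  rw [E1.deriv_eq, a1, p1, K1, i1, ← hl] at c1
  rw [E1.deriv.deriv_eq, a2, p2, K2, i2] at c2
  rw [E2.deriv_eq, b1, p1, K1, i1, k1, ← hl] at d1
  rw [E2.deriv.deriv_eq, b2, p2, K2, i2, k2] at d2
  rw [E2.deriv.deriv.deriv_eq, b3, K3, i3, k3, h4, h4'] at d3
  -- Order one of E1 gives ρ = l l̄. Orders one, two and three of E2 give in turn β = 0, ν ≠ 0 and
  -- f_zz(0) = 0; order two of E1 then gives μ = 0.
  have hρl : (ρ : ℂ) = l * star l := by linear_combination -c1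
  have hl0 : l ≠ 0 := fun h0 => hρ' (by rw [hρl, h0, zero_mul])
  have hsl0 : star l ≠ 0 := star_ne_zero.2 hl0
  have hβ0 : star β = 0 := by
    have : star β * l = 0 := by linear_combination d1
    exact (mul_eq_zero.1 this).resolve_right hl0
  have hν0 : star ν ≠ 0 := fun h0 => hρ' (by rw [hβ0, h0] at d2; linear_combination -d2)
  have hf2 : dirD (1, 0) (dirD (1, 0) f) 0 = 0 := by
    have : star ν * l * dirD (1, 0) (dirD (1, 0) f) 0 = 0 := by
      rw [hβ0] at d3
      linear_combination d3 / 3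
    exact (mul_eq_zero.1 this).resolve_left (mul_ne_zero hν0 hl0)
  have hμ0 : star μ = 0 := by
    have : star μ * l ^ 2 = 0 := by rw [hf2] at c2; linear_combination c2
    exact (mul_eq_zero.1 this).resolve_right (pow_ne_zero 2 hl0)
  have ef : ∀ᶠ Z in 𝓝 0, f Z = l * Z.1 := by
    filter_upwards [e1] with Z hZ
    rw [hμ0, hρl] at hZ
    apply mul_left_cancel₀ hsl0
    linear_combination -hZ
  set τ := dirD (1, 0) (dirD (1, 0) g) 0 with hτ
  -- With μ = 0 and f_zz(0) = 0, the ∂_w² relation is ρ ζ = l̄² g + τ̄ κ(l z), where κ belongs to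
  -- Φ'.
  have eg : ∀ᶠ Z in 𝓝 0, g Z = l / star l * Z.2 + -(star τ / star l ^ 2) * kappa Φ' (l * Z.1) := by
    filter_upwards [eventually_dirD_dirD_polMap_holSlice hΦ' hf hg hf0 hg0 (1, 0),
      eventually_comp_clm (((dirD_const_mul_eventually hΦ ρ ew).dirD ew).trans
        (dirD_const_mul_eventually (hΦ.dirD ew) ρ ew)) holSlice,
      eventually_comp_clm ((he.dirD ew).dirD ew) holSlice,
      (show ∀ᶠ Z in 𝓝 0, dirD ew (dirD ew Φ) (holSlice Z) = Z.2 from h.two),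
      (show ∀ᶠ Z in 𝓝 0, dirD ew (dirD ew Φ') (holSlice (f Z, g Z)) = g Z from
        tfg.eventually h'.two),
      (show ∀ᶠ Z in 𝓝 0, dirD eη Φ' (holSlice (f Z, g Z)) = kappa Φ' (f Z) from
        tfg.eventually h'.dirD_η_holSlice), ef] with Z a b c d e f k
    rw [st1, ← hl, ← hμ, ← hτ, hf2, hμ0, e, f, k, star_zero] at a
    rw [c, a, d, hρl] at b
    have u1 : star l ^ 2 * (l / star l) = l * star l := by field_simp
    have u2 : star l ^ 2 * (star τ / star l ^ 2) = star τ := mul_div_cancel₀ _ (pow_ne_zero 2 hsl0)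
    apply mul_left_cancel₀ (pow_ne_zero 2 hsl0)
    linear_combination b - Z.2 * u1 + kappa Φ' (l * Z.1) * u2
  -- The second z-derivative of the formula for g at 0, with κ''(0) = 1. As τ occurs on both sides,
  -- c = τ / l² equals -τ̄ / l̄², so c is imaginary.
  have hτc : τ = -(star τ / star l ^ 2) * l ^ 2 := by
    have hκl : AnalyticAt ℂ (fun s => kappa Φ' (l * s)) 0 :=
      AnalyticAt.comp (g := kappa Φ') (by simpa using analyticAt_kappa hΦ')
        (analyticAt_const.mul analyticAt_id)
    have k2 := (h'.jet_kappa_comp (γ := fun _ => 0) analyticAt_const rfl (by simp) l).2.1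
    simp only [add_zero] at k2
    have E3 : (fun s : ℂ => g (s • (1, 0))) =ᶠ[𝓝 0] fun s =>
        -(star τ / star l ^ 2) * kappa Φ' (l * s) + 0 * s := by
      filter_upwards [tendsto_pair_left.eventually eg] with s hs'
      rw [hs, hs']
      ring
    have q := (jet_comp_line hg (1, 0)).2.1
    rw [E3.deriv.deriv_eq, (jet_linear_combination hκl hid _ 0).2.1, k2, i2, ← hτ] at q
    linear_combination -q
  have u : τ / l ^ 2 = -(star τ / star l ^ 2) := by
    rw [div_eq_iff (pow_ne_zero 2 hl0)]
    exact hτc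
  refine ⟨l, _, hl0, hρl, ?_, ef, eg⟩
  rw [star_neg, star_div₀, star_star, star_pow, star_star, u]

end Rigidity

/-! ### Rigid equivalence, the polarized identity and rotations -/

section Equivalence

variable {F F' : ℂ × ℂ → ℝ}

/-- It suffices to evaluate the equivalence at the points (z, ζ, F(z, ζ)), where v = 0. -/
theorem RigidlyEquivalent.exists_identity
    (h : RigidlyEquivalent (rigidHypersurface F) (rigidHypersurface F')) (hF : ContinuousAt F 0)
    (hF0 : F 0 = 0) : ∃ (f g h : ℂ × ℂ → ℂ) (ρ : ℝ), AnalyticAt ℂ f 0 ∧ AnalyticAt ℂ g 0 ∧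
      AnalyticAt ℂ h 0 ∧ f 0 = 0 ∧ g 0 = 0 ∧ h 0 = 0 ∧ ρ ≠ 0 ∧
      ∀ᶠ p in 𝓝 0, ρ * F p + (h p).re = F' (f p, g p) := by
  obtain ⟨H, ⟨f, g, h, ρ, hf, hg, hh, hf0, hg0, hh0, hρ, -, hH⟩, he⟩ := h
  refine ⟨f, g, h, ρ, hf, hg, hh, hf0, hg0, hh0, hρ, ?_⟩
  have ht : Tendsto (fun p : ℂ × ℂ => (p.1, p.2, (F p : ℂ))) (𝓝 0) (𝓝 0) := by
    have : ContinuousAt (fun p : ℂ × ℂ => (p.1, p.2, (F p : ℂ))) 0 :=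
      continuousAt_fst.prodMk (continuousAt_snd.prodMk (continuous_ofReal.continuousAt.comp hF))
    have h0 := this.tendsto
    rwa [hF0, ofReal_zero] at h0
  filter_upwards [ht.eventually he] with p hp
  have := hp.1 (by simp [rigidHypersurface])
  rw [hH] at this
  simpa [rigidHypersurface] using this

/-- Under the map the defect Re w - F is multiplied by ρ ≠ 0, so membership is preserved in both
directions. -/
theorem RigidlyEquivalent.of_identity {f g h : ℂ × ℂ → ℂ} {ρ : ℝ} (hf : AnalyticAt ℂ f 0)
    (hg : AnalyticAt ℂ g 0) (hh : AnalyticAt ℂ h 0) (hf0 : f 0 = 0) (hg0 : g 0 = 0) (hh0 : h 0 = 0)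
    (hρ : ρ ≠ 0)
    (hj : dirD (1, 0) f 0 * dirD (0, 1) g 0 - dirD (0, 1) f 0 * dirD (1, 0) g 0 ≠ 0)
    (he : ∀ᶠ p in 𝓝 0, ρ * F p + (h p).re = F' (f p, g p)) :
    RigidlyEquivalent (rigidHypersurface F) (rigidHypersurface F') := by
  refine ⟨fun P => (f (P.1, P.2.1), g (P.1, P.2.1), ρ * P.2.2 + h (P.1, P.2.1)),
    ⟨f, g, h, ρ, hf, hg, hh, hf0, hg0, hh0, hρ, hj, fun _ _ _ => rfl⟩, ?_⟩
  have ht : Tendsto (fun P : ℂ × ℂ × ℂ => (P.1, P.2.1)) (𝓝 0) (𝓝 0) :=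
    (by fun_prop : Continuous fun P : ℂ × ℂ × ℂ => (P.1, P.2.1)).tendsto' 0 0 rfl
  filter_upwards [ht.eventually he] with P hP
  simp only [rigidHypersurface, Set.mem_ofPred_eq, add_re, re_ofReal_mul]
  rw [← hP, add_left_inj, mul_right_inj' hρ]

theorem RigidlyEquivalent.trans {M M' M'' : Set (ℂ × ℂ × ℂ)} (h : RigidlyEquivalent M M')
    (h' : RigidlyEquivalent M' M'') : RigidlyEquivalent M M'' := by
  obtain ⟨H, ⟨f, g, h, ρ, hf, hg, hh, hf0, hg0, hh0, hρ, hj, hH⟩, he⟩ := h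
  obtain ⟨H', ⟨f', g', h', ρ', hf', hg', hh', hf0', hg0', hh0', hρ', hj', hH'⟩, he'⟩ := h'
  have hφ : AnalyticAt ℂ (fun p => (f p, g p)) 0 := hf.prod hg
  have comp : ∀ {k : ℂ × ℂ → ℂ}, AnalyticAt ℂ k 0 → AnalyticAt ℂ (fun p => k (f p, g p)) 0 :=
    fun {k} hk => AnalyticAt.comp (g := k) (by rwa [hf0, hg0]) hφ
  have dcomp : ∀ {k : ℂ × ℂ → ℂ}, AnalyticAt ℂ k 0 → ∀ u, fderiv ℂ (fun p => k (f p, g p)) 0 u =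
      fderiv ℂ f 0 u * fderiv ℂ k 0 (1, 0) + fderiv ℂ g 0 u * fderiv ℂ k 0 (0, 1) := by
    intro k hk u
    have hk' : DifferentiableAt ℂ k (f 0, g 0) := by
      rw [hf0, hg0]; exact hk.differentiableAt
    have := (hk'.hasFDerivAt.comp (0 : ℂ × ℂ) (f := fun p => (f p, g p))
      (hf.differentiableAt.hasFDerivAt.prodMk hg.differentiableAt.hasFDerivAt)).fderiv
    rw [show (fun p => k (f p, g p)) = k ∘ fun p => (f p, g p) from rfl, this, hf0, hg0]
    have e : ∀ x y : ℂ, ((x, y) : ℂ × ℂ) = x • (1, 0) + y • (0, 1) := fun x y => by simp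
    rw [ContinuousLinearMap.comp_apply, ContinuousLinearMap.prod_apply, e (fderiv ℂ f 0 u),
      map_add, map_smul, map_smul]
    rfl
  refine ⟨H' ∘ H, ⟨fun p => f' (f p, g p), fun p => g' (f p, g p),
    fun p => ρ' * h p + h' (f p, g p), ρ' * ρ, comp hf', comp hg',
    (analyticAt_const.mul hh).add (comp hh'), ?_, ?_, ?_, mul_ne_zero hρ' hρ, ?_, ?_⟩, ?_⟩
  · beta_reduce; rw [hf0, hg0]; exact hf0'
  · beta_reduce; rw [hf0, hg0]; exact hg0'
  · beta_reduce; rw [hf0, hg0, hh0, mul_zero, zero_add]; exact hh0'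
  · rw [dcomp hf', dcomp hf', dcomp hg', dcomp hg']
    convert mul_ne_zero hj hj' using 1
    ring
  · intro z ζ w
    rw [Function.comp_apply, hH, hH']
    congr 2
    push_cast
    ring
  · have ht : Tendsto H (𝓝 0) (𝓝 0) := by
      have e : H = fun P : ℂ × ℂ × ℂ =>
          (f (P.1, P.2.1), g (P.1, P.2.1), (ρ : ℂ) * P.2.2 + h (P.1, P.2.1)) :=
        funext fun P => hH P.1 P.2.1 P.2.2
      have hc : ∀ {k : ℂ × ℂ → ℂ}, AnalyticAt ℂ k 0 → k 0 = 0 →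
          Tendsto (fun P : ℂ × ℂ × ℂ => k (P.1, P.2.1)) (𝓝 0) (𝓝 0) := by
        intro k hk hk0
        have ht : Tendsto (fun P : ℂ × ℂ × ℂ => (P.1, P.2.1)) (𝓝 0) (𝓝 0) :=
          (by fun_prop : Continuous fun P : ℂ × ℂ × ℂ => (P.1, P.2.1)).tendsto' 0 0 rfl
        have := hk.continuousAt.tendsto.comp ht
        rwa [hk0] at this
      have hw : Tendsto (fun P : ℂ × ℂ × ℂ => (ρ : ℂ) * P.2.2) (𝓝 0) (𝓝 0) :=
        (by fun_prop : Continuous fun P : ℂ × ℂ × ℂ => (ρ : ℂ) * P.2.2).tendsto' 0 0 (by simp)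
      rw [e]
      have := (hc hf hf0).prodMk_nhds ((hc hg hg0).prodMk_nhds (hw.add (hc hh hh0)))
      rwa [add_zero] at this
    filter_upwards [he, ht.eventually he'] with P h1 h2
    exact h1.trans h2

/-- The polarization of Re h is (h(Z) + h̄(W)) / 2, and both sides are holomorphic. -/
theorem IsPolarization.identity {Φ Φ' : Pol → ℂ} (hΦ : IsPolarization Φ F)
    (hΦ' : IsPolarization Φ' F') {f g h : ℂ × ℂ → ℂ} {ρ : ℝ} (hf : AnalyticAt ℂ f 0)
    (hg : AnalyticAt ℂ g 0) (hh : AnalyticAt ℂ h 0) (hf0 : f 0 = 0) (hg0 : g 0 = 0)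
    (he : ∀ᶠ p in 𝓝 0, ρ * F p + (h p).re = F' (f p, g p)) :
    ∀ᶠ v in 𝓝 0, ρ * Φ v + (h v.1 + conjFun h v.2) / 2 = Φ' (polMap f g v) := by
  refine eventuallyEq_of_polDiag ?_ (hΦ'.analytic.comp_polMap hf hg hf0 hg0) ?_
  · exact (analyticAt_const.mul hΦ.analytic).add
      (((analyticAt_fst_comp hh).add (analyticAt_snd_comp (analyticAt_conjFun hh))).div_const)
  · have tfg : Tendsto (fun Z => (f Z, g Z)) (𝓝 0) (𝓝 0) := by
      have := (hf.prod hg).continuousAt.tendsto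
      rwa [hf0, hg0] at this
    filter_upwards [he, hΦ.eq, tfg.eventually hΦ'.eq] with p h1 h2 h3
    rw [polMap_polDiag, h2, h3, ← h1]
    push_cast
    rw [re_eq_add_conj]
    simp [polDiag, conjFun]

/-- The factor l / l̄ is unimodular, so the denominator is invariant; each term of the numerator
acquires l l̄. -/
theorem gmModel_rotate {l : ℂ} (hl : l ≠ 0) (z ζ : ℂ) :
    gmModel (l * z) (l / star l * ζ) = l * star l * gmModel z ζ := by
  have hl' : star l ≠ 0 := star_ne_zero.2 hl
  have e : 1 - l / star l * ζ * star (l / star l * ζ) = 1 - ζ * star ζ := by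
    rw [star_mul', star_div₀, star_star]
    field_simp
  rw [gmModel, gmModel, e, ← mul_div_assoc]
  congr 1
  rw [star_mul', star_mul', star_div₀, star_star]
  field_simp

theorem IsNormalForm.expansion_rotate {G : ℕ → ℕ → ℕ → ℕ → ℂ} (h : IsNormalForm F G) {l : ℂ}
    (hl : l ≠ 0) : HasExpansion
      (fun p => (F (l * p.1, l / star l * p.2) : ℂ) - l * star l * gmModel p.1 p.2)
      (fun a b c d => G a b c d * (l ^ a * (l / star l) ^ b * star l ^ c * (star l / l) ^ d)) := by
  have ht : Tendsto (fun p : ℂ × ℂ => (l * p.1, l / star l * p.2)) (𝓝 0) (𝓝 0) :=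
    (by fun_prop : Continuous fun p : ℂ × ℂ => (l * p.1, l / star l * p.2)).tendsto' 0 0 (by simp)
  filter_upwards [ht.eventually h.expansion] with p hp
  rw [gmModel_rotate hl] at hp
  refine hp.congr_arg fun n => ?_
  simp only [mul_pow, star_mul', star_div₀, star_star]
  ring

/-- The modulus of l enters only through z and z̄, as √ρ ^ (a + c); splitting off one factor ρ
leaves the exponent (a + c - 2) / 2. The quotient l / l̄ is the phase of angle 2φ. -/
theorem rotate_coefficient {ρ : ℝ} (hρ : 0 < ρ) (φ : ℝ) (a b c d : ℕ) {l : ℂ}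
    (hl : l = (√ρ : ℝ) * Complex.exp (I * φ)) :
    l ^ a * (l / star l) ^ b * star l ^ c * (star l / l) ^ d =
      ρ * ((ρ ^ (((a : ℝ) + (c : ℝ) - 2) / 2) : ℝ) *
        Complex.exp (I * (φ : ℂ) * ((a : ℂ) + 2 * (b : ℂ) - (c : ℂ) - 2 * (d : ℂ)))) := by
  have hr : (√ρ : ℝ) ≠ 0 := (Real.sqrt_pos.2 hρ).ne'
  have hr' : ((√ρ : ℝ) : ℂ) ≠ 0 := by exact_mod_cast hr
  have hs : star l = (√ρ : ℝ) * Complex.exp (-(I * φ)) := by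
    rw [hl, star_mul', star_def, conj_ofReal, ← Complex.exp_conj]
    simp
  have h1 : l / star l = Complex.exp (2 * (I * φ)) := by
    rw [hs, hl, mul_div_mul_left _ _ hr', ← Complex.exp_sub]
    ring_nf
  have h2 : star l / l = Complex.exp (-(2 * (I * φ))) := by
    rw [hs, hl, mul_div_mul_left _ _ hr', ← Complex.exp_sub]
    ring_nf
  have h3 : ρ * ρ ^ (((a : ℝ) + (c : ℝ) - 2) / 2) = √ρ ^ (a + c) := by
    rw [Real.sqrt_eq_rpow, ← Real.rpow_natCast, ← Real.rpow_mul hρ.le]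
    nth_rw 1 [← Real.rpow_one ρ]
    rw [← Real.rpow_add hρ]
    congr 1
    push_cast
    ring
  rw [h1, h2, hs, hl, ← mul_assoc (ρ : ℂ), ← ofReal_mul, h3, mul_pow, mul_pow, ← Complex.exp_nat_mul,
    ← Complex.exp_nat_mul, ← Complex.exp_nat_mul, ← Complex.exp_nat_mul]
  have e : I * (φ : ℂ) * ((a : ℂ) + 2 * (b : ℂ) - (c : ℂ) - 2 * (d : ℂ)) =
      a * (I * φ) + b * (2 * (I * φ)) + c * (-(I * φ)) + d * (-(2 * (I * φ))) := by ring
  rw [e, Complex.exp_add, Complex.exp_add, Complex.exp_add]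
  push_cast
  ring

variable {G G' : ℕ → ℕ → ℕ → ℕ → ℂ}

theorem RigidlyEquivalent.of_coefficients (hG : IsNormalForm F G) (hG' : IsNormalForm F' G')
    {ρ φ : ℝ} (hρ : 0 < ρ) (h : ∀ a b c d : ℕ, G a b c d =
      G' a b c d * (ρ ^ (((a : ℝ) + (c : ℝ) - 2) / 2) : ℝ) *
        Complex.exp (I * (φ : ℂ) * ((a : ℂ) + 2 * (b : ℂ) - (c : ℂ) - 2 * (d : ℂ)))) :
    RigidlyEquivalent (rigidHypersurface F) (rigidHypersurface F') := by
  set l : ℂ := (√ρ : ℝ) * Complex.exp (I * φ) with hl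
  have hl0 : l ≠ 0 := mul_ne_zero (by exact_mod_cast (Real.sqrt_pos.2 hρ).ne') (Complex.exp_ne_zero _)
  have hl0' : star l ≠ 0 := star_ne_zero.2 hl0
  have hll : l * star l = ρ := by
    have := rotate_coefficient hρ φ 1 0 1 0 hl
    norm_num at this
    simpa using this
  refine .of_identity (f := fun p => l * p.1) (g := fun p => l / star l * p.2) (h := fun _ => 0)
    (ρ := ρ) (analyticAt_const.mul analyticAt_fst) (analyticAt_const.mul analyticAt_snd)
    analyticAt_const (by simp) (by simp) rfl hρ.ne' ?_ ?_
  · have dfst : ∀ u Z : ℂ × ℂ, dirD u (fun Z : ℂ × ℂ => Z.1) Z = u.1 := fun u Z =>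
      dirD_clm (ContinuousLinearMap.fst ℂ ℂ ℂ) Z u
    have dsnd : ∀ u Z : ℂ × ℂ, dirD u (fun Z : ℂ × ℂ => Z.2) Z = u.2 := fun u Z =>
      dirD_clm (ContinuousLinearMap.snd ℂ ℂ ℂ) Z u
    rw [dirD_const_mul differentiableAt_fst, dirD_const_mul differentiableAt_snd,
      dirD_const_mul differentiableAt_fst, dirD_const_mul differentiableAt_snd, dfst, dfst, dsnd, dsnd]
    simp [hl0]
  · filter_upwards [hG.expansion, hG'.expansion_rotate hl0] with p h1 h2
    have h3 := h2.unique ((h1.mul_left (ρ : ℂ)).congr_arg fun n => by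
      rw [h, rotate_coefficient hρ φ _ _ _ _ hl]; ring)
    rw [hll] at h3
    have h4 : ((ρ * F p : ℝ) : ℂ) = F' (l * p.1, l / star l * p.2) := by
      push_cast
      linear_combination -h3
    simpa using ofReal_injective h4

theorem sporadicFive_congr {Φ Φ' : Pol → ℂ} (h : Φ =ᶠ[𝓝 0] Φ') :
    sporadicFive Φ = sporadicFive Φ' :=
  ((((h.dirD eη).dirD ew).dirD ez).dirD ez).dirD_eq ez

theorem sporadicFive_const_mul {Φ : Pol → ℂ} (h : AnalyticAt ℂ Φ 0) (c : ℂ) :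
    sporadicFive (fun v => c * Φ v) = c * sporadicFive Φ := by
  have h1 := dirD_const_mul_eventually h c eη
  have h2 := (h1.dirD ew).trans (dirD_const_mul_eventually (h.dirD eη) c ew)
  have h3 := (h2.dirD ez).trans (dirD_const_mul_eventually ((h.dirD eη).dirD ew) c ez)
  have h4 := (h3.dirD ez).trans (dirD_const_mul_eventually (((h.dirD eη).dirD ew).dirD ez) c ez)
  exact ((h4.dirD ez).trans
    (dirD_const_mul_eventually ((((h.dirD eη).dirD ew).dirD ez).dirD ez) c ez)).self_of_nhds

/-- `Prenormal.map_eq` leaves only l and an imaginary c, and reality of `sporadicFive` on both sides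
removes c. The argument of l then serves as φ. -/
theorem IsNormalForm.coefficients_of_equivalent (hF : InClassC21 F) (hF' : InClassC21 F')
    (hG : IsNormalForm F G) (hG' : IsNormalForm F' G')
    (h : RigidlyEquivalent (rigidHypersurface F) (rigidHypersurface F')) :
    ∃ ρ φ : ℝ, 0 < ρ ∧ ∀ a b c d : ℕ, G a b c d =
      G' a b c d * (ρ ^ (((a : ℝ) + (c : ℝ) - 2) / 2) : ℝ) *
        Complex.exp (I * (φ : ℂ) * ((a : ℂ) + 2 * (b : ℂ) - (c : ℂ) - 2 * (d : ℂ))) := by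
  obtain ⟨Φ, hΦ⟩ := hF.exists_polarization
  obtain ⟨Φ', hΦ'⟩ := hF'.exists_polarization
  obtain ⟨n, n4, n5⟩ := hG.prenormal hF hΦ
  obtain ⟨n', n4', n5'⟩ := hG'.prenormal hF' hΦ'
  obtain ⟨f, g, h, ρ, hf, hg, hh, hf0, hg0, hh0, hρ, he⟩ :=
    h.exists_identity hF.analytic.continuousAt hF.through_origin
  have hi := hΦ.identity hΦ' hf hg hh hf0 hg0 he
  have tfg : Tendsto (fun Z => (f Z, g Z)) (𝓝 0) (𝓝 0) := by
    have := (hf.prod hg).continuousAt.tendsto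
    rwa [hf0, hg0] at this
  -- At W = 0 both defining functions vanish, and so does the conjugate germ of h.
  have hhz : ∀ᶠ Z in 𝓝 0, h Z = 0 := by
    filter_upwards [eventually_comp_clm hi holSlice,
      (show ∀ᶠ Z in 𝓝 0, Φ (holSlice Z) = 0 from n.zero),
      (show ∀ᶠ Z in 𝓝 0, Φ' (holSlice (f Z, g Z)) = 0 from tfg.eventually n'.zero)] with Z a b c
    rw [polMap_holSlice hf0 hg0, b, c] at a
    have hc : conjFun h (holSlice Z).2 = 0 := conjFun_zero hh0
    rw [hc] at a
    change (ρ : ℂ) * 0 + (h Z + 0) / 2 = 0 at a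
    linear_combination 2 * a
  have he' : ∀ᶠ p in 𝓝 0, ρ * F p = F' (f p, g p) := by
    filter_upwards [he, hhz] with p a b
    rw [← a, b]
    simp
  have hi' : (fun v => ρ * Φ v) =ᶠ[𝓝 0] fun v => Φ' (polMap f g v) := by
    have := hΦ.identity hΦ' (h := fun _ => 0) hf hg analyticAt_const hf0 hg0 (by simpa using he')
    filter_upwards [this] with v hv
    simpa [conjFun] using hv
  obtain ⟨l, c, hl0, hρl, hc, ef, eg⟩ := n.map_eq n' n4 n4' hf hg hf0 hg0 hρ hi'
  have hsl0 : star l ≠ 0 := star_ne_zero.2 hl0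
  have hρ0 : (ρ : ℂ) ≠ 0 := by exact_mod_cast hρ
  have h5 := n'.sporadicFive_comp hf hg ef eg
  rw [← sporadicFive_congr hi', sporadicFive_const_mul hΦ.analytic, star_div₀, star_star] at h5
  -- The conjugate of l / l̄ times l̄ l³ is (l l̄)² = ρ²; one factor ρ cancels against the left
  -- side.
  have h5' : sporadicFive Φ = ρ * (sporadicFive Φ' + 3 * c) := by
    apply mul_left_cancel₀ hρ0
    rw [h5, hρl]
    field_simp
  have hcre : c.re = 0 := by
    have := congrArg re hc
    simp only [star_def, conj_re, neg_re] at this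
    linarith
  have hcim : c.im = 0 := by
    have := congrArg im h5'
    rw [im_ofReal_mul, n5] at this
    simp only [add_im, n5', zero_add] at this
    have h3 : (3 * c).im = 3 * c.im := by simp
    rw [h3] at this
    have := (mul_eq_zero.1 this.symm).resolve_left hρ
    linarith
  have hc0 : c = 0 := Complex.ext hcre hcim
  have hρn : ρ = ‖l‖ ^ 2 := by
    have : (ρ : ℂ) = ((‖l‖ ^ 2 : ℝ) : ℂ) := by
      rw [hρl, star_def, mul_conj, normSq_eq_norm_sq]
    exact_mod_cast this
  have hρpos : 0 < ρ := by rw [hρn]; positivity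
  have hla : l = (√ρ : ℝ) * Complex.exp (I * l.arg) := by
    rw [hρn, Real.sqrt_sq (norm_nonneg l), mul_comm I, norm_mul_exp_arg_mul_I]
  refine ⟨ρ, l.arg, hρpos, fun a b c d => ?_⟩
  -- The same function is expanded once through F and once through F'; uniqueness of coefficients
  -- compares the two.
  have hx : HasExpansion
      (fun p => (F' (l * p.1, l / star l * p.2) : ℂ) - l * star l * gmModel p.1 p.2)
      (fun a b c d => ρ * G a b c d) := by
    filter_upwards [hG.expansion, he', ef, eg] with p h1 h2 h3 h4
    rw [hc0, zero_mul, add_zero] at h4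
    rw [h3, h4] at h2
    rw [← h2, ← hρl]
    have := h1.mul_left (ρ : ℂ)
    push_cast
    rw [← mul_sub]
    exact this.congr_arg fun n => by ring
  have hu := congrFun (congrFun (congrFun (congrFun (hx.unique (hG'.expansion_rotate hl0)) a) b) c) d
  simp only [rotate_coefficient hρpos l.arg a b c d hla] at hu
  apply mul_left_cancel₀ hρ0
  rw [hu]
  ring

end Equivalence

/-! ### Coordinate changes of (z, ζ) and their inverse germs -/

section CoordinateChange

/-- `(F, G)` is the inverse germ of the biholomorphism germ `(f, g)` of `ℂ²` at the origin. -/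
structure IsInverseGerm (f g F G : ℂ × ℂ → ℂ) : Prop where
  analytic_f : AnalyticAt ℂ f 0
  analytic_g : AnalyticAt ℂ g 0
  analytic_F : AnalyticAt ℂ F 0
  analytic_G : AnalyticAt ℂ G 0
  f_zero : f 0 = 0
  g_zero : g 0 = 0
  F_zero : F 0 = 0
  G_zero : G 0 = 0
  jacobian : dirD (1, 0) f 0 * dirD (0, 1) g 0 - dirD (0, 1) f 0 * dirD (1, 0) g 0 ≠ 0
  left : ∀ᶠ p in 𝓝 0, (F (f p, g p), G (f p, g p)) = p
  right : ∀ᶠ p in 𝓝 0, (f (F p, G p), g (F p, G p)) = p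

theorem tendsto_pair {f g : ℂ × ℂ → ℂ} (hf : AnalyticAt ℂ f 0) (hg : AnalyticAt ℂ g 0)
    (hf0 : f 0 = 0) (hg0 : g 0 = 0) : Tendsto (fun Z => (f Z, g Z)) (𝓝 0) (𝓝 0) := by
  have := (hf.prod hg).continuousAt.tendsto
  rwa [hf0, hg0] at this

theorem exists_isInverseGerm {f g : ℂ × ℂ → ℂ} (hf : AnalyticAt ℂ f 0)
    (hg : AnalyticAt ℂ g 0) (hf0 : f 0 = 0) (hg0 : g 0 = 0)
    (hj : dirD (1, 0) f 0 * dirD (0, 1) g 0 - dirD (0, 1) f 0 * dirD (1, 0) g 0 ≠ 0) :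
    ∃ F G, IsInverseGerm f g F G := by
  have hφ : AnalyticAt ℂ (fun p => (f p, g p)) 0 := hf.prod hg
  let A : ℂ × ℂ →L[ℂ] ℂ × ℂ := (fderiv ℂ f 0).prod (fderiv ℂ g 0)
  have hA : HasFDerivAt (fun p => (f p, g p)) A 0 :=
    hf.differentiableAt.hasFDerivAt.prodMk hg.differentiableAt.hasFDerivAt
  have hinj : Function.Injective (A : ℂ × ℂ →ₗ[ℂ] ℂ × ℂ) := by
    rw [injective_iff_map_eq_zero]
    rintro ⟨x, y⟩ hxy
    have e : ((x, y) : ℂ × ℂ) = x • (1, 0) + y • (0, 1) := by simp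
    have h1 : x * dirD (1, 0) f 0 + y * dirD (0, 1) f 0 = 0 := by
      have := congrArg Prod.fst hxy
      rw [e, map_add, map_smul, map_smul] at this
      exact this
    have h2 : x * dirD (1, 0) g 0 + y * dirD (0, 1) g 0 = 0 := by
      have := congrArg Prod.snd hxy
      rw [e, map_add, map_smul, map_smul] at this
      exact this
    have hx : x = 0 := (mul_eq_zero.1 (show x * (dirD (1, 0) f 0 * dirD (0, 1) g 0 -
      dirD (0, 1) f 0 * dirD (1, 0) g 0) = 0 by
        linear_combination dirD (0, 1) g 0 * h1 - dirD (0, 1) f 0 * h2)).resolve_right hj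
    have hy : y = 0 := (mul_eq_zero.1 (show y * (dirD (1, 0) f 0 * dirD (0, 1) g 0 -
      dirD (0, 1) f 0 * dirD (1, 0) g 0) = 0 by
        linear_combination dirD (1, 0) f 0 * h2 - dirD (1, 0) g 0 * h1)).resolve_right hj
    rw [hx, hy]
    rfl
  let e : (ℂ × ℂ) ≃L[ℂ] ℂ × ℂ :=
    (LinearEquiv.ofInjectiveEndo (A : ℂ × ℂ →ₗ[ℂ] ℂ × ℂ) hinj).toContinuousLinearEquiv
  have he : HasFDerivAt (fun p => (f p, g p)) (e : ℂ × ℂ →L[ℂ] ℂ × ℂ) 0 := by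
    have : (e : ℂ × ℂ →L[ℂ] ℂ × ℂ) = A := ContinuousLinearMap.ext fun x => rfl
    rwa [this]
  -- The exponent ⊤ stands for analyticity, so the inverse function theorem yields an analytic local
  -- inverse.
  have hc : ContDiffAt ℂ ⊤ (fun p => (f p, g p)) 0 := hφ.contDiffAt
  have hs := hc.hasStrictFDerivAt' he (by simp)
  have h0 : (f 0, g 0) = (0 : ℂ × ℂ) := by rw [hf0, hg0]; rfl
  have hi : AnalyticAt ℂ (hc.localInverse he (by simp)) 0 := by
    have := (hc.to_localInverse he (by simp)).analyticAt
    rwa [h0] at this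
  have hi0 : hc.localInverse he (by simp) 0 = 0 := by
    have := hc.localInverse_apply_image he (by simp)
    rwa [h0] at this
  have hl := hs.eventually_left_inverse
  have hr := hs.eventually_right_inverse
  rw [h0] at hr
  refine ⟨fun p => (hc.localInverse he (by simp) p).1, fun p => (hc.localInverse he (by simp) p).2,
    hf, hg, analyticAt_fst.comp hi, analyticAt_snd.comp hi, hf0, hg0, ?_, ?_, hj, ?_, ?_⟩
  · simp [hi0]
  · simp [hi0]
  · filter_upwards [hl] with p hp using hp
  · filter_upwards [hr] with p hp using hp

namespace IsInverseGerm

variable {f g F G : ℂ × ℂ → ℂ} {Φ : Pol → ℂ} {F₀ : ℂ × ℂ → ℝ}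

theorem tendsto (h : IsInverseGerm f g F G) : Tendsto (fun Z => (f Z, g Z)) (𝓝 0) (𝓝 0) :=
  tendsto_pair h.analytic_f h.analytic_g h.f_zero h.g_zero

theorem tendsto_inv (h : IsInverseGerm f g F G) : Tendsto (fun Z => (F Z, G Z)) (𝓝 0) (𝓝 0) :=
  tendsto_pair h.analytic_F h.analytic_G h.F_zero h.G_zero

theorem analyticAt_comp (h : IsInverseGerm f g F G) (hΦ : AnalyticAt ℂ Φ 0) :
    AnalyticAt ℂ (fun v => Φ (polMap F G v)) 0 :=
  hΦ.comp_polMap h.analytic_F h.analytic_G h.F_zero h.G_zero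

theorem eventually_of_comp (h : IsInverseGerm f g F G) {P : ℂ × ℂ → Prop}
    (hP : ∀ᶠ Z in 𝓝 0, P (f Z, g Z)) : ∀ᶠ Z in 𝓝 0, P Z := by
  filter_upwards [h.tendsto_inv.eventually hP, h.right] with Z a b
  rwa [b] at a

theorem polMap_eq (h : IsInverseGerm f g F G) :
    Φ =ᶠ[𝓝 0] fun v => Φ (polMap F G (polMap f g v)) := by
  have t1 : Tendsto (fun v : Pol => v.1) (𝓝 0) (𝓝 0) := continuous_fst.tendsto' 0 0 rfl
  have t2 : Tendsto (fun v : Pol => star v.2) (𝓝 0) (𝓝 0) :=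
    (by fun_prop : Continuous fun v : Pol => star v.2).tendsto' 0 0 (by simp)
  filter_upwards [t1.eventually h.left, t2.eventually h.left] with v a b
  congr 1
  refine Prod.ext a.symm ?_
  have b1 := congrArg star b
  rw [star_star] at b1
  rw [← b1]
  simp [polMap, conjFun, Prod.star_def]

theorem isPolarization (h : IsInverseGerm f g F G) (hΦ : IsPolarization Φ F₀) :
    IsPolarization (fun v => Φ (polMap F G v)) (fun p => F₀ (F p, G p)) where
  analytic := h.analyticAt_comp hΦ.analytic
  eq := by
    filter_upwards [h.tendsto_inv.eventually hΦ.eq] with p hp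
    rw [polMap_polDiag, hp]

theorem analyticAt_real (h : IsInverseGerm f g F G) (hF : AnalyticAt ℝ F₀ 0) :
    AnalyticAt ℝ (fun p => F₀ (F p, G p)) 0 :=
  AnalyticAt.comp (g := F₀) (by rwa [h.F_zero, h.G_zero])
    (h.analytic_F.restrictScalars.prod h.analytic_G.restrictScalars)

theorem rigidlyEquivalent (h : IsInverseGerm f g F G) (F₀ : ℂ × ℂ → ℝ) :
    RigidlyEquivalent (rigidHypersurface F₀) (rigidHypersurface fun p => F₀ (F p, G p)) := by
  refine .of_identity (ρ := 1) (h := fun _ => 0) h.analytic_f h.analytic_g analyticAt_const h.f_zero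
    h.g_zero rfl one_ne_zero h.jacobian ?_
  filter_upwards [h.left] with p hp
  rw [hp]
  simp

end IsInverseGerm

end CoordinateChange

/-! ### The shear that normalizes the order-five term -/

section Shear

variable {Φ : Pol → ℂ}

/-- The shear `(z, ζ) ↦ (z, ζ - c κ(z))`. -/
theorem Prenormal.isInverseGerm_shear (h : Prenormal Φ) (c : ℂ) :
    IsInverseGerm (fun Z => Z.1) (fun Z => Z.2 - c * kappa Φ Z.1) (fun Z => Z.1)
      (fun Z => Z.2 + c * kappa Φ Z.1) := by
  have hk : AnalyticAt ℂ (fun Z : ℂ × ℂ => kappa Φ Z.1) 0 :=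
    (analyticAt_kappa h.analytic).comp_clm (ContinuousLinearMap.fst ℂ ℂ ℂ)
  have hck : AnalyticAt ℂ (fun Z : ℂ × ℂ => c * kappa Φ Z.1) 0 := analyticAt_const.mul hk
  have dfst : ∀ u Z : ℂ × ℂ, dirD u (fun Z : ℂ × ℂ => Z.1) Z = u.1 := fun u Z =>
    dirD_clm (ContinuousLinearMap.fst ℂ ℂ ℂ) Z u
  have dsnd : ∀ u Z : ℂ × ℂ, dirD u (fun Z : ℂ × ℂ => Z.2) Z = u.2 := fun u Z =>
    dirD_clm (ContinuousLinearMap.snd ℂ ℂ ℂ) Z u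
  refine ⟨analyticAt_fst, analyticAt_snd.sub hck, analyticAt_fst, analyticAt_snd.add hck, rfl,
    by simp [h.kappa_zero], rfl, by simp [h.kappa_zero], ?_, .of_forall fun p => by simp,
    .of_forall fun p => by simp⟩
  have h1 : dirD (0, 1) (fun Z : ℂ × ℂ => kappa Φ Z.1) 0 = 0 :=
    (dirD_comp_clm (ContinuousLinearMap.fst ℂ ℂ ℂ) (v := (0 : ℂ × ℂ)) (Φ := kappa Φ)
      (by simpa using (analyticAt_kappa h.analytic).differentiableAt) (0, 1)).trans (by simp [dirD])
  rw [dfst, dfst, dirD_sub differentiableAt_snd hck.differentiableAt, dsnd,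
    dirD_const_mul hk.differentiableAt, h1]
  simp

/-- In the second w-derivative on {W = 0} the shear enters twice: as c κ from the new ζ, and as c̄ κ
from the conjugate of g_zz(0) = c multiplying Φ_η = κ. The two cancel precisely because c is
imaginary. -/
theorem Prenormal.shear (h : Prenormal Φ) {c : ℂ} (hc : star c = -c) :
    Prenormal (fun v => Φ (polMap (fun Z => Z.1) (fun Z => Z.2 + c * kappa Φ Z.1) v)) ∧
    sporadicFour (fun v => Φ (polMap (fun Z => Z.1) (fun Z => Z.2 + c * kappa Φ Z.1) v)) =
      sporadicFour Φ ∧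
    sporadicFive (fun v => Φ (polMap (fun Z => Z.1) (fun Z => Z.2 + c * kappa Φ Z.1) v)) =
      sporadicFive Φ + 3 * c := by
  have hi := h.isInverseGerm_shear c
  have hΦ := h.analytic
  have hk := analyticAt_kappa hΦ
  have hF := hi.analytic_F
  have hG := hi.analytic_G
  have dfst : ∀ u Z : ℂ × ℂ, dirD u (fun Z : ℂ × ℂ => Z.1) Z = u.1 := fun u Z =>
    dirD_clm (ContinuousLinearMap.fst ℂ ℂ ℂ) Z u
  have st1 : star ((1, 0) : ℂ × ℂ) = (1, 0) := by simp [Prod.star_def]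
  have st2 : star ((0, 1) : ℂ × ℂ) = (0, 1) := by simp [Prod.star_def]
  obtain ⟨k1, k2, -⟩ := h.jet_kappa
  have F1 : dirD (1, 0) (fun Z : ℂ × ℂ => Z.1) = fun _ => 1 := funext fun Z => dfst _ _
  have F2 : dirD (0, 1) (fun Z : ℂ × ℂ => Z.1) = fun _ => 0 := funext fun Z => dfst _ _
  have hid : AnalyticAt ℂ (fun s : ℂ => s) 0 := analyticAt_id
  obtain ⟨i1, i2, -⟩ := jet_id
  obtain ⟨G1, G2, -⟩ := jet_comp_line hG (1, 0)
  obtain ⟨L1, L2, -⟩ := jet_linear_combination hk hid c 0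
  have eG : (fun s : ℂ => (s • ((1, 0) : ℂ × ℂ)).2 + c * kappa Φ (s • ((1, 0) : ℂ × ℂ)).1) =
      fun s => c * kappa Φ s + 0 * s := by
    funext s
    simp
  rw [eG, L1, k1, i1] at G1
  rw [eG, L2, k2, i2] at G2
  have G3 : dirD (0, 1) (fun Z : ℂ × ℂ => Z.2 + c * kappa Φ Z.1) 0 = 1 := by
    have e := (jet_comp_line hG (0, 1)).1
    rw [← e]
    simp [h.kappa_zero]
  have tFG := hi.tendsto_inv
  have one : ∀ᶠ Z : ℂ × ℂ in 𝓝 0, dirD ew Φ (holSlice (Z.1, Z.2 + c * kappa Φ Z.1)) = Z.1 :=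
    tFG.eventually h.one
  have two : ∀ᶠ Z : ℂ × ℂ in 𝓝 0, dirD ew (dirD ew Φ) (holSlice (Z.1, Z.2 + c * kappa Φ Z.1)) =
    Z.2 + c * kappa Φ Z.1 := tFG.eventually h.two
  have eta : ∀ᶠ Z : ℂ × ℂ in 𝓝 0, dirD eη Φ (holSlice (Z.1, Z.2 + c * kappa Φ Z.1)) = kappa Φ Z.1 :=
    tFG.eventually h.dirD_η_holSlice
  refine ⟨⟨hi.analyticAt_comp hΦ, h.hermitian.comp_polMap hF hG hi.F_zero hi.G_zero,
    h.levi.comp_polMap hΦ hF hG hi.F_zero hi.G_zero, ?_, ?_, ?_⟩, ?_, ?_⟩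
  · filter_upwards [tFG.eventually h.zero] with Z hZ
    exact (congrArg Φ (polMap_holSlice hi.F_zero hi.G_zero Z)).trans hZ
  · filter_upwards [eventually_dirD_polMap_holSlice hΦ hF hG hi.F_zero hi.G_zero (1, 0), one]
      with Z a b
    refine a.trans ?_
    rw [b, st1, ← G1, F1]
    simp
  · filter_upwards [eventually_dirD_dirD_polMap_holSlice hΦ hF hG hi.F_zero hi.G_zero (1, 0), one,
      two, eta] with Z a b b' b''
    refine a.trans ?_
    rw [b, b', b'', st1, ← G1, ← G2, F1, dirD_const]
    simp only [mul_one, mul_zero, zero_mul, add_zero, star_zero, zero_add, star_one, one_mul, hc]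
    ring
  · have hN := hi.analyticAt_comp hΦ
    rw [sporadicFour, sporadicFour, ← (jet_comp_line (hΦ.dirD eη) ez).2.2,
      ← (jet_comp_line (hN.dirD eη) ez).2.2]
    -- On the z-axis the η-derivative remains κ, since the ζ-derivatives at 0 of the two components
    -- are 0 and 1.
    refine EventuallyEq.deriv_eq (EventuallyEq.deriv (EventuallyEq.deriv ?_))
    filter_upwards [tendsto_pair_left.eventually
      (eventually_dirD_polMap_holSlice hΦ hF hG hi.F_zero hi.G_zero (0, 1)),
      tendsto_pair_left.eventually eta] with s a b
    have e1 : (s • ez : Pol) = holSlice (s, 0) := by simp [holSlice_apply]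
    rw [show dirD eη Φ (s • ez) = kappa Φ s from rfl, e1]
    refine a.trans ?_
    rw [b, st2, F2, G3]
    simp
  · rw [h.sporadicFive_comp (l := 1) (ν := 1) (c := c) hF hG (.of_forall fun Z => by simp)
      (.of_forall fun Z => by simp)]
    simp

end Shear

/-! ### Multilinearity and symmetry of iterated derivatives -/

section Multilinear

variable {V : Type*} [NormedAddCommGroup V] [NormedSpace ℂ V] {Ψ : V → ℂ}

theorem dirD_combination (x y : ℂ) (u v : V) :
    dirD (x • u + y • v) Ψ = fun p => x * dirD u Ψ p + y * dirD v Ψ p := by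
  funext p
  rw [dirD_add_dir, dirD_smul_dir, dirD_smul_dir]

theorem dirD_combination_apply (x y : ℂ) (u v : V) (p : V) :
    dirD (x • u + y • v) Ψ p = x * dirD u Ψ p + y * dirD v Ψ p := by rw [dirD_combination]

theorem dirD_dirD_combination {a : V} (h : AnalyticAt ℂ Ψ a) (w : V) (x y : ℂ) (u v : V) :
    dirD w (dirD (x • u + y • v) Ψ) a = x * dirD w (dirD u Ψ) a + y * dirD w (dirD v Ψ) a := by
  have hu := (h.dirD u).differentiableAt
  have hv := (h.dirD v).differentiableAt
  rw [dirD_combination, dirD_add (hu.const_mul x) (hv.const_mul y), dirD_const_mul hu,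
    dirD_const_mul hv]

theorem dirD_comm_two_two {a : V} (h : AnalyticAt ℂ Ψ a) (u t : V) :
    dirD u (dirD u (dirD t (dirD t Ψ))) a = dirD t (dirD t (dirD u (dirD u Ψ))) a := by
  have h1 := (dirD_comm_eventually (h.dirD t) u t).dirD_eq u
  have h2 := ((dirD_comm_eventually h u t).dirD t).dirD_eq u
  have h3 := dirD_comm ((h.dirD u).dirD t) u t
  have h4 := (dirD_comm_eventually (h.dirD u) u t).dirD_eq t
  rw [h1, h2, h3, h4]

theorem dirD_comm_two {a : V} (h : AnalyticAt ℂ Ψ a) (u t : V) :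
    dirD u (dirD u (dirD t Ψ)) a = dirD t (dirD u (dirD u Ψ)) a := by
  rw [(dirD_comm_eventually h u t).dirD_eq, dirD_comm (h.dirD u)]

theorem dirD_holSlice {X : Pol → ℂ} (hX : AnalyticAt ℂ X 0) (x : ℂ × ℂ) :
    dirD x (fun Z => X (holSlice Z)) 0 = dirD (x, 0) X 0 :=
  (dirD_comp_clm_eventually hX holSlice x).self_of_nhds

theorem dirD_dirD_holSlice {X : Pol → ℂ} (hX : AnalyticAt ℂ X 0) (x y : ℂ × ℂ) :
    dirD x (dirD y (fun Z => X (holSlice Z))) 0 = dirD (x, 0) (dirD (y, 0) X) 0 := by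
  have h1 : dirD y (fun Z => X (holSlice Z)) =ᶠ[𝓝 0] fun Z => dirD (y, 0) X (holSlice Z) :=
    dirD_comp_clm_eventually hX holSlice y
  rw [h1.dirD_eq, dirD_holSlice (hX.dirD _)]

theorem dirD_conj_polSwap_zero {X Y : Pol → ℂ} (hX : AnalyticAt ℂ X 0) (hY : AnalyticAt ℂ Y 0)
    (h : ∀ᶠ v in 𝓝 0, X v = star (Y (polSwap v))) (u : Pol) :
    ∀ᶠ v in 𝓝 0, dirD u X v = star (dirD (polSwap u) Y (polSwap v)) :=
  dirD_conj_polSwap hX (polSwap_zero.symm ▸ hY) h u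

end Multilinear

/-! ### Prenormalization -/

section Prenormalization

/-- The function vanishes on `{W = 0}`, is real with degenerate Levi form, its Levi matrix at the
origin is `diag(1, 0)`, and it is 2-nondegenerate. -/
structure LeviNormalized (Φ : Pol → ℂ) : Prop where
  analytic : AnalyticAt ℂ Φ 0
  hermitian : IsHermitian Φ
  levi : LeviDegenerate Φ
  zero : ∀ᶠ Z in 𝓝 (0 : ℂ × ℂ), Φ (holSlice Z) = 0
  zw : dirD ez (dirD ew Φ) 0 = 1
  zη : dirD ez (dirD eη Φ) 0 = 0
  ζw : dirD eζ (dirD ew Φ) 0 = 0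
  ζη : dirD eζ (dirD eη Φ) 0 = 0
  nondegenerate : dirD ew (dirD ew (dirD eζ Φ)) 0 ≠ 0

/-- Differentiating the determinant at a point where three entries vanish, only Φ_zw times the
derivative of Φ_ζη survives. -/
theorem LeviDegenerate.dirD_ζη {Φ : Pol → ℂ} (hΦ : AnalyticAt ℂ Φ 0) (h : LeviDegenerate Φ)
    (zw : dirD ez (dirD ew Φ) 0 ≠ 0) (zη : dirD ez (dirD eη Φ) 0 = 0)
    (ζw : dirD eζ (dirD ew Φ) 0 = 0) (ζη : dirD eζ (dirD eη Φ) 0 = 0) (u : Pol) :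
    dirD u (dirD eη (dirD eζ Φ)) 0 = 0 := by
  have an : ∀ x y, DifferentiableAt ℂ (dirD x (dirD y Φ)) 0 := fun x y =>
    ((hΦ.dirD y).dirD x).differentiableAt
  have h1 := EventuallyEq.dirD_eq h u
  rw [dirD_mul (an _ _) (an _ _), dirD_mul (an _ _) (an _ _), zη, ζw, ζη,
    (dirD_comm_eventually hΦ eζ eη).dirD_eq] at h1
  have h2 : dirD ez (dirD ew Φ) 0 * dirD u (dirD eη (dirD eζ Φ)) 0 = 0 := by
    linear_combination h1
  exact (mul_eq_zero.1 h2).resolve_left zw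

namespace LeviNormalized

variable {Φ : Pol → ℂ}

theorem zero_conj (h : LeviNormalized Φ) : ∀ᶠ W in 𝓝 0, Φ (antiSlice W) = 0 := by
  filter_upwards [eventually_comp_clm h.hermitian antiSlice, tendsto_star_pair.eventually h.zero]
    with W h1 h2
  rw [h1]
  have e : polSwap (antiSlice W) = holSlice (star W) := by
    simp [polSwap, antiSlice_apply, holSlice_apply]
  rw [e, h2, star_zero]

theorem hol_eq (x : ℂ × ℂ) : ((x, 0) : Pol) = x.1 • ez + x.2 • eζ := by simp

theorem anti_eq (y : ℂ × ℂ) : ((0, y) : Pol) = y.1 • ew + y.2 • eη := by simp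

theorem dirD_hol_dirD_anti (h : LeviNormalized Φ) (x y : ℂ × ℂ) :
    dirD (x, 0) (dirD (0, y) Φ) 0 = x.1 * y.1 := by
  have hΦ := h.analytic
  rw [anti_eq, dirD_dirD_combination hΦ, hol_eq, dirD_combination_apply, dirD_combination_apply, h.zw, h.zη,
    h.ζw, h.ζη]
  ring

theorem dirD_hol_dirD_anti_anti (h : LeviNormalized Φ) (x y : ℂ × ℂ) :
    dirD (x, 0) (dirD (0, y) (dirD (0, y) Φ)) 0 =
      x.1 * dirD ez (dirD (0, y) (dirD (0, y) Φ)) 0 +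
        x.2 * (y.1 ^ 2 * dirD ew (dirD ew (dirD eζ Φ)) 0) := by
  have hΦ := h.analytic
  have e := h.levi.dirD_ζη hΦ (by simp [h.zw]) h.zη h.ζw h.ζη
  have h1 : dirD (0, y) (dirD (0, y) (dirD eζ Φ)) 0 = y.1 ^ 2 * dirD ew (dirD ew (dirD eζ Φ)) 0 := by
    rw [anti_eq, dirD_dirD_combination (hΦ.dirD _), dirD_combination_apply, dirD_combination_apply, e, e,
      dirD_comm (hΦ.dirD eζ) eη ew, e]
    ring
  rw [hol_eq x, dirD_combination_apply, ← dirD_comm_two hΦ _ eζ, h1]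

/-- Prenormalization: a change of the coordinates `(z, ζ)` that brings the coefficients of
`1`, `z̄` and `z̄²` to their normal form and kills the derivative `∂_z³ ∂_ζ̄`. -/
theorem exists_prenormal (h : LeviNormalized Φ) : ∃ f g F G, IsInverseGerm f g F G ∧
    Prenormal (fun v => Φ (polMap F G v)) ∧ sporadicFour (fun v => Φ (polMap F G v)) = 0 := by
  have hΦ := h.analytic
  set t := dirD ew (dirD ew (dirD eζ Φ)) 0 with ht
  have ht0 : t ≠ 0 := h.nondegenerate
  have hst0 : star t ≠ 0 := star_ne_zero.2 ht0
  set p₂ := dirD ez (dirD ez (dirD ew Φ)) 0 with hp₂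
  set q₃ := dirD ez (dirD ez (dirD ez (dirD eη Φ))) 0 with hq₃
  have hq₂ : dirD ez (dirD ez (dirD eη Φ)) 0 = star t := by
    have := (dirD_conj_polSwap_zero ((hΦ.dirD _).dirD _) ((hΦ.dirD _).dirD _)
      (h.hermitian.dirD_dirD hΦ ez eη) ez).self_of_nhds
    rw [polSwap_zero] at this
    rw [this, ht]
    simp [polSwap, Prod.star_def]
  -- Prenormality leaves the second component of a free; this value makes f_zz(0) = q₃ / (3 t̄),
  -- which annihilates `sporadicFour` at the end.
  set a : ℂ × ℂ := (1, (q₃ / (3 * star t) - p₂) / star t) with ha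
  have ha1 : a.1 = 1 := rfl
  set u : Pol := (0, a) with hu
  set T := dirD (star a, 0) (dirD u (dirD u Φ)) 0 with hT
  set A := dirD (star a, 0) (dirD (star a, 0) (dirD u (dirD u Φ))) 0 with hA
  set B := dirD ez (dirD u (dirD u Φ)) 0 with hB
  -- The first component makes the derivative of g along ā vanish. The second-order condition on g
  -- prescribes only the real part of x = ∂_b̄ ∂_u² Φ(0), namely 2 Re x = -(A + |T|²); the second
  -- component of b solves it with x real.
  set b : ℂ × ℂ := (-T, star ((-(A + T * star T) / 2 + star T * B) / t)) with hb
  set v : Pol := (0, b) with hv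
  have pu : polSwap u = (star a, 0) := by simp [polSwap, hu]
  have pu' : polSwap (star a, 0) = u := by simp [polSwap, hu]
  have pv : polSwap v = (star b, 0) := by simp [polSwap, hv]
  have hT' : ∀ x : ℂ × ℂ, dirD (x, 0) (dirD u (dirD u Φ)) 0 = x.1 * B + x.2 * t := fun x => by
    rw [h.dirD_hol_dirD_anti_anti x a, ha1]
    ring
  have hTb : dirD (star b, 0) (dirD u (dirD u Φ)) 0 = -(A + T * star T) / 2 := by
    rw [hT']
    simp only [hb, Prod.star_def, star_neg, star_star]
    field_simp
    ring
  -- Conjugation exchanges the two holomorphic derivatives in A with the two antiholomorphic ones.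
  have hAr : star A = A := by
    have h1 := h.hermitian.dirD_dirD hΦ u u
    have h2 := dirD_conj_polSwap_zero ((hΦ.dirD _).dirD _) ((hΦ.dirD _).dirD _) h1 (star a, 0)
    have h3 := (dirD_conj_polSwap_zero (((hΦ.dirD _).dirD _).dirD _) (((hΦ.dirD _).dirD _).dirD _)
      h2 (star a, 0)).self_of_nhds
    rw [pu, pu', polSwap_zero, dirD_comm_two_two hΦ u] at h3
    exact h3.symm
  have hconj : ∀ w : Pol, dirD (star a, 0) (dirD (star a, 0) (dirD w Φ)) 0 =
      star (dirD (polSwap w) (dirD u (dirD u Φ)) 0) := fun w => by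
    have h1 := h.hermitian.dirD_dirD hΦ (star a, 0) w
    have h2 := (dirD_conj_polSwap_zero ((hΦ.dirD _).dirD _) ((hΦ.dirD _).dirD _) h1
      (star a, 0)).self_of_nhds
    rw [pu', polSwap_zero, dirD_comm_two hΦ u] at h2
    exact h2
  have huΦ := hΦ.dirD u
  have huuΦ := huΦ.dirD u
  have hvΦ := hΦ.dirD v
  have hgA : AnalyticAt ℂ (fun w => dirD u (dirD u Φ) w + dirD v Φ w) 0 := huuΦ.add hvΦ
  have hgD : ∀ x : ℂ × ℂ, dirD (x, 0) (fun w => dirD u (dirD u Φ) w + dirD v Φ w) =ᶠ[𝓝 0]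
      fun w => dirD (x, 0) (dirD u (dirD u Φ)) w + dirD (x, 0) (dirD v Φ) w := fun x => by
    filter_upwards [huuΦ.eventually_analyticAt, hvΦ.eventually_analyticAt] with w h1 h2
    exact dirD_add h1.differentiableAt h2.differentiableAt _
  -- Prenormality wants ∂_w and ∂_w² of the new function on {W = 0} to be the new coordinates
  -- themselves. If (f̄, ḡ) maps the curve s a + s² b / 2 to (s, 0) up to O(s³), these derivatives
  -- are ∂_u Φ and (∂_u² + ∂_v) Φ. So f and g are defined by them, and `df1`, `dg1`, `df2`, `dg2`
  -- verify that the curve is straightened.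
  let f : ℂ × ℂ → ℂ := fun Z => dirD u Φ (holSlice Z)
  let g : ℂ × ℂ → ℂ := fun Z => dirD u (dirD u Φ) (holSlice Z) + dirD v Φ (holSlice Z)
  have hf : AnalyticAt ℂ f 0 := huΦ.comp_clm holSlice
  have hg : AnalyticAt ℂ g 0 := hgA.comp_clm holSlice
  have z1 : ∀ y, ∀ᶠ W in 𝓝 0, dirD (0, y) Φ (antiSlice W) = 0 := fun y =>
    eventually_dirD_slice hΦ antiSlice h.zero_conj y
  have z2 := (eventually_dirD_slice huΦ antiSlice (z1 a) a).self_of_nhds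
  have hf0 : f 0 = 0 := (z1 a).self_of_nhds
  have hg0 : g 0 = 0 := by
    have e1 : dirD u (dirD u Φ) (holSlice 0) = 0 := z2
    have e2 : dirD v Φ (holSlice 0) = 0 := (z1 b).self_of_nhds
    change dirD u (dirD u Φ) (holSlice 0) + dirD v Φ (holSlice 0) = 0
    rw [e1, e2, add_zero]
  have df : ∀ x, dirD x f 0 = x.1 := fun x => by
    rw [dirD_holSlice huΦ, h.dirD_hol_dirD_anti, ha1, mul_one]
  have dg : ∀ x, dirD x g 0 = dirD (x, 0) (dirD u (dirD u Φ)) 0 - x.1 * T := fun x => by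
    have e := dirD_holSlice hgA x
    have e0 : dirD (x, 0) (fun w => dirD u (dirD u Φ) w + dirD v Φ w) 0 =
        dirD (x, 0) (dirD u (dirD u Φ)) 0 + dirD (x, 0) (dirD v Φ) 0 := (hgD x).self_of_nhds
    rw [e0, h.dirD_hol_dirD_anti] at e
    refine e.trans ?_
    simp only [hb]
    ring
  have df1 : dirD (star a) f 0 = 1 := by
    rw [df]
    simp [ha, Prod.star_def]
  have dg1 : dirD (star a) g 0 = 0 := by
    rw [dg, ← hT]
    simp [ha, Prod.star_def]
  have df2 : dirD (star a) (dirD (star a) f) 0 + dirD (star b) f 0 = 0 := by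
    rw [dirD_dirD_holSlice huΦ, hconj, pu, ← hT, df]
    simp [hb, Prod.star_def]
  have dg2 : dirD (star a) (dirD (star a) g) 0 + dirD (star b) g 0 = 0 := by
    have e := dirD_dirD_holSlice hgA (star a) (star a)
    rw [(hgD (star a)).dirD_eq, dirD_add (huuΦ.dirD _).differentiableAt (hvΦ.dirD _).differentiableAt,
      hconj, pv, hTb, ← hA] at e
    rw [dg, hTb]
    refine (congrArg (· + _) e).trans ?_
    simp only [hb, Prod.star_def, star_neg, star_div₀, star_add, star_mul', star_star, star_ofNat, hAr]
    ring
  have dfζ : dirD (0, 1) f 0 = 0 := df _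
  have dgζ : dirD (0, 1) g 0 = t := by
    rw [dg, hT']
    simp
  have dfz : dirD (1, 0) f 0 = 1 := df _
  obtain ⟨F, G, hi⟩ := exists_isInverseGerm hf hg hf0 hg0 (by rw [dfz, dgζ, dfζ]; simpa using ht0)
  set Φ' : Pol → ℂ := fun v => Φ (polMap F G v) with hΦ'def
  have hΦ' : AnalyticAt ℂ Φ' 0 := hi.analyticAt_comp hΦ
  have hE : Φ =ᶠ[𝓝 0] fun v => Φ' (polMap f g v) := hi.polMap_eq
  have one : ∀ᶠ Z in 𝓝 0, dirD ew Φ' (holSlice (f Z, g Z)) = f Z := by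
    filter_upwards [eventually_dirD_polMap_holSlice hΦ' hf hg hf0 hg0 a,
      eventually_comp_clm (hE.dirD u) holSlice] with Z e1 e2
    rw [df1, dg1, ← hu, ← e2] at e1
    simpa using e1.symm
  have hp : Prenormal Φ' := by
    refine ⟨hΦ', h.hermitian.comp_polMap hi.analytic_F hi.analytic_G hi.F_zero hi.G_zero,
      h.levi.comp_polMap hΦ hi.analytic_F hi.analytic_G hi.F_zero hi.G_zero, ?_,
      hi.eventually_of_comp (P := fun Z => dirD ew Φ' (holSlice Z) = Z.1) one,
      hi.eventually_of_comp (P := fun Z => dirD ew (dirD ew Φ') (holSlice Z) = Z.2) ?_⟩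
    · filter_upwards [hi.tendsto_inv.eventually h.zero] with Z hZ
      exact (congrArg Φ (polMap_holSlice hi.F_zero hi.G_zero Z)).trans hZ
    · filter_upwards [eventually_dirD_polMap_holSlice hΦ' hf hg hf0 hg0 b,
        eventually_comp_clm (hE.dirD v) holSlice,
        eventually_dirD_dirD_polMap_holSlice hΦ' hf hg hf0 hg0 a,
        eventually_comp_clm ((hE.dirD u).dirD u) holSlice] with Z e1 e2 e3 e4
      rw [← hv, ← e2] at e1
      rw [← hu, ← e4, df1, dg1, star_one, star_zero] at e3
      have s1 := congrArg star df2
      have s2 := congrArg star dg2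
      rw [star_add, star_zero] at s1 s2
      change _ = dirD u (dirD u Φ) (holSlice Z) + dirD v Φ (holSlice Z)
      rw [e1, e3]
      linear_combination -dirD ew Φ' (holSlice (f Z, g Z)) * s1 -
        dirD eη Φ' (holSlice (f Z, g Z)) * s2
  refine ⟨f, g, F, G, hi, hp, ?_⟩
  have hid : AnalyticAt ℂ (fun s : ℂ => s) 0 := analyticAt_id
  have hφ : AnalyticAt ℂ (fun s : ℂ => f (s • (1, 0))) 0 :=
    AnalyticAt.comp (g := f) (by simpa using hf) (analyticAt_id.smul analyticAt_const)
  obtain ⟨i1, i2, i3⟩ := jet_id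
  obtain ⟨p1, p2, -⟩ := jet_comp_line hf (1, 0)
  obtain ⟨γ1, γ2, -⟩ := jet_linear_combination hφ hid 1 (-1)
  rw [p1, i1, dfz] at γ1
  have hff : dirD (1, 0) (dirD (1, 0) f) 0 = p₂ + a.2 * star t := by
    rw [dirD_dirD_holSlice huΦ, dirD_comm_two hΦ ez u, hu, anti_eq, dirD_combination_apply,
      ← dirD_comm_two hΦ ez ew, ← dirD_comm_two hΦ ez eη, hq₂, ha1, one_mul]
  rw [p2, i2, hff] at γ2
  have hγ : AnalyticAt ℂ (fun s : ℂ => 1 * f (s • (1, 0)) + -1 * s) 0 :=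
    (analyticAt_const.mul hφ).add (analyticAt_const.mul hid)
  obtain ⟨-, -, K3⟩ := hp.jet_kappa_comp hγ (by simp [hf0]) (by rw [γ1]; ring) 1
  have eK : (fun s : ℂ => kappa Φ' (1 * s + (1 * f (s • (1, 0)) + -1 * s))) =
      fun s => kappa Φ' (f (s • (1, 0))) := by
    funext s; congr 1; ring
  rw [eK, γ2] at K3
  have hK : AnalyticAt ℂ (fun s : ℂ => kappa Φ' (f (s • (1, 0)))) 0 :=
    AnalyticAt.comp (g := kappa Φ') (by simpa [hf0] using analyticAt_kappa hΦ') hφ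
  -- On the z-axis Φ_η = t̄ κ(f) with κ of the new function. Its third derivative at 0 is q₃ = t̄
  -- (S₄ + 3 f_zz(0)), and the choice of a gives S₄ = 0.
  have hq : (fun s : ℂ => dirD eη Φ (s • ez)) =ᶠ[𝓝 0] fun s =>
      star t * kappa Φ' (f (s • (1, 0))) + 0 * s := by
    have st2 : star ((0, 1) : ℂ × ℂ) = (0, 1) := by simp [Prod.star_def]
    filter_upwards [tendsto_pair_left.eventually
        (eventually_dirD_polMap_holSlice hΦ' hf hg hf0 hg0 (0, 1)),
      tendsto_pair_left.eventually (eventually_comp_clm (hE.dirD eη) holSlice),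
      tendsto_pair_left.eventually (hi.tendsto.eventually hp.dirD_η_holSlice)] with s e1 e2 e3
    have e4 : (s • ez : Pol) = holSlice (s, 0) := by simp [holSlice_apply]
    have e5 : s • ((1, 0) : ℂ × ℂ) = (s, 0) := by simp
    rw [e4, e5, e2]
    refine e1.trans ?_
    rw [st2, dfζ, dgζ, e3]
    simp
  have Q := (jet_comp_line (hΦ.dirD eη) ez).2.2
  rw [hq.deriv.deriv.deriv_eq, (jet_linear_combination hK hid (star t) 0).2.2, K3, i3, ← hq₃] at Q
  have ha2 : a.2 * star t = q₃ / (3 * star t) - p₂ := div_mul_cancel₀ _ hst0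
  have hq₃' : q₃ / (3 * star t) * (3 * star t) = q₃ := div_mul_cancel₀ _ (by simpa using ht0)
  rw [ha2] at Q
  apply mul_left_cancel₀ hst0
  linear_combination Q - hq₃'

end LeviNormalized

end Prenormalization

/-! ### Linear normalization of the Levi form -/

section LinearNormalization

variable {Φ : Pol → ℂ} {F : ℂ × ℂ → ℝ}

theorem dirD_rotate {V : Type*} [NormedAddCommGroup V] [NormedSpace ℂ V] {Ψ : V → ℂ} {p : V}
    (h : AnalyticAt ℂ Ψ p) (a b c : V) :
    dirD a (dirD b (dirD c Ψ)) p = dirD b (dirD c (dirD a Ψ)) p := by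
  rw [dirD_comm (h.dirD c), (dirD_comm_eventually h a c).dirD_eq]

/-- Otherwise the linear form with coefficients e would annihilate every vector in the spanning
condition, hence be zero. -/
theorem IsPolarization.two_nondegenerate (h : IsPolarization Φ F) (hF : InClassC21 F) {e : ℂ × ℂ}
    (he : e ≠ 0) (h1 : ∀ b, dirD (e, 0) (dirD (0, b) Φ) 0 = 0) :
    ∃ b b' : ℂ × ℂ, dirD (0, b) (dirD (0, b') (dirD (e, 0) Φ)) 0 ≠ 0 := by
  by_contra! hc
  have hΦ := h.analytic
  let ℓ : (Fin 2 → ℂ) →ₗ[ℂ] ℂ :=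
    e.1 • LinearMap.proj (R := ℂ) (φ := fun _ : Fin 2 => ℂ) 0 +
      e.2 • LinearMap.proj (R := ℂ) (φ := fun _ : Fin 2 => ℂ) 1
  have hℓ : ∀ x, ℓ x = e.1 * x 0 + e.2 * x 1 := fun x => rfl
  have hcomb : ∀ X : Pol → ℂ, e.1 * dirD (coordDir 0, 0) X 0 + e.2 * dirD (coordDir 1, 0) X 0 =
      dirD (e, 0) X 0 := fun X => by
    rw [LeviNormalized.hol_eq e, dirD_combination_apply]
    rfl
  have hspan : Submodule.span ℂ
    ((Set.range fun k : Fin 2 => holGrad (_root_.dAnti k fun q => (F q : ℂ)) 0) ∪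
      (Set.range fun kl : Fin 2 × Fin 2 =>
        holGrad (_root_.dAnti kl.1 (_root_.dAnti kl.2 fun q => (F q : ℂ))) 0)) ≤
      LinearMap.ker ℓ := by
    rw [Submodule.span_le, Set.union_subset_iff]
    constructor
    · rintro _ ⟨k, rfl⟩
      have e1 : ∀ j, holGrad (_root_.dAnti k fun q => (F q : ℂ)) 0 j =
          dirD (coordDir j, 0) (dirD (0, coordDir k) Φ) 0 := fun j => by
        have := (dHol_polDiag (hΦ.dirD _) (h.dAnti k) j).self_of_nhds
        rw [polDiag_zero] at this
        exact this.symm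
      rw [SetLike.mem_coe, LinearMap.mem_ker, hℓ]
      beta_reduce
      rw [e1, e1, hcomb, h1]
    · rintro _ ⟨⟨k, l⟩, rfl⟩
      have e1 : ∀ j, holGrad (_root_.dAnti k (_root_.dAnti l fun q => (F q : ℂ))) 0 j =
          dirD (coordDir j, 0) (dirD (0, coordDir k) (dirD (0, coordDir l) Φ)) 0 := fun j => by
        have := (dHol_polDiag ((hΦ.dirD _).dirD _) (h.dAnti_dAnti k l) j).self_of_nhds
        rw [polDiag_zero] at this
        exact this.symm
      rw [SetLike.mem_coe, LinearMap.mem_ker, hℓ]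
      dsimp only
      rw [e1, e1, hcomb, dirD_rotate hΦ, hc]
  have htop : LinearMap.ker ℓ = ⊤ := top_le_iff.1 (hF.two_nondegenerate ▸ hspan)
  have hz : ∀ x, ℓ x = 0 := fun x => by
    have : x ∈ LinearMap.ker ℓ := htop ▸ Submodule.mem_top
    exact this
  apply he
  have z0 := hz (Pi.single 0 1)
  have z1 := hz (Pi.single 1 1)
  rw [hℓ] at z0 z1
  ext
  · simpa using z0
  · simpa using z1

/-- The vector e' spans the Levi kernel and e is transverse to it; s is the Levi form on e, real by
Hermitian symmetry and nonzero because the rank is one. -/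
theorem IsPolarization.exists_levi_basis (h : IsPolarization Φ F) (hF : InClassC21 F) :
    ∃ (e e' : ℂ × ℂ) (s : ℝ), s ≠ 0 ∧ dirD (e, 0) (dirD (0, star e) Φ) 0 = s ∧
      (∀ b, dirD (e', 0) (dirD (0, b) Φ) 0 = 0) ∧ e.1 * e'.2 - e.2 * e'.1 ≠ 0 := by
  have hΦ := h.analytic
  have herm : ∀ u u' : Pol, dirD u (dirD u' Φ) 0 = star (dirD (polSwap u') (dirD (polSwap u) Φ) 0) :=
    fun u u' => by
      have := (h.hermitian.dirD_dirD hΦ u u').self_of_nhds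
      rw [polSwap_zero, dirD_comm hΦ (polSwap u)] at this
      exact this
  have sz : polSwap ez = ew := by simp [polSwap, Prod.star_def]
  have sζ : polSwap eζ = eη := by simp [polSwap, Prod.star_def]
  have sw : polSwap ew = ez := by simp [polSwap, Prod.star_def]
  have sη : polSwap eη = eζ := by simp [polSwap, Prod.star_def]
  have hA := herm ez ew
  have hC := herm eζ ew
  have hD := herm eζ eη
  rw [sz, sw] at hA
  rw [sζ, sw] at hC
  rw [sζ, sη] at hD
  have hdet := (h.leviDegenerate hF).self_of_nhds
  have hb : ∀ (e' b : ℂ × ℂ), dirD (e', 0) (dirD (0, b) Φ) 0 =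
      b.1 * (e'.1 * dirD ez (dirD ew Φ) 0 + e'.2 * dirD eζ (dirD ew Φ) 0) +
        b.2 * (e'.1 * dirD ez (dirD eη Φ) 0 + e'.2 * dirD eζ (dirD eη Φ) 0) := fun e' b => by
    rw [LeviNormalized.anti_eq, dirD_dirD_combination hΦ, LeviNormalized.hol_eq,
      dirD_combination_apply, dirD_combination_apply]
  have hne : ¬ (dirD ez (dirD ew Φ) 0 = 0 ∧ dirD ez (dirD eη Φ) 0 = 0 ∧
      dirD eζ (dirD ew Φ) 0 = 0 ∧ dirD eζ (dirD eη Φ) 0 = 0) := by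
    rintro ⟨h1, h2, h3, h4⟩
    have hm := h.leviMatrix_eq.self_of_nhds
    have hr := hF.levi_rank_one.self_of_nhds
    rw [polDiag_zero, h1, h2, h3, h4] at hm
    have : (!![0, 0; 0, 0] : Matrix (Fin 2) (Fin 2) ℂ) = 0 := by
      ext i j; fin_cases i <;> fin_cases j <;> rfl
    rw [hm, this, Matrix.rank_zero] at hr
    exact zero_ne_one hr
  set A := dirD ez (dirD ew Φ) 0
  set B := dirD ez (dirD eη Φ) 0
  set C := dirD eζ (dirD ew Φ) 0
  set D := dirD eζ (dirD eη Φ) 0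
  have hAr : ((A.re : ℝ) : ℂ) = A := Complex.conj_eq_iff_re.1 hA.symm
  have hDr : ((D.re : ℝ) : ℂ) = D := Complex.conj_eq_iff_re.1 hD.symm
  by_cases hA0 : A = 0
  -- If the zz̄ entry vanishes, the zero determinant is |B|² = 0, so only the ζζ̄ entry is left and
  -- the coordinates are swapped.
  · have hB0 : B = 0 := by
      rw [hA0, hC, zero_mul] at hdet
      rcases mul_eq_zero.1 hdet.symm with h0 | h0
      · exact h0
      · exact star_eq_zero.1 h0
    have hC0 : C = 0 := by rw [hC, hB0, star_zero]
    have hD0 : D ≠ 0 := fun h0 => hne ⟨hA0, hB0, hC0, h0⟩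
    refine ⟨(0, 1), (1, 0), D.re, fun h0 => hD0 (by rw [← hDr, h0, ofReal_zero]), ?_, ?_, ?_⟩
    · rw [hb, hDr]
      simp [D]
    · intro b
      rw [hb]
      simp [hA0, hB0]
    · simp
  · refine ⟨(1, 0), (-C / A, 1), A.re, fun h0 => hA0 (by rw [← hAr, h0, ofReal_zero]), ?_, ?_, ?_⟩
    · rw [hb, hAr]
      simp [A]
    · intro b
      rw [hb]
      have h1 : -C / A * A + 1 * C = 0 := by field_simp; ring
      have h2 : -C / A * B + 1 * D = 0 := by field_simp; linear_combination hdet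
      rw [h1, h2, mul_zero, mul_zero, add_zero]
    · simp

theorem isInverseGerm_linear {e e' : ℂ × ℂ} {δ : ℂ} (hδ : e.1 * e'.2 - e.2 * e'.1 = δ)
    (hδ0 : δ ≠ 0) :
    IsInverseGerm (fun Z => e'.2 / δ * Z.1 + -e'.1 / δ * Z.2)
      (fun Z => -e.2 / δ * Z.1 + e.1 / δ * Z.2)
      (fun Z => e.1 * Z.1 + e'.1 * Z.2) (fun Z => e.2 * Z.1 + e'.2 * Z.2) := by
  have lin : ∀ c c' : ℂ, AnalyticAt ℂ (fun Z : ℂ × ℂ => c * Z.1 + c' * Z.2) 0 := fun c c' =>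
    (analyticAt_const.mul analyticAt_fst).add (analyticAt_const.mul analyticAt_snd)
  have dlin : ∀ (c c' : ℂ) (u : ℂ × ℂ), dirD u (fun Z : ℂ × ℂ => c * Z.1 + c' * Z.2) 0 =
      c * u.1 + c' * u.2 := fun c c' u =>
    dirD_clm (c • ContinuousLinearMap.fst ℂ ℂ ℂ + c' • ContinuousLinearMap.snd ℂ ℂ ℂ) 0 u
  refine ⟨lin _ _, lin _ _, lin _ _, lin _ _, by simp, by simp, by simp, by simp, ?_,
    .of_forall fun p => ?_, .of_forall fun p => ?_⟩
  · simp only [dlin]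
    convert inv_ne_zero hδ0 using 1
    field_simp
    linear_combination hδ
  · ext
    · simp only
      field_simp
      linear_combination p.1 * hδ
    · simp only
      field_simp
      linear_combination p.2 * hδ
  · ext
    · simp only
      field_simp
      linear_combination p.1 * hδ
    · simp only
      field_simp
      linear_combination p.2 * hδ

/-- The linear map of the polarized variables induced by `Z ↦ z e + ζ e'`. -/
noncomputable def polLinear (e e' : ℂ × ℂ) : Pol →L[ℂ] Pol :=
  ((ContinuousLinearMap.fst ℂ ℂ ℂ).smulRight e + (ContinuousLinearMap.snd ℂ ℂ ℂ).smulRight e').prodMap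
    ((ContinuousLinearMap.fst ℂ ℂ ℂ).smulRight (star e) +
      (ContinuousLinearMap.snd ℂ ℂ ℂ).smulRight (star e'))

theorem polMap_linear (e e' : ℂ × ℂ) (v : Pol) :
    polMap (fun Z => e.1 * Z.1 + e'.1 * Z.2) (fun Z => e.2 * Z.1 + e'.2 * Z.2) v =
      polLinear e e' v := by
  ext <;> simp [polMap, polLinear, conjFun] <;> ring

theorem polLinear_z (e e' : ℂ × ℂ) : polLinear e e' ez = (e, 0) := by simp [polLinear]
theorem polLinear_ζ (e e' : ℂ × ℂ) : polLinear e e' eζ = (e', 0) := by simp [polLinear]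
theorem polLinear_w (e e' : ℂ × ℂ) : polLinear e e' ew = (0, star e) := by simp [polLinear]
theorem polLinear_η (e e' : ℂ × ℂ) : polLinear e e' eη = (0, star e') := by simp [polLinear]

theorem dirD_dirD_comp_clm (hΦ : AnalyticAt ℂ Φ 0) (T : Pol →L[ℂ] Pol) (u u' : Pol) :
    dirD u (dirD u' (fun v => Φ (T v))) =ᶠ[𝓝 0] fun v => dirD (T u) (dirD (T u') Φ) (T v) :=
  (Filter.EventuallyEq.dirD (dirD_comp_clm_eventually hΦ T u') u).trans
    (dirD_comp_clm_eventually (hΦ.dirD _) T u)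

/-- After a linear change of coordinates the Levi matrix at the origin is `diag(s, 0)`. -/
theorem IsPolarization.exists_linear (h : IsPolarization Φ F) (hF : InClassC21 F) :
    ∃ (F' : ℂ × ℂ → ℝ) (Φ' : Pol → ℂ) (s : ℝ), AnalyticAt ℝ F' 0 ∧ IsPolarization Φ' F' ∧
      RigidlyEquivalent (rigidHypersurface F) (rigidHypersurface F') ∧ F' 0 = 0 ∧ s ≠ 0 ∧
      LeviDegenerate Φ' ∧ dirD ez (dirD ew Φ') 0 = s ∧ dirD ez (dirD eη Φ') 0 = 0 ∧
      dirD eζ (dirD ew Φ') 0 = 0 ∧ dirD eζ (dirD eη Φ') 0 = 0 ∧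
      dirD ew (dirD ew (dirD eζ Φ')) 0 ≠ 0 := by
  obtain ⟨e, e', s, hs, h1, h2, hδ⟩ := h.exists_levi_basis hF
  have hΦ := h.analytic
  have hi := isInverseGerm_linear rfl hδ
  have hT : (fun v => Φ (polMap (fun Z => e.1 * Z.1 + e'.1 * Z.2)
      (fun Z => e.2 * Z.1 + e'.2 * Z.2) v)) = fun v => Φ (polLinear e e' v) :=
    funext fun v => by rw [polMap_linear]
  have hp := hi.isPolarization h
  have hl := (h.leviDegenerate hF).comp_polMap hΦ hi.analytic_F hi.analytic_G hi.F_zero hi.G_zero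
  rw [hT] at hp hl
  have two : ∀ u u', dirD u (dirD u' (fun v => Φ (polLinear e e' v))) 0 =
      dirD (polLinear e e' u) (dirD (polLinear e e' u') Φ) 0 := fun u u' => by
    have := (dirD_dirD_comp_clm hΦ (polLinear e e') u u').self_of_nhds
    simpa only [map_zero] using this
  have three : ∀ u u' u'', dirD u (dirD u' (dirD u'' (fun v => Φ (polLinear e e' v)))) 0 =
      dirD (polLinear e e' u) (dirD (polLinear e e' u') (dirD (polLinear e e' u'') Φ)) 0 :=
    fun u u' u'' => by
      have := ((Filter.EventuallyEq.dirD (dirD_dirD_comp_clm hΦ (polLinear e e') u' u'') u).trans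
        (dirD_comp_clm_eventually ((hΦ.dirD _).dirD _) (polLinear e e') u)).self_of_nhds
      simpa only [map_zero] using this
  have zw : dirD ez (dirD ew (fun v => Φ (polLinear e e' v))) 0 = s := by
    rw [two, polLinear_z, polLinear_w, h1]
  have ζw : dirD eζ (dirD ew (fun v => Φ (polLinear e e' v))) 0 = 0 := by
    rw [two, polLinear_ζ, polLinear_w, h2]
  have ζη : dirD eζ (dirD eη (fun v => Φ (polLinear e e' v))) 0 = 0 := by
    rw [two, polLinear_ζ, polLinear_η, h2]
  have zη : dirD ez (dirD eη (fun v => Φ (polLinear e e' v))) 0 = 0 := by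
    have := (hp.hermitian.dirD_dirD hp.analytic ez eη).self_of_nhds
    have sz : polSwap ez = ew := by simp [polSwap, Prod.star_def]
    have sη : polSwap eη = eζ := by simp [polSwap, Prod.star_def]
    rw [polSwap_zero, sz, sη, dirD_comm hp.analytic ew, ζw, star_zero] at this
    exact this
  refine ⟨_, _, s, hi.analyticAt_real hF.analytic, hp, hi.rigidlyEquivalent F, ?_, hs, hl, zw, zη, ζw,
    ζη, fun h0 => ?_⟩
  · simp only [Prod.fst_zero, Prod.snd_zero, mul_zero, add_zero]
    exact hF.through_origin
  -- Third derivatives along e' involving the conjugate kernel direction vanish by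
  -- `LeviDegenerate.dirD_ζη`. If the remaining one vanished too, all would, against
  -- 2-nondegeneracy.
  · have hη := hl.dirD_ζη hp.analytic (by rw [zw]; exact_mod_cast hs) zη ζw ζη
    have he' : e' ≠ 0 := fun h0 => hδ (by simp [h0])
    obtain ⟨b, b', hb⟩ := h.two_nondegenerate hF he' h2
    apply hb
    have q1 : dirD (0, star e) (dirD (0, star e) (dirD (e', 0) Φ)) 0 = 0 := by
      rw [three, polLinear_w, polLinear_ζ] at h0
      exact h0
    have q2 : dirD (0, star e) (dirD (0, star e') (dirD (e', 0) Φ)) 0 = 0 := by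
      have := hη ew
      rw [three, polLinear_w, polLinear_η, polLinear_ζ] at this
      exact this
    have q3 : dirD (0, star e') (dirD (0, star e') (dirD (e', 0) Φ)) 0 = 0 := by
      have := hη eη
      rw [three, polLinear_η, polLinear_ζ] at this
      exact this
    have hδ' : star e.1 * star e'.2 - star e.2 * star e'.1 ≠ 0 := by
      have := star_ne_zero.2 hδ
      rwa [star_sub, star_mul', star_mul'] at this
    obtain ⟨δ, hδd⟩ : ∃ δ, star e.1 * star e'.2 - star e.2 * star e'.1 = δ := ⟨_, rfl⟩
    rw [hδd] at hδ'
    have hspan : ∀ b : ℂ × ℂ, ((0, b) : Pol) =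
        ((b.1 * star e'.2 - b.2 * star e'.1) / δ) • (0, star e) +
          ((b.2 * star e.1 - b.1 * star e.2) / δ) • (0, star e') := fun b => by
      ext
      · simp
      · simp
      · simp only [Prod.snd_add, Prod.smul_snd, Prod.fst_add, Prod.smul_fst, Prod.fst_star,
          smul_eq_mul]
        field_simp
        linear_combination -b.1 * hδd
      · simp only [Prod.snd_add, Prod.smul_snd, Prod.snd_star, smul_eq_mul]
        field_simp
        linear_combination -b.2 * hδd
    have hX := hΦ.dirD (e', 0)
    rw [hspan b', dirD_dirD_combination hX, hspan b, dirD_combination_apply, dirD_combination_apply,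
      dirD_comm hX (0, star e') (0, star e), q1, q2, q3]
    ring

end LinearNormalization

/-! ### Removing the pluriharmonic part -/

section PluriharmonicPart

variable {Φ : Pol → ℂ} {F : ℂ × ℂ → ℝ} {k₁ k₂ : ℂ × ℂ → ℂ}

theorem dirD_fst_comp (hk : AnalyticAt ℂ k₁ 0) (u : Pol) :
    ∀ᶠ v : Pol in 𝓝 0, dirD u (fun v : Pol => k₁ v.1) v = dirD u.1 k₁ v.1 :=
  dirD_comp_clm_eventually hk (ContinuousLinearMap.fst ℂ (ℂ × ℂ) (ℂ × ℂ)) u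

theorem dirD_snd_comp (hk : AnalyticAt ℂ k₂ 0) (u : Pol) :
    ∀ᶠ v : Pol in 𝓝 0, dirD u (fun v : Pol => k₂ v.2) v = dirD u.2 k₂ v.2 :=
  dirD_comp_clm_eventually hk (ContinuousLinearMap.snd ℂ (ℂ × ℂ) (ℂ × ℂ)) u

/-- Pluriharmonic terms do not contribute to mixed derivatives. -/
theorem dirD_anti_dirD_hol_add_pluriharmonic (hΦ : AnalyticAt ℂ Φ 0) (h₁ : AnalyticAt ℂ k₁ 0)
    (h₂ : AnalyticAt ℂ k₂ 0) (c : ℂ) (x y : ℂ × ℂ) :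
    dirD (0, y) (dirD (x, 0) fun v => c * Φ v + (k₁ v.1 + k₂ v.2)) =ᶠ[𝓝 0] fun v =>
      c * dirD (0, y) (dirD (x, 0) Φ) v := by
  have a₁ := analyticAt_fst_comp h₁
  have a₂ := analyticAt_snd_comp h₂
  have ac : AnalyticAt ℂ (fun v => c * Φ v) 0 := analyticAt_const.mul hΦ
  have e : dirD (x, 0) (fun v => c * Φ v + (k₁ v.1 + k₂ v.2)) =ᶠ[𝓝 0] fun v =>
      c * dirD (x, 0) Φ v + dirD x k₁ v.1 := by
    filter_upwards [dirD_fst_comp h₁ (x, 0), dirD_snd_comp h₂ (x, 0),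
      dirD_const_mul_eventually hΦ c (x, 0), a₁.eventually_analyticAt, a₂.eventually_analyticAt,
      ac.eventually_analyticAt] with v e1 e2 e3 e4 e5 e6
    rw [dirD_add (Ψ := fun v : Pol => k₁ v.1 + k₂ v.2) e6.differentiableAt
      (e4.add e5 : AnalyticAt ℂ (fun v : Pol => k₁ v.1 + k₂ v.2) v).differentiableAt,
      dirD_add e4.differentiableAt e5.differentiableAt, e1, e2, e3, dirD_zero_dir, add_zero]
  have bc : AnalyticAt ℂ (fun v => c * dirD (x, 0) Φ v) 0 := analyticAt_const.mul (hΦ.dirD _)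
  filter_upwards [e.dirD (0, y), dirD_fst_comp (h₁.dirD x) (0, y),
    dirD_const_mul_eventually (hΦ.dirD (x, 0)) c (0, y),
    (analyticAt_fst_comp (h₁.dirD x)).eventually_analyticAt, bc.eventually_analyticAt]
    with v e0 e1 e3 e4 e5
  rw [e0, dirD_add e5.differentiableAt e4.differentiableAt, e1, e3, dirD_zero_dir, add_zero]

theorem dirD_hol_dirD_anti_add_pluriharmonic (hΦ : AnalyticAt ℂ Φ 0) (h₁ : AnalyticAt ℂ k₁ 0)
    (h₂ : AnalyticAt ℂ k₂ 0) (c : ℂ) (x y : ℂ × ℂ) :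
    dirD (x, 0) (dirD (0, y) fun v => c * Φ v + (k₁ v.1 + k₂ v.2)) =ᶠ[𝓝 0] fun v =>
      c * dirD (x, 0) (dirD (0, y) Φ) v := by
  have ac : AnalyticAt ℂ (fun v : Pol => c * Φ v + (k₁ v.1 + k₂ v.2)) 0 :=
    (analyticAt_const.mul hΦ).add ((analyticAt_fst_comp h₁).add (analyticAt_snd_comp h₂))
  filter_upwards [dirD_comm_eventually ac (x, 0) (0, y), dirD_comm_eventually hΦ (x, 0) (0, y),
    dirD_anti_dirD_hol_add_pluriharmonic hΦ h₁ h₂ c x y] with v e1 e2 e3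
  rw [e1, e2, e3]

/-- Subtracting the pluriharmonic part and rescaling `w` makes the hypersurface Levi-normalized. -/
theorem IsPolarization.exists_leviNormalized (h : IsPolarization Φ F) (hF : AnalyticAt ℝ F 0)
    (hF0 : F 0 = 0) {s : ℝ} (hs : s ≠ 0) (hl : LeviDegenerate Φ)
    (zw : dirD ez (dirD ew Φ) 0 = s) (zη : dirD ez (dirD eη Φ) 0 = 0)
    (ζw : dirD eζ (dirD ew Φ) 0 = 0) (ζη : dirD eζ (dirD eη Φ) 0 = 0)
    (hn : dirD ew (dirD ew (dirD eζ Φ)) 0 ≠ 0) :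
    ∃ (F' : ℂ × ℂ → ℝ) (Φ' : Pol → ℂ), AnalyticAt ℝ F' 0 ∧ IsPolarization Φ' F' ∧
      RigidlyEquivalent (rigidHypersurface F) (rigidHypersurface F') ∧ LeviNormalized Φ' := by
  have hΦ := h.analytic
  have hk : AnalyticAt ℂ (fun Z => -(s : ℂ)⁻¹ * Φ (holSlice Z)) 0 :=
    analyticAt_const.mul (hΦ.comp_clm holSlice)
  set k : ℂ × ℂ → ℂ := fun Z => -(s : ℂ)⁻¹ * Φ (holSlice Z) with hkd
  have hs' : (s : ℂ) ≠ 0 := by exact_mod_cast hs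
  have hΦ0 : Φ 0 = 0 := by
    have := h.eq.self_of_nhds
    rwa [polDiag_zero, hF0, ofReal_zero] at this
  have hk0 : k 0 = 0 := by
    rw [hkd]
    beta_reduce
    rw [map_zero, hΦ0, mul_zero]
  have hck := analyticAt_conjFun hk
  -- The term k(Z) cancels Φ / s on {W = 0}, and its conjugate keeps the function Hermitian without
  -- disturbing that slice. Their sum is the polarization of Re (2k), realized by h = 2k in the
  -- rigid map.
  set Ψ : Pol → ℂ := fun v => (s : ℂ)⁻¹ * Φ v + (k v.1 + conjFun k v.2) with hΨd
  have hΨ : AnalyticAt ℂ Ψ 0 :=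
    (analyticAt_const.mul hΦ).add ((analyticAt_fst_comp hk).add (analyticAt_snd_comp hck))
  have mixed := dirD_hol_dirD_anti_add_pluriharmonic hΦ hk hck (s : ℂ)⁻¹
  have m11 := mixed (1, 0) (1, 0)
  have m12 := mixed (1, 0) (0, 1)
  have m21 := mixed (0, 1) (1, 0)
  have m22 := mixed (0, 1) (0, 1)
  have hp : IsPolarization Ψ fun p => s⁻¹ * F p + (2 * k p).re := by
    refine ⟨hΨ, ?_⟩
    filter_upwards [h.eq] with p hp
    rw [hΨd]
    beta_reduce
    rw [hp]
    push_cast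
    rw [re_eq_add_conj, map_mul, map_ofNat]
    simp only [polDiag, conjFun, star_star, star_def]
    ring
  refine ⟨_, Ψ, ?_, hp, ?_, ⟨hΨ, hp.hermitian, ?_, ?_, ?_, ?_, ?_, ?_, ?_⟩⟩
  · have hk2 : AnalyticAt ℝ (fun p => 2 * k p) 0 := (analyticAt_const.mul hk).restrictScalars
    exact (analyticAt_const.mul hF).add ((reCLM.analyticAt _).comp hk2)
  · refine .of_identity (f := fun Z => Z.1) (g := fun Z => Z.2) (h := fun Z => 2 * k Z)
      (ρ := s⁻¹) analyticAt_fst analyticAt_snd (analyticAt_const.mul hk) rfl rfl (by simp [hk0])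
      (inv_ne_zero hs) ?_ (.of_forall fun p => rfl)
    have dfst : ∀ u Z : ℂ × ℂ, dirD u (fun Z : ℂ × ℂ => Z.1) Z = u.1 := fun u Z =>
      dirD_clm (ContinuousLinearMap.fst ℂ ℂ ℂ) Z u
    have dsnd : ∀ u Z : ℂ × ℂ, dirD u (fun Z : ℂ × ℂ => Z.2) Z = u.2 := fun u Z =>
      dirD_clm (ContinuousLinearMap.snd ℂ ℂ ℂ) Z u
    simp only [dfst, dsnd]
    norm_num
  · filter_upwards [hl, m11, m12, m21, m22] with v e0 e1 e2 e3 e4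
    rw [e1, e2, e3, e4]
    linear_combination ((s : ℂ)⁻¹) ^ 2 * e0
  · refine .of_forall fun Z => ?_
    have : conjFun k 0 = 0 := conjFun_zero hk0
    change (s : ℂ)⁻¹ * Φ (holSlice Z) + (-(s : ℂ)⁻¹ * Φ (holSlice Z) + conjFun k 0) = 0
    rw [this]
    ring
  · exact m11.self_of_nhds.trans (by beta_reduce; rw [zw, inv_mul_cancel₀ hs'])
  · exact m12.self_of_nhds.trans (by beta_reduce; rw [zη, mul_zero])
  · exact m21.self_of_nhds.trans (by beta_reduce; rw [ζw, mul_zero])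
  · exact m22.self_of_nhds.trans (by beta_reduce; rw [ζη, mul_zero])
  · have := ((dirD_anti_dirD_hol_add_pluriharmonic hΦ hk hck (s : ℂ)⁻¹ (0, 1) (1, 0)).dirD ew).trans
      (dirD_const_mul_eventually ((hΦ.dirD eζ).dirD ew) (s : ℂ)⁻¹ ew)
    exact this.self_of_nhds.trans_ne (mul_ne_zero (inv_ne_zero hs') hn)

end PluriharmonicPart

/-! ### Existence of the normal form and conclusion -/

theorem InClassC21.exists_normalForm {F : ℂ × ℂ → ℝ} (hF : InClassC21 F) :
    ∃ (F' : ℂ × ℂ → ℝ) (G : ℕ → ℕ → ℕ → ℕ → ℂ),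
      InClassC21 F' ∧ IsNormalForm F' G ∧
      RigidlyEquivalent (rigidHypersurface F) (rigidHypersurface F') := by
  obtain ⟨Φ, hΦ⟩ := hF.exists_polarization
  obtain ⟨F₁, Φ₁, s, a₁, p₁, r₁, z₁, hs, l₁, zw, zη, ζw, ζη, n₁⟩ := hΦ.exists_linear hF
  obtain ⟨F₂, Φ₂, a₂, p₂, r₂, n₂⟩ := p₁.exists_leviNormalized a₁ z₁ hs l₁ zw zη ζw ζη n₁
  obtain ⟨f, g, u, v, hi, n₃, h4⟩ := n₂.exists_prenormal
  have p₃ := hi.isPolarization p₂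
  have a₃ := hi.analyticAt_real a₂
  set Φ₃ : Pol → ℂ := fun x => Φ₂ (polMap u v x)
  set F₃ : ℂ × ℂ → ℝ := fun p => F₂ (u p, v p)
  -- The shear adds 3c with c imaginary, so this c cancels exactly the imaginary part of
  -- `sporadicFive`.
  obtain ⟨c, hc, hc5⟩ : ∃ c : ℂ, star c = -c ∧ (sporadicFive Φ₃ + 3 * c).im = 0 :=
    ⟨-((sporadicFive Φ₃).im / 3 * I), by simp, by simp; ring⟩
  obtain ⟨n₄, e4, e5⟩ := n₃.shear hc
  have hj := n₃.isInverseGerm_shear c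
  have p₄ := hj.isPolarization p₃
  obtain ⟨G, hG⟩ := IsNormalForm.of_prenormal n₄ p₄ (e4.trans h4) (by rw [e5, hc5])
  exact ⟨_, G, .of_prenormal n₄ p₄ (hj.analyticAt_real a₃), hG,
    ((r₁.trans r₂).trans (hi.rigidlyEquivalent F₂)).trans (hj.rigidlyEquivalent F₃)⟩

theorem theorem1p13 :
    (∀ F : ℂ × ℂ → ℝ, InClassC21 F →
      ∃ (F' : ℂ × ℂ → ℝ) (G : ℕ → ℕ → ℕ → ℕ → ℂ),
        InClassC21 F' ∧ IsNormalForm F' G ∧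
        RigidlyEquivalent (rigidHypersurface F) (rigidHypersurface F')) ∧
    (∀ (F F' : ℂ × ℂ → ℝ) (G G' : ℕ → ℕ → ℕ → ℕ → ℂ),
      InClassC21 F → InClassC21 F' → IsNormalForm F G → IsNormalForm F' G' →
      (RigidlyEquivalent (rigidHypersurface F) (rigidHypersurface F') ↔
        ∃ ρ φ : ℝ, 0 < ρ ∧ ∀ a b c d : ℕ,
          G a b c d =
            G' a b c d * (ρ ^ (((a : ℝ) + (c : ℝ) - 2) / 2) : ℝ) *
              Complex.exp (I * (φ : ℂ) * ((a : ℂ) + 2 * (b : ℂ) - (c : ℂ) - 2 * (d : ℂ))))) := by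
  refine ⟨fun F hF => hF.exists_normalForm, fun F F' G G' hF hF' hG hG' => ⟨fun h =>
    IsNormalForm.coefficients_of_equivalent hF hF' hG hG' h, ?_⟩⟩
  rintro ⟨ρ, φ, hρ, h⟩
  exact .of_coefficients hG hG' hρ h
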